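/- Let $d\ge 1$, $n\ge 0$, $\nu>0$ and let $D$ be the unit ball of $Z=\mathbb C^d$ with $(\zeta|\omega)=\sum_i\zeta_i\overline{\omega_i}$ and genus $p=d+1$. Let $G$ be the automorphism group of $D$, realized by $SU(d,1)$ acting by fractional linear maps. Let $\mathcal P_\lambda Z$ be the $\lambda$-homogeneous polynomials on $Z$ and $\mathcal P^nZ=\sum_{\lambda\le n}\mathcal P_\lambda Z$ the polynomials of degree at most $n$. For $0\le\lambda\le n$ let the little space $H_\nu^2(D,\mathcal P_\lambda Z)$ be the Hilbert space of holomorphic maps $F:D\to\mathcal P_\lambda Z$, $z\mapsto F_z(\zeta)$, with continuous point evaluations, containing all polynomial maps, on which $G$ acts unitarily (projectively) by $(g^{-\alpha_\nu}F)_z(\zeta)=\det(\partial_zg)^{\nu/p}F_{g(z)}((\partial_zg)\zeta)$, and whose reproducing kernel is normalized by $K_{0,0}(\zeta,\omega)=(\zeta|\omega)^\lambda/\lambda!$; this space exists. A big space is a Hilbert space of holomorphic maps $F:D\to\mathcal P^nZ$ with continuous point evaluations, containing all polynomial maps, on which $G$ acts unitarily (projectively) by $$(g^{-\beta_\nu}F)_z(\zeta)=\det(\partial_zg)^{(\nu+n)/p}\det(\partial_{z+\zeta}g)^{-n/p}F_{g(z)}(g(z+\zeta)-g(z)).$$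 Its reproducing kernel, written as $K_{z,w}(\zeta,\omega)=\sum_\alpha F^\alpha_z(\zeta)\overline{F^\alpha_w(\omega)}$ for an orthonormal basis $F^\alpha$, is called a $G$-covariant kernel. Then for every big space there is exactly one tuple $\mathbf c=(c_\lambda)_{0\le\lambda\le n}$ of constants $c_\lambda>0$ for which it is the weighted orthogonal sum of the little spaces, that is, for which there are intertwining operators $\mathcal I_\lambda:H_\nu^2(D,\mathcal P_\lambda Z)\to H$, with $\mathcal I_\lambda q=q$ for maps $q$ constant in $z$, such that the $\sqrt{c_\lambda}\,\mathcal I_\lambda$ are isometries onto mutually orthogonal subspaces that span a dense subspace of $H$. Conversely, every tuple of constants $c_\lambda>0$ arises from such a big space. The corresponding kernel $K^{\nu,\mathbf c}$ satisfies $$K^{\nu,\mathbf c}_{0,0}(\zeta,\omega)=\sum_{\ell=0}^n(\zeta|\omega)^\ell\sum_{\lambda=0}^{\ell}\kappa^\lambda_\ell(\nu)\,\frac{c_\lambda}{\lambda!}\qquad(\zeta,\omega\in Z),$$ with the universal coefficients $$\kappa^\lambda_\ell(\nu)=\Big(\frac{(\lambda-n)_{\ell-\lambda}}{(\nu+2\lambda)_{\ell-\lambda}}\Big)^2\sum_{p+q=\ell-\lambda}\binom{\nu+\ell-1}{p}\binom{\lambda}{q}\qquad(0\le\lambda\le\ell\le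 n),$$ where $(x)_k=x(x+1)\cdots(x+k-1)$ and, in the sum, $p,q\ge 0$ are integers. -/

import Mathlib

open scoped InnerProductSpace

noncomputable section

namespace BallKernel

/-- The Hermitian space `Z = ℂ^d`. The form `(ζ|ω) = ∑ ζᵢ ω̄ᵢ`, linear in `ζ`, is
`inner ℂ ω ζ`. -/
abbrev Z (d : ℕ) : Type := EuclideanSpace ℂ (Fin d)

/-- The open unit ball `D` of `ℂ^d`. -/
abbrev D (d : ℕ) : Type := Metric.ball (0 : Z d) 1

/-- A map `z ↦ F_z(ζ)` from `D` to polynomials on `Z` is treated as the function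
`(z, ζ) ↦ F_z(ζ)` on `D × Z`. -/
abbrev Pt (d : ℕ) : Type := D d × Z d

/-- The origin of the ball. -/
def origin (d : ℕ) : D d := ⟨0, by simp⟩

/-! ### The group `SU(d,1)` acting on the ball by fractional linear maps -/

/-- Signature matrix `diag(1, …, 1, -1)`. -/
def sig (d : ℕ) : Matrix (Fin d ⊕ Unit) (Fin d ⊕ Unit) ℂ :=
  Matrix.diagonal (Sum.elim (fun _ => 1) (fun _ => -1))

/-- The group `SU(d,1)`. Through the fractional linear action below it is, up to its finite centre,
the group of all biholomorphic automorphisms of the unit ball. -/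
def SU (d : ℕ) : Set (Matrix (Fin d ⊕ Unit) (Fin d ⊕ Unit) ℂ) :=
  {g | g.conjTranspose * sig d * g = sig d ∧ g.det = 1}

variable {d : ℕ}

/-- Denominator of `g(z)`. For `g ∈ SU(d,1)` one has `det (∂_z g) = (den g z) ^ (-p)`, with the
genus `p = d + 1` of the ball. -/
def den (g : Matrix (Fin d ⊕ Unit) (Fin d ⊕ Unit) ℂ) (z : Z d) : ℂ :=
  (∑ j, g (Sum.inr ()) (Sum.inl j) * z j) + g (Sum.inr ()) (Sum.inr ())

/-- Numerator of `g(z)`. -/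
def num (g : Matrix (Fin d ⊕ Unit) (Fin d ⊕ Unit) ℂ) (z : Z d) (i : Fin d) : ℂ :=
  (∑ j, g (Sum.inl i) (Sum.inl j) * z j) + g (Sum.inl i) (Sum.inr ())

/-- The fractional linear map `z ↦ g(z)`, meaningful where `den g z ≠ 0`. -/
def act (g : Matrix (Fin d ⊕ Unit) (Fin d ⊕ Unit) ℂ) (z : Z d) : Z d :=
  WithLp.toLp 2 fun i => num g z i / den g z

theorem normSq_den_sub {g : Matrix (Fin d ⊕ Unit) (Fin d ⊕ Unit) ℂ} (hg : g ∈ SU d) (z : Z d) :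
    ‖den g z‖ ^ 2 - ∑ i, ‖num g z i‖ ^ 2 = 1 - ‖z‖ ^ 2 := by
  set v : Fin d ⊕ Unit → ℂ := Sum.elim (fun i => z i) (fun _ => 1) with hv
  have key : ∀ u : Fin d ⊕ Unit → ℂ, star u ⬝ᵥ (Matrix.mulVec (sig d) u) =
      ((∑ i, ‖u (Sum.inl i)‖ ^ 2 - ‖u (Sum.inr ())‖ ^ 2 : ℝ) : ℂ) := by
    intro u
    simp [dotProduct, sig, Matrix.mulVec_diagonal, sub_eq_add_neg, ← Complex.conj_mul']
  have h1 : star (Matrix.mulVec g v) ⬝ᵥ (Matrix.mulVec (sig d) (Matrix.mulVec g v)) =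
      star v ⬝ᵥ (Matrix.mulVec (sig d) v) := by
    conv_rhs => rw [← hg.1]
    rw [Matrix.star_mulVec, ← Matrix.dotProduct_mulVec, Matrix.mulVec_mulVec, Matrix.mulVec_mulVec,
      Matrix.mul_assoc]
  rw [key, key] at h1
  have h2 := Complex.ofReal_injective h1
  have h3 : ∀ i, Matrix.mulVec g v (Sum.inl i) = num g z i := by
    intro i
    simp [Matrix.mulVec, dotProduct, num, hv]
  have h4 : Matrix.mulVec g v (Sum.inr ()) = den g z := by
    simp [Matrix.mulVec, dotProduct, den, hv]
  simp only [h3, h4] at h2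
  simp only [hv, Sum.elim_inl, Sum.elim_inr, norm_one, ← EuclideanSpace.norm_sq_eq] at h2
  linarith

theorem act_mem_ball {g : Matrix (Fin d ⊕ Unit) (Fin d ⊕ Unit) ℂ} (hg : g ∈ SU d) (z : D d) :
    act g z ∈ Metric.ball (0 : Z d) 1 := by
  have hz : ‖(z : Z d)‖ < 1 := mem_ball_zero_iff.mp z.2
  have h := normSq_den_sub hg (z : Z d)
  have hlt : ∑ i, ‖num g (z : Z d) i‖ ^ 2 < ‖den g (z : Z d)‖ ^ 2 := by
    nlinarith [norm_nonneg (z : Z d)]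
  have hpos : 0 < ‖den g (z : Z d)‖ ^ 2 :=
    lt_of_le_of_lt (Finset.sum_nonneg fun i _ => by positivity) hlt
  have h5 : ‖act g (z : Z d)‖ ^ 2 < 1 := by
    rw [EuclideanSpace.norm_sq_eq]
    simp only [act, norm_div, div_pow, ← Finset.sum_div]
    rwa [div_lt_one hpos]
  rw [mem_ball_zero_iff]
  nlinarith [norm_nonneg (act g (z : Z d))]

/-- The action of `SU(d,1)` on the ball. -/
def actBall (g : SU d) (z : D d) : D d := ⟨act g.1 z, act_mem_ball g.2 z⟩

/-- The holomorphic branch on the ball of `det (∂_z g) ^ (ν / p) = (den g z) ^ (-ν)` that is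
positive at `z = 0`. (A branch is determined up to a constant of modulus one; on the ball
`den g z / den g 0` lies in the right half plane.) -/
def detPow (ν : ℝ) (g : SU d) (z : D d) : ℂ :=
  ((‖den g.1 0‖ ^ (-ν) : ℝ) : ℂ) * (den g.1 z / den g.1 0) ^ (-(ν : ℂ))

/-! ### The multiplier actions -/

/-- `F'` is the transform of `F` under `g⁻¹` in the action
`(g^{-α} F)_z(ζ) = det(∂_z g)^{ν/p} F_{g(z)}((∂_z g) ζ)`. -/
def IsLittleTranslate (ν : ℝ) (g : SU d) (F F' : Pt d → ℂ) : Prop :=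
  ∀ (z : D d) (ζ : Z d),
    F' (z, ζ) = detPow ν g z * F (actBall g z, fderiv ℂ (act g.1) (z : Z d) ζ)

/-- `F'` is the transform of `F` under `g⁻¹` in the action
`(g^{-β} F)_z(ζ) = det(∂_z g)^{(ν+n)/p} det(∂_{z+ζ} g)^{-n/p} F_{g(z)}(g(z+ζ) - g(z))`.
Both sides being polynomial in `ζ`, the identity is required where `g(z+ζ)` is finite. -/
def IsBigTranslate (ν : ℝ) (n : ℕ) (g : SU d) (F F' : Pt d → ℂ) : Prop :=
  ∀ (z : D d) (ζ : Z d), den g.1 (z + ζ) ≠ 0 →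
    F' (z, ζ) = detPow ν g z * (den g.1 (z + ζ) / den g.1 z) ^ n *
      F (actBall g z, act g.1 (z + ζ) - act g.1 z)

/-! ### Hilbert spaces of holomorphic maps from the ball to polynomials -/

/-- `F` is a holomorphic map from the ball to the finite-dimensional space `V` of polynomials. -/
def IsHolomorphicMap (V : Submodule ℂ (MvPolynomial (Fin d) ℂ)) (F : Pt d → ℂ) : Prop :=
  (∀ z : D d, ∃ q ∈ V, ∀ ζ : Z d, F (z, ζ) = MvPolynomial.eval ζ q) ∧
  ∀ ζ : Z d, ∃ f : Z d → ℂ, DifferentiableOn ℂ f (Metric.ball 0 1) ∧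
    ∀ z : D d, F (z, ζ) = f z

section Spaces

variable (H : Type*) [NormedAddCommGroup H] [InnerProductSpace ℂ H] [CompleteSpace H]
  [RKHS ℂ H (Pt d) ℂ]

/-- The elements of `H` are holomorphic maps from the ball to `V`, and `H` contains all
polynomial maps (which are spanned by the maps `z ↦ p(z) q`, with `p` a polynomial and `q ∈ V`). -/
def IsSpaceOfMaps (V : Submodule ℂ (MvPolynomial (Fin d) ℂ)) : Prop :=
  (∀ F : H, IsHolomorphicMap V F) ∧
  ∀ p : MvPolynomial (Fin d) ℂ, ∀ q ∈ V, ∃ F : H, ∀ (z : D d) (ζ : Z d),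
    F (z, ζ) = MvPolynomial.eval (z : Z d) p * MvPolynomial.eval ζ q

/-- The scalar kernel `K_{z,w}(ζ,ω)` of the reproducing kernel of `H`, for `x = (z, ζ)` and
`y = (w, ω)`. It equals `∑ F_z(ζ) conj(F_w(ω))`, summed over an orthonormal basis of `H`. -/
def ker (x y : Pt d) : ℂ := RKHS.kernel H x y 1

/-- `H` is the little Hilbert space of parameter `ν` of maps into the `l`-homogeneous polynomials:
the group acts unitarily (up to constants of modulus one, which depend on the branches chosen),
and the kernel is normalized at the origin by the Fischer-Fock kernel `(ζ|ω)^l / l!`. -/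
structure IsLittleSpace (ν : ℝ) (l : ℕ) : Prop where
  maps : IsSpaceOfMaps H (MvPolynomial.homogeneousSubmodule (Fin d) ℂ l)
  unitary : ∀ (g : SU d) (F : H), ∃ F' : H, IsLittleTranslate ν g F F' ∧ ‖F'‖ = ‖F‖
  normalized : ∀ ζ ω : Z d,
    ker H (origin d, ζ) (origin d, ω) = (inner ℂ ω ζ) ^ l / (l.factorial : ℂ)

/-- `H` is a big Hilbert space of parameter `ν` with a covariant kernel: a space of maps into the
polynomials of degree at most `n` on which the group acts unitarily (up to constants). -/
structure IsBigSpace (ν : ℝ) (n : ℕ) : Prop where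
  maps : IsSpaceOfMaps H (MvPolynomial.restrictTotalDegree (Fin d) ℂ n)
  unitary : ∀ (g : SU d) (F : H), ∃ F' : H, IsBigTranslate ν n g F F' ∧ ‖F'‖ = ‖F‖

/-- `H` is the orthogonal direct sum of the images of the little spaces `L l`, `l ≤ n`, with weights
`c l`: there are intertwining operators `I l : L l → H`, normalized by `I l q = q` for the maps `q`
constant in `z`, such that the `√(c l) • I l` are isometries onto orthogonal subspaces that span a
dense subspace of `H`. Equivalently, the `√(c l) • I l Φ`, with `Φ` in an orthonormal basis of
`L l` and `l ≤ n`, form an orthonormal basis of `H`. In the definition, `V l = √(c l) • I l`. -/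
def IsWeightedSum (ν : ℝ) (n : ℕ) (c : Fin (n + 1) → ℝ) (L : Fin (n + 1) → Type*)
    [∀ l, NormedAddCommGroup (L l)] [∀ l, InnerProductSpace ℂ (L l)]
    [∀ l, RKHS ℂ (L l) (Pt d) ℂ] : Prop :=
  ∃ V : ∀ l, L l →ₗᵢ[ℂ] H, IsHilbertSum ℂ L V ∧
    (∀ (l : Fin (n + 1)) (g : SU d) (F F' : L l),
      IsLittleTranslate ν g F F' → IsBigTranslate ν n g (V l F) (V l F')) ∧
    ∀ (l : Fin (n + 1)) (F : L l), (∀ (z w : D d) (ζ : Z d), F (z, ζ) = F (w, ζ)) →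
      ∀ x : Pt d, V l F x = (Real.sqrt (c l) : ℂ) * F x

end Spaces

/-- The Pochhammer symbol `(x)_k = x (x + 1) ⋯ (x + k - 1)`. -/
def poch (x : ℝ) (k : ℕ) : ℝ := ∏ i ∈ Finset.range k, (x + i)

/-- The generalized binomial coefficient `x (x - 1) ⋯ (x - k + 1) / k!`. -/
def binom (x : ℝ) (k : ℕ) : ℝ := (∏ i ∈ Finset.range k, (x - i)) / (k.factorial : ℝ)

/-- The coefficients `κ^l_m(ν)`, for `l ≤ m ≤ n`. -/
def kappa (n : ℕ) (ν : ℝ) (l m : ℕ) : ℝ :=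
  (poch ((l : ℝ) - n) (m - l) / poch (ν + 2 * l) (m - l)) ^ 2 *
    ∑ pq ∈ Finset.HasAntidiagonal.antidiagonal (m - l), binom (ν + m - 1) pq.1 * (l.choose pq.2 : ℝ)

end BallKernel

end

/-! ### The action of `SU(d,1)` on the ball: cocycle laws, inverses, branches and derivatives -/

open scoped InnerProductSpace
noncomputable section
namespace BallKernel
variable {d : ℕ}

/-! The little space has the explicit kernel `(1 - (z|w))^(-ν) (B(z,w)⁻¹ζ|ω)^l / l!`, called `lK`.
It is positive because it expands into a convergent series of positive kernels (binomial series for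
the first factor; the mixed derivative of `-log(1 - (z|w))` for the second), and these series
dominate all monomials, so the associated Hilbert space contains all polynomial maps. Covariance of
`lK` is the invariance of the form of signature `(d,1)` in homogeneous coordinates.

The bridge from little to big spaces is the operator `iop`, that is `F ↦ ∑ A_k (ζ·∂_z)^k F / k!`
with `A_k = (l-n)_k / (ν+2l)_k` and `k ≤ n - l`. Fractional linear maps send lines to lines, so its
intertwining property can be checked on `t ↦ F_{z+tζ}(ζ)`. There the little action is a change of
variable `t ↦ t/(1+at)` with multiplier `(1+at)^(-(ν+2l))`. The `A_k` are exactly such that the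
resulting triangular sum of Taylor coefficients collapses by the binomial theorem to powers of `1+a`
(`sum_icoeff_tc_moebius`, `iop_translate`). Any intertwiner agreeing with `iop`, up to a scalar, on
maps constant in `z` agrees with it everywhere, since translates of such maps have dense span
(`intertwiner_eq`). Evaluating `iop` at a point is a bounded functional, represented by a vector
`iopVec`; the kernels `∑ c_l (iopVec x | iopVec y)` are then covariant and positive, and they are
the kernels of the weighted sums.

Conversely, a covariant Hermitian kernel, holomorphic in its first point, is determined by its
values at the origin, by transitivity and analytic continuation from the circle action
(`Covariant.eq_zero`). At the origin the stabilizer forces a big kernel to be `∑ k_m (ζ|ω)^m` with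
real `k_m` (`Covariant.exists_origin_coeff`). The `l`-th summand contributes `A_k² (ν+2l)_k / (k!
l!) (ζ|ω)^(l+k)`, whose coefficient is `κ / l!` by the Chu–Vandermonde identity (`kappa_eq`). The
matrix passing from the `c_l` to the `k_m` is triangular with diagonal `1/l!`, hence invertible,
which gives existence and uniqueness of the weights. They are positive because the big space
contains the maps constant in `z`: such a map of degree `l` yields a Cauchy–Schwarz bound that fails
when `c_l ≤ 0` (`IsBigSpace.weight_pos`). -/

/-- Square matrices of size `d + 1`, with rows and columns split as `d + 1`. -/
abbrev Mat (d : ℕ) : Type := Matrix (Fin d ⊕ Unit) (Fin d ⊕ Unit) ℂ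

/-- Homogeneous coordinates `(z, 1)`. -/
def hom (z : Z d) : Fin d ⊕ Unit → ℂ := Sum.elim (fun i => z i) (fun _ => 1)

theorem mulVec_hom_inl (g : Mat d) (z : Z d) (i : Fin d) :
    g.mulVec (hom z) (Sum.inl i) = num g z i := by
  simp [Matrix.mulVec, dotProduct, num, hom]

theorem mulVec_hom_inr (g : Mat d) (z : Z d) : g.mulVec (hom z) (Sum.inr ()) = den g z := by
  simp [Matrix.mulVec, dotProduct, den, hom]

/-- The fractional linear action is the linear action on homogeneous coordinates made projective,
with `den` as the scaling factor. The cocycle law for `den` and the action law for `act` are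
therefore associativity of matrix products. -/
theorem mulVec_hom (g : Mat d) (z : Z d) (hz : den g z ≠ 0) :
    g.mulVec (hom z) = den g z • hom (act g z) := by
  ext (i | i)
  · rw [mulVec_hom_inl]
    simp [hom, act, mul_div_cancel₀ _ hz]
  · rw [mulVec_hom_inr]
    simp [hom]

theorem den_mul (g k : Mat d) (z : Z d) (hz : den k z ≠ 0) :
    den (g * k) z = den k z * den g (act k z) := by
  rw [← mulVec_hom_inr, ← Matrix.mulVec_mulVec, mulVec_hom k z hz, Matrix.mulVec_smul,
    Pi.smul_apply, mulVec_hom_inr, smul_eq_mul]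

theorem act_mul (g k : Mat d) (z : Z d) (hz : den k z ≠ 0) :
    act (g * k) z = act g (act k z) := by
  ext i
  simp only [act, den_mul g k z hz]
  rw [← mulVec_hom_inl, ← Matrix.mulVec_mulVec, mulVec_hom k z hz, Matrix.mulVec_smul,
    Pi.smul_apply, mulVec_hom_inl, smul_eq_mul, mul_div_mul_left _ _ hz]
  rfl

theorem den_one (z : Z d) : den (1 : Mat d) z = 1 := by
  simp [den]

theorem act_one (z : Z d) : act (1 : Mat d) z = z := by
  ext i
  simp [act, num, den, Matrix.one_apply]

theorem sig_mul_sig : sig d * sig d = 1 := by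
  rw [sig, Matrix.diagonal_mul_diagonal, ← Matrix.diagonal_one]
  congr 1
  ext (i | i) <;> simp

theorem conjTranspose_sig : (sig d).conjTranspose = sig d := by
  rw [sig, Matrix.diagonal_conjTranspose]
  congr 1
  ext (i | i) <;> simp

theorem inv_mul_of_mem {g : Mat d} (hg : g ∈ SU d) :
    (sig d * g.conjTranspose * sig d) * g = 1 := by
  rw [mul_assoc, mul_assoc, ← mul_assoc _ (sig d) g, hg.1, sig_mul_sig]

theorem mul_inv_of_mem {g : Mat d} (hg : g ∈ SU d) :
    g * (sig d * g.conjTranspose * sig d) = 1 :=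
  mul_eq_one_comm.mp (inv_mul_of_mem hg)

theorem inv_mem {g : Mat d} (hg : g ∈ SU d) : sig d * g.conjTranspose * sig d ∈ SU d := by
  constructor
  · have h := mul_inv_of_mem hg
    rw [Matrix.conjTranspose_mul, Matrix.conjTranspose_mul, Matrix.conjTranspose_conjTranspose,
      conjTranspose_sig]
    calc _ = sig d * (g * ((sig d * sig d) * sig d * g.conjTranspose * sig d)) := by
          simp only [mul_assoc]
      _ = sig d := by rw [sig_mul_sig, one_mul, h, mul_one]
  · have h := congrArg Matrix.det (inv_mul_of_mem hg)
    rwa [Matrix.det_mul, hg.2, mul_one, Matrix.det_one] at h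

/-- The inverse in `SU(d,1)`. -/
def inv (g : SU d) : SU d := ⟨sig d * g.1.conjTranspose * sig d, inv_mem g.2⟩

theorem den_ne_zero (g : SU d) {z : Z d} (hz : z ∈ Metric.ball (0 : Z d) 1) : den g.1 z ≠ 0 := by
  intro h0
  have h := normSq_den_sub g.2 z
  have hz' : ‖z‖ < 1 := mem_ball_zero_iff.mp hz
  rw [h0] at h
  have : 0 ≤ ∑ i, ‖num g.1 z i‖ ^ 2 := Finset.sum_nonneg fun i _ => by positivity
  simp only [norm_zero] at h
  nlinarith [norm_nonneg z]

theorem den_zero_ne (g : SU d) : den g.1 0 ≠ 0 := den_ne_zero g (by simp)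

theorem act_inv_act (g : SU d) {z : Z d} (hz : den g.1 z ≠ 0) :
    act (inv g).1 (act g.1 z) = z := by
  rw [← act_mul _ _ _ hz]
  simp only [inv, inv_mul_of_mem g.2, act_one]

theorem den_inv_act (g : SU d) {z : Z d} (hz : den g.1 z ≠ 0) :
    den g.1 z * den (inv g).1 (act g.1 z) = 1 := by
  rw [← den_mul _ _ _ hz]
  simp only [inv, inv_mul_of_mem g.2, den_one]

theorem inv_inv (g : SU d) : inv (inv g) = g := by
  apply Subtype.ext
  simp only [inv, Matrix.conjTranspose_mul, Matrix.conjTranspose_conjTranspose, conjTranspose_sig]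
  calc _ = (sig d * sig d) * g.1 * (sig d * sig d) := by simp only [mul_assoc]
    _ = g.1 := by rw [sig_mul_sig, one_mul, mul_one]

/-- The linear part of the denominator. -/
def denLin (g : Mat d) (ζ : Z d) : ℂ := ∑ j, g (Sum.inr ()) (Sum.inl j) * ζ j

/-- The linear part of the numerator. -/
def numLin (g : Mat d) (ζ : Z d) (i : Fin d) : ℂ := ∑ j, g (Sum.inl i) (Sum.inl j) * ζ j

theorem den_eq (g : Mat d) (z : Z d) : den g z = denLin g z + den g 0 := by
  simp [den, denLin]

theorem den_add_smul (g : Mat d) (z ζ : Z d) (t : ℂ) :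
    den g (z + t • ζ) = den g z + t * denLin g ζ := by
  simp only [den, denLin, PiLp.add_apply, PiLp.smul_apply, smul_eq_mul, mul_add,
    Finset.sum_add_distrib, Finset.mul_sum]
  rw [add_right_comm]
  congr 2
  ext i
  ring

theorem num_add_smul (g : Mat d) (z ζ : Z d) (t : ℂ) (i : Fin d) :
    num g (z + t • ζ) i = num g z i + t * numLin g ζ i := by
  simp only [num, numLin, PiLp.add_apply, PiLp.smul_apply, smul_eq_mul, mul_add,
    Finset.sum_add_distrib, Finset.mul_sum]
  rw [add_right_comm]
  congr 2
  ext i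
  ring

theorem den_inv_zero (g : SU d) : den (inv g).1 0 = star (den g.1 0) := by
  simp [den, inv, sig]

/-- Otherwise `z` could be rescaled, by a factor of modulus at most one, to a zero of the
denominator inside the ball. -/
theorem norm_denLin_lt (g : SU d) {z : Z d} (hz : z ∈ Metric.ball (0 : Z d) 1) :
    ‖denLin g.1 z‖ < ‖den g.1 0‖ := by
  by_contra! h
  have hpos : 0 < ‖den g.1 0‖ := norm_pos_iff.mpr (den_zero_ne g)
  have hne : denLin g.1 z ≠ 0 := norm_pos_iff.mp (hpos.trans_le h)
  have hmem : (-(den g.1 0) / denLin g.1 z) • z ∈ Metric.ball (0 : Z d) 1 := by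
    rw [mem_ball_zero_iff, norm_smul, norm_div, norm_neg]
    have h1 : ‖den g.1 0‖ / ‖denLin g.1 z‖ ≤ 1 := (div_le_one (hpos.trans_le h)).mpr h
    exact (mul_le_of_le_one_left (norm_nonneg _) h1).trans_lt (mem_ball_zero_iff.mp hz)
  refine den_ne_zero g hmem ?_
  have := den_add_smul g.1 0 z (-(den g.1 0) / denLin g.1 z)
  rw [zero_add] at this
  rw [this, div_mul_cancel₀ _ hne, add_neg_cancel]

/-- This keeps the base of the power in `detPow` in the right half plane, where principal branches
can be multiplied. -/
theorem re_den_div_pos (g : SU d) {z : Z d} (hz : z ∈ Metric.ball (0 : Z d) 1) :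
    0 < (den g.1 z / den g.1 0).re := by
  have h0 := den_zero_ne g
  rw [den_eq, add_div, div_self h0, Complex.add_re, Complex.one_re]
  have h1 : ‖denLin g.1 z / den g.1 0‖ < 1 := by
    rw [norm_div, div_lt_one (norm_pos_iff.mpr h0)]
    exact norm_denLin_lt g hz
  have h2 := (abs_le.mp (Complex.abs_re_le_norm (denLin g.1 z / den g.1 0))).1
  linarith

theorem log_mul_of_re_pos {x y : ℂ} (hx : 0 < x.re) (hy : 0 < y.re) :
    Complex.log (x * y) = Complex.log x + Complex.log y := by
  have hx0 : x ≠ 0 := fun h => by simp [h] at hx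
  have hy0 : y ≠ 0 := fun h => by simp [h] at hy
  refine Complex.log_mul hx0 hy0 ?_
  have h1 := abs_lt.mp (Complex.abs_arg_lt_pi_div_two_iff.mpr (Or.inl hx))
  have h2 := abs_lt.mp (Complex.abs_arg_lt_pi_div_two_iff.mpr (Or.inl hy))
  constructor <;> linarith [h1.1, h1.2, h2.1, h2.2]

theorem mul_cpow_of_re_pos {x y : ℂ} (hx : 0 < x.re) (hy : 0 < y.re) (a : ℂ) :
    (x * y) ^ a = x ^ a * y ^ a := by
  have hx0 : x ≠ 0 := fun h => by simp [h] at hx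
  have hy0 : y ≠ 0 := fun h => by simp [h] at hy
  rw [Complex.cpow_def_of_ne_zero (mul_ne_zero hx0 hy0), Complex.cpow_def_of_ne_zero hx0,
    Complex.cpow_def_of_ne_zero hy0, log_mul_of_re_pos hx hy, ← Complex.exp_add, add_mul]

/-- The two normalized denominators multiply to the positive number `‖den g 0‖⁻²`. Its `(-ν)`-th
power cancels the two positive factors `‖den g 0‖ ^ (-ν)`, so no phase remains. -/
theorem detPow_mul_detPow_inv (ν : ℝ) (g : SU d) (z : D d) :
    detPow ν g z * detPow ν (inv g) (actBall g z) = 1 := by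
  have hz := z.2
  have h1 := re_den_div_pos g hz
  have h2 := re_den_div_pos (inv g) (actBall g z).2
  have h0 := den_zero_ne g
  have hn : 0 < ‖den g.1 0‖ := norm_pos_iff.mpr h0
  have key : den g.1 (z : Z d) / den g.1 0 *
      (den (inv g).1 (actBall g z : Z d) / den (inv g).1 0) = ((‖den g.1 0‖ ^ 2 : ℝ) : ℂ)⁻¹ := by
    rw [div_mul_div_comm, show (actBall g z : Z d) = act g.1 z from rfl,
      den_inv_act g (den_ne_zero g hz), den_inv_zero]
    simp [Complex.mul_conj']
  have e : detPow ν g z * detPow ν (inv g) (actBall g z) =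
      ((‖den g.1 0‖ ^ (-ν) * ‖den g.1 0‖ ^ (-ν) : ℝ) : ℂ) *
      ((den g.1 (z : Z d) / den g.1 0) ^ (-(ν : ℂ)) *
      (den (inv g).1 (actBall g z : Z d) / den (inv g).1 0) ^ (-(ν : ℂ))) := by
    simp only [detPow, den_inv_zero, norm_star]
    push_cast
    ring
  rw [e, ← mul_cpow_of_re_pos h1 h2, key, ← Complex.ofReal_inv, ← Complex.ofReal_neg,
    ← Complex.ofReal_cpow (by positivity), ← Complex.ofReal_mul, ← Complex.ofReal_one]
  congr 1
  rw [Real.inv_rpow (by positivity), ← Real.rpow_natCast, ← Real.rpow_mul hn.le,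
    ← Real.rpow_neg hn.le, ← Real.rpow_add hn, ← Real.rpow_add hn]
  norm_num
  ring_nf
  simp

theorem detPow_ne_zero (ν : ℝ) (g : SU d) (z : D d) : detPow ν g z ≠ 0 := fun h => by
  simpa [h] using detPow_mul_detPow_inv ν g z

theorem sig_form_hom (z w : Z d) :
    star (hom w) ⬝ᵥ (sig d).mulVec (hom z) = inner ℂ w z - 1 := by
  simp [dotProduct, sig, Matrix.mulVec_diagonal, hom, PiLp.inner_apply, sub_eq_add_neg, mul_comm]

theorem sig_form_mulVec {g : Mat d} (hg : g.conjTranspose * sig d * g = sig d)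
    (u v : Fin d ⊕ Unit → ℂ) :
    star (g.mulVec u) ⬝ᵥ (sig d).mulVec (g.mulVec v) = star u ⬝ᵥ (sig d).mulVec v := by
  conv_rhs => rw [← hg]
  rw [Matrix.star_mulVec, ← Matrix.dotProduct_mulVec, Matrix.mulVec_mulVec, Matrix.mulVec_mulVec,
    Matrix.mul_assoc]

/-- The invariant form takes the value `(z|w) - 1` on the homogeneous coordinates of `z` and `w`. -/
theorem one_sub_inner_act (g : SU d) {z w : Z d} (hz : den g.1 z ≠ 0) (hw : den g.1 w ≠ 0) :
    den g.1 z * star (den g.1 w) * (1 - inner ℂ (act g.1 w) (act g.1 z)) = 1 - inner ℂ w z := by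
  have h := sig_form_mulVec g.2.1 (hom w) (hom z)
  rw [mulVec_hom _ _ hz, mulVec_hom _ _ hw, star_smul, Matrix.mulVec_smul, smul_dotProduct,
    dotProduct_smul, sig_form_hom, sig_form_hom] at h
  simp only [smul_eq_mul] at h
  linear_combination -h

/-- The derivative of `act g` at `z`. -/
def actDeriv (g : Mat d) (z ζ : Z d) : Z d :=
  WithLp.toLp 2 fun i => (numLin g ζ i * den g z - num g z i * denLin g ζ) / den g z ^ 2

/-- Lines go to lines, with a fractional linear reparametrization. This exact formula reduces the
intertwining property to one complex variable, and differentiating it at `t = 0` identifies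
`actDeriv` as the derivative. -/
theorem act_add_smul (g : Mat d) (z ζ : Z d) (t : ℂ) (hz : den g z ≠ 0)
    (ht : den g (z + t • ζ) ≠ 0) :
    act g (z + t • ζ) = act g z + (t * den g z / den g (z + t • ζ)) • actDeriv g z ζ := by
  ext i
  simp only [act, actDeriv, PiLp.add_apply, PiLp.smul_apply, smul_eq_mul]
  have e := num_add_smul g z ζ t i
  have e2 := den_add_smul g z ζ t
  rw [e]
  field_simp
  rw [e2]
  ring

theorem hasFDerivAt_linear_form (a : Fin d → ℂ) (b : ℂ) (z : Z d) :
    ∃ L : Z d →L[ℂ] ℂ, (∀ ζ, L ζ = ∑ j, a j * ζ j) ∧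
      HasFDerivAt (fun z : Z d => (∑ j, a j * z j) + b) L z := by
  refine ⟨∑ j, a j • EuclideanSpace.proj j, fun ζ => by simp, ?_⟩
  refine HasFDerivAt.add_const b ?_
  refine ((∑ j, a j • (EuclideanSpace.proj j : Z d →L[ℂ] ℂ)).hasFDerivAt (x := z)).congr_of_eventuallyEq ?_
  refine Filter.Eventually.of_forall fun z => by simp

theorem hasFDerivAt_den (g : Mat d) (z : Z d) :
    ∃ L : Z d →L[ℂ] ℂ, (∀ ζ, L ζ = denLin g ζ) ∧ HasFDerivAt (den g) L z :=
  hasFDerivAt_linear_form _ _ z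

theorem differentiable_den (g : Mat d) : Differentiable ℂ (den g) := fun z => by
  obtain ⟨L, -, h⟩ := hasFDerivAt_den g z
  exact h.differentiableAt

theorem differentiableAt_act (g : Mat d) {z : Z d} (hz : den g z ≠ 0) :
    DifferentiableAt ℂ (act g) z := by
  have : ∀ i, DifferentiableAt ℂ (fun z : Z d => num g z i / den g z) z := by
    intro i
    obtain ⟨L, -, h⟩ := hasFDerivAt_linear_form (fun j => g (Sum.inl i) (Sum.inl j))
      (g (Sum.inl i) (Sum.inr ())) z
    simp only [div_eq_mul_inv]
    exact h.differentiableAt.mul ((differentiable_den g z).inv hz)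
  exact (differentiableAt_euclidean (𝕜 := ℂ)).mpr this

theorem fderiv_act (g : Mat d) {z : Z d} (hz : den g z ≠ 0) (ζ : Z d) :
    fderiv ℂ (act g) z ζ = actDeriv g z ζ := by
  have h1 : HasDerivAt (fun t : ℂ => act g (z + t • ζ)) (fderiv ℂ (act g) z ζ) 0 := by
    have hd : HasFDerivAt (act g) (fderiv ℂ (act g) z) (z + (0 : ℂ) • ζ) := by
      simpa using (differentiableAt_act g hz).hasFDerivAt
    have hl : HasDerivAt (fun t : ℂ => z + t • ζ) ζ 0 := by
      simpa using ((hasDerivAt_id (0 : ℂ)).smul_const ζ).const_add z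
    exact hd.comp_hasDerivAt (0 : ℂ) hl
  have hden : HasDerivAt (fun t : ℂ => den g z + t * denLin g ζ) (denLin g ζ) 0 := by
    simpa using ((hasDerivAt_id (0 : ℂ)).mul_const (denLin g ζ)).const_add (den g z)
  have h2 : HasDerivAt (fun t : ℂ => act g z +
      (t * den g z / (den g z + t * denLin g ζ)) • actDeriv g z ζ) (actDeriv g z ζ) 0 := by
    have : HasDerivAt (fun t : ℂ => t * den g z / (den g z + t * denLin g ζ)) 1 0 := by
      have := ((hasDerivAt_id (0 : ℂ)).mul_const (den g z)).div hden (by simpa using hz)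
      refine HasDerivAt.congr_deriv this ?_
      simp only [zero_mul, add_zero, id, sub_zero, one_mul]
      field_simp
    simpa using (this.smul_const (actDeriv g z ζ)).const_add (act g z)
  refine h1.unique (h2.congr_of_eventuallyEq ?_)
  have hev : ∀ᶠ t : ℂ in nhds 0, den g z + t * denLin g ζ ≠ 0 :=
    hden.continuousAt.eventually_ne (by simpa using hz)
  filter_upwards [hev] with t ht
  rw [← den_add_smul] at ht ⊢
  exact act_add_smul g z ζ t hz ht

end BallKernel
end

/-! ### Special elements of `SU(d,1)`: reflections, rotations and transitivity -/

open scoped InnerProductSpace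
noncomputable section
namespace BallKernel
variable {d : ℕ}

theorem den_smul (c : ℂ) (g : Mat d) (z : Z d) : den (c • g) z = c * den g z := by
  rw [← mulVec_hom_inr, ← mulVec_hom_inr, Matrix.smul_mulVec]
  rfl

theorem act_smul {c : ℂ} (hc : c ≠ 0) (g : Mat d) (z : Z d) : act (c • g) z = act g z := by
  ext i
  simp only [act, den_smul]
  rw [← mulVec_hom_inl, ← mulVec_hom_inl, Matrix.smul_mulVec, Pi.smul_apply, smul_eq_mul,
    mul_div_mul_left _ _ hc]

/-- Preservation of the form forces `|det g| = 1`, so a `(d+1)`-st root of `(det g)⁻¹` is a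
unimodular scalar that corrects the determinant. Scalars do not change the action on the ball. -/
theorem exists_smul_mem_SU {g : Mat d} (hg : g.conjTranspose * sig d * g = sig d) :
    ∃ c : ℂ, c ≠ 0 ∧ c • g ∈ SU d := by
  have hs : (sig d).det * (sig d).det = 1 := by
    rw [← Matrix.det_mul, sig_mul_sig, Matrix.det_one]
  have hs0 : (sig d).det ≠ 0 := fun h => by simp [h] at hs
  have hdet : star g.det * g.det = 1 := by
    have h := congrArg Matrix.det hg
    rw [Matrix.det_mul, Matrix.det_mul, Matrix.det_conjTranspose] at h
    apply mul_right_cancel₀ hs0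
    linear_combination h
  have hnorm : ‖g.det‖ = 1 := by
    have h := congrArg norm hdet
    rw [norm_mul, norm_star, norm_one, ← sq] at h
    exact (pow_eq_one_iff_of_nonneg (norm_nonneg _) two_ne_zero).mp h
  have hg0 : g.det ≠ 0 := fun h => by simp [h] at hnorm
  obtain ⟨c, hc⟩ := IsAlgClosed.exists_pow_nat_eq (g.det)⁻¹
    (n := Fintype.card (Fin d ⊕ Unit)) (by simp)
  have hcn : ‖c‖ = 1 := by
    have h := congrArg norm hc
    rw [norm_pow, norm_inv, hnorm, inv_one] at h
    exact (pow_eq_one_iff_of_nonneg (norm_nonneg c) (by simp)).mp h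
  refine ⟨c, fun h => by simp [h] at hcn, ?_, ?_⟩
  · rw [Matrix.conjTranspose_smul, Matrix.smul_mul, Matrix.smul_mul, Matrix.mul_smul, hg, smul_smul]
    have : star c * c = 1 := by
      simp [Complex.conj_mul', hcn]
    rw [this, one_smul]
  · rw [Matrix.det_smul, hc, inv_mul_cancel₀ hg0]

/-- The pseudo-Hermitian complex reflection `1 + β v v* σ`. -/
def refl (v : Fin d ⊕ Unit → ℂ) (β : ℂ) : Mat d :=
  1 + β • Matrix.vecMulVec v (Matrix.vecMul (star v) (sig d))

theorem refl_mulVec (v u : Fin d ⊕ Unit → ℂ) (β : ℂ) :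
    (refl v β).mulVec u = u + (β * (star v ⬝ᵥ (sig d).mulVec u)) • v := by
  rw [refl, Matrix.add_mulVec, Matrix.one_mulVec, Matrix.smul_mulVec, Matrix.vecMulVec_mulVec,
    ← Matrix.dotProduct_mulVec, ← smul_smul]
  congr 2
  ext i
  simp [mul_comm]

/-- All deviations from `sig d` are multiples of the single rank one matrix `σ v v* σ`, and the
hypothesis says that their total coefficient is zero. -/
theorem refl_sig {v : Fin d ⊕ Unit → ℂ} {β : ℂ}
    (h : β + star β + β * star β * (star v ⬝ᵥ (sig d).mulVec v) = 0) :
    (refl v β).conjTranspose * sig d * refl v β = sig d := by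
  set w := Matrix.vecMul (star v) (sig d) with hw
  have hws : star w = (sig d).mulVec v := by
    rw [hw, Matrix.star_vecMul, star_star, conjTranspose_sig]
  have e1 : (Matrix.vecMulVec v w).conjTranspose * sig d = Matrix.vecMulVec (star w) w := by
    rw [Matrix.conjTranspose_vecMulVec, Matrix.vecMulVec_mul]
  have e2 : sig d * Matrix.vecMulVec v w = Matrix.vecMulVec (star w) w := by
    rw [Matrix.mul_vecMulVec, hws]
  have e3 : Matrix.vecMulVec (star w) w * Matrix.vecMulVec v w =
      (star v ⬝ᵥ (sig d).mulVec v) • Matrix.vecMulVec (star w) w := by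
    rw [Matrix.vecMulVec_mul_vecMulVec, Matrix.dotProduct_mulVec, ← hw]
    ext i j
    simp [Matrix.vecMulVec_apply]
    ring
  rw [refl, Matrix.conjTranspose_add, Matrix.conjTranspose_one, Matrix.conjTranspose_smul]
  rw [add_mul, add_mul, one_mul, Matrix.smul_mul, e1, mul_add, mul_add, mul_one, mul_one,
    Matrix.smul_mul, Matrix.mul_smul, Matrix.mul_smul, e2, e3, smul_smul, smul_smul]
  have e4 : ∀ M : Mat d, sig d + β • M + (star β • M +
      (star β * β * (star v ⬝ᵥ (sig d).mulVec v)) • M) = sig d + (β + star β +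
      β * star β * (star v ⬝ᵥ (sig d).mulVec v)) • M := fun M => by module
  rw [e4, h, zero_smul, add_zero]

theorem refl_den (a : Z d) (b β : ℂ) (z : Z d) :
    den (refl (Sum.elim a (fun _ => b)) β) z = 1 + β * (inner ℂ a z - star b) * b := by
  rw [← mulVec_hom_inr, refl_mulVec]
  simp [dotProduct, sig, Matrix.mulVec_diagonal, hom, PiLp.inner_apply, sub_eq_add_neg, mul_comm]

theorem refl_num (a : Z d) (b β : ℂ) (z : Z d) (i : Fin d) :
    num (refl (Sum.elim a (fun _ => b)) β) z i = z i + β * (inner ℂ a z - star b) * a i := by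
  rw [← mulVec_hom_inl, refl_mulVec]
  simp [dotProduct, sig, Matrix.mulVec_diagonal, hom, PiLp.inner_apply, sub_eq_add_neg, mul_comm]

theorem sig_form_elim (a : Z d) (b : ℂ) :
    star (Sum.elim a (fun _ : Unit => b)) ⬝ᵥ (sig d).mulVec (Sum.elim a (fun _ => b)) =
      inner ℂ a a - star b * b := by
  rw [PiLp.inner_apply]
  simp [dotProduct, sig, Matrix.mulVec_diagonal, sub_eq_add_neg, mul_comm, -inner_self_eq_norm_sq_to_K]

/-- The group element of `SU(d,1)` acting like a pseudo-Hermitian complex reflection. -/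
theorem exists_SU_refl (a : Z d) (b β : ℂ)
    (h : β + star β + β * star β * (inner ℂ a a - star b * b) = 0) :
    ∃ g : SU d, ∃ c : ℂ, c ≠ 0 ∧
      (∀ z, den g.1 z = c * (1 + β * (inner ℂ a z - star b) * b)) ∧
      ∀ z, act g.1 z = (1 + β * (inner ℂ a z - star b) * b)⁻¹ •
        (z + (β * (inner ℂ a z - star b)) • a) := by
  obtain ⟨c, hc, hg⟩ := exists_smul_mem_SU (refl_sig (v := Sum.elim a (fun _ => b)) (β := β)
    (by rw [sig_form_elim, h]))
  refine ⟨⟨_, hg⟩, c, hc, fun z => by rw [den_smul, refl_den], fun z => ?_⟩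
  rw [act_smul hc]
  ext i
  simp only [act, refl_den, refl_num, PiLp.smul_apply, PiLp.add_apply, smul_eq_mul]
  rw [div_eq_inv_mul]

/-- The reflection along `(0, 1)` multiplies the last homogeneous coordinate by `c̄`, which
projectively multiplies `z` by `c`. -/
theorem exists_SU_circle (d : ℕ) {c : ℂ} (hc : ‖c‖ = 1) :
    ∃ g : SU d, ∃ b : ℂ, (∀ z, den g.1 z = b) ∧ ∀ z, act g.1 z = c • z := by
  have hcc : c * star c = 1 := by simp [Complex.mul_conj', hc]
  obtain ⟨g, b, -, hden, hact⟩ := exists_SU_refl (0 : Z d) 1 (1 - star c) (by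
    simp only [star_sub, star_one, star_star, inner_zero_left]
    linear_combination -hcc)
  refine ⟨g, b * star c, fun z => ?_, fun z => ?_⟩
  · rw [hden]
    simp
  · rw [hact]
    have : (1 + (1 - star c) * (inner ℂ (0 : Z d) z - star 1) * 1)⁻¹ = c := by
      apply inv_eq_of_mul_eq_one_left
      simp only [inner_zero_left, star_one]
      linear_combination hcc
    rw [this]
    simp

/-- The unitary map that multiplies `ω` by `c` and fixes its orthogonal complement. The factor
`(ω|ω)` on both sides clears the denominator and admits `ω = 0`. -/
theorem exists_SU_fix_zero (ω : Z d) {c : ℂ} (hc : ‖c‖ = 1) :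
    ∃ g : SU d, ∃ b : ℂ, (∀ z, den g.1 z = b) ∧
      ∀ z, (inner ℂ ω ω : ℂ) • act g.1 z =
        (inner ℂ ω ω : ℂ) • z + ((c - 1) * inner ℂ ω z) • ω := by
  have hcc : c * star c = 1 := by simp [Complex.mul_conj', hc]
  rcases eq_or_ne ω 0 with rfl | h0
  · obtain ⟨g, b, hden, hact⟩ := exists_SU_circle d hc
    exact ⟨g, b, hden, fun z => by simp⟩
  have hω : (inner ℂ ω ω : ℂ) ≠ 0 := inner_self_ne_zero.mpr h0
  have hr : star (inner ℂ ω ω : ℂ) = inner ℂ ω ω := inner_conj_symm ω ω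
  obtain ⟨g, b, -, hden, hact⟩ := exists_SU_refl ω 0 ((c - 1) / inner ℂ ω ω) (by
    rw [star_div₀, hr, star_zero, star_sub, star_one]
    field_simp
    linear_combination (inner ℂ ω ω : ℂ) * hcc)
  refine ⟨g, b, fun z => by rw [hden]; simp, fun z => ?_⟩
  rw [hact]
  simp only [star_zero, sub_zero, mul_zero, add_zero, inv_one, one_smul, smul_add, smul_smul]
  congr 2
  field_simp

theorem exists_SU_act_eq_zero {w : Z d} (hw : w ∈ Metric.ball (0 : Z d) 1) :
    ∃ g : SU d, act g.1 w = 0 := by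
  have hw' : ‖w‖ < 1 := mem_ball_zero_iff.mp hw
  set s : ℝ := Real.sqrt (1 - ‖w‖ ^ 2) with hs
  have hpos : 0 < 1 - ‖w‖ ^ 2 := by nlinarith [norm_nonneg w]
  have hs0 : 0 < s := Real.sqrt_pos.mpr hpos
  have hs2 : s ^ 2 = 1 - ‖w‖ ^ 2 := Real.sq_sqrt hpos.le
  have hin : (inner ℂ w w : ℂ) = 1 - (s : ℂ) ^ 2 := by
    rw [inner_self_eq_norm_sq_to_K]
    have : ((s ^ 2 : ℝ) : ℂ) = ((1 - ‖w‖ ^ 2 : ℝ) : ℂ) := by rw [hs2]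
    push_cast at this
    rw [this]
    simp
  have hsC : (s : ℂ) ≠ 0 := by exact_mod_cast hs0.ne'
  have hsC1 : (1 + s : ℂ) ≠ 0 := by exact_mod_cast (by positivity : (0 : ℝ) < 1 + s).ne'
  have hst : star ((1 : ℂ) + s) = 1 + s := by simp
  have hβ : star (((s * (1 + s) : ℝ) : ℂ)⁻¹) = (((s * (1 + s) : ℝ) : ℂ)⁻¹) := by
    rw [← Complex.ofReal_inv]
    exact Complex.conj_ofReal _
  -- The vectors `(w, 1)` and `-s (0, 1)` have the same form value `-s²`. The reflection along their
  -- difference `(w, 1 + s)`, with `β = 1 / (s (1 + s))`, carries the first to the second.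
  obtain ⟨g, b, -, hden, hact⟩ := exists_SU_refl w (1 + s) (((s * (1 + s) : ℝ) : ℂ)⁻¹) (by
    rw [hβ, hin, hst]
    push_cast
    field_simp
    ring)
  refine ⟨g, ?_⟩
  rw [hact, hst, hin]
  have : (((s * (1 + s) : ℝ) : ℂ)⁻¹ * (1 - (s : ℂ) ^ 2 - (1 + s))) = -1 := by
    push_cast
    field_simp
    ring
  rw [this]
  simp

end BallKernel
end

/-! ### Gram matrices and reproducing kernel Hilbert spaces -/

open scoped InnerProductSpace ComplexOrder
noncomputable section
namespace BallKernel
variable {d : ℕ}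

section Hilbert

variable {X H H' : Type*} [NormedAddCommGroup H] [InnerProductSpace ℂ H]
  [NormedAddCommGroup H'] [InnerProductSpace ℂ H']

theorem denseRange_linearCombination {v : X → H}
    (hv : (Submodule.span ℂ (Set.range v)).topologicalClosure = ⊤) :
    DenseRange (Finsupp.linearCombination ℂ v) := by
  rw [DenseRange, ← LinearMap.coe_range, Finsupp.range_linearCombination]
  exact Submodule.dense_iff_topologicalClosure_eq_top.mpr hv

theorem inner_linearCombination (v : X → H) (a b : X →₀ ℂ) :
    inner ℂ (Finsupp.linearCombination ℂ v a) (Finsupp.linearCombination ℂ v b) =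
      a.sum fun x s => b.sum fun y t => star s * inner ℂ (v x) (v y) * t := by
  simp only [Finsupp.linearCombination_apply, Finsupp.sum, sum_inner, inner_sum,
    inner_smul_left, inner_smul_right, Finset.mul_sum]
  rw [Finset.sum_comm]
  refine Finset.sum_congr rfl fun x _ => Finset.sum_congr rfl fun y _ => ?_
  simp only [starRingEnd_apply]
  ring

/-- Two families with dense spans and the same Gram matrix are related by a unitary map. -/
theorem exists_linearIsometryEquiv_of_gram [CompleteSpace H] [CompleteSpace H'] {v : X → H} {v' : X → H'}
    (hv : (Submodule.span ℂ (Set.range v)).topologicalClosure = ⊤)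
    (hv' : (Submodule.span ℂ (Set.range v')).topologicalClosure = ⊤)
    (h : ∀ x y, inner ℂ (v x) (v y) = inner ℂ (v' x) (v' y)) :
    ∃ e : H ≃ₗᵢ[ℂ] H', ∀ x, e (v x) = v' x := by
  set T := Finsupp.linearCombination ℂ v
  set T' := Finsupp.linearCombination ℂ v'
  have hd : DenseRange T := denseRange_linearCombination hv
  have hd' : DenseRange T' := denseRange_linearCombination hv'
  -- Equal Gram matrices give equal norms of corresponding combinations, so `T a ↦ T' a` is well
  -- defined and isometric on a dense subspace; its extension has closed and dense range.
  have hn : ∀ a, ‖T' a‖ = ‖T a‖ := by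
    intro a
    have : inner ℂ (T' a) (T' a) = inner ℂ (T a) (T a) := by
      rw [inner_linearCombination, inner_linearCombination]
      simp only [h]
    rw [inner_self_eq_norm_sq_to_K, inner_self_eq_norm_sq_to_K] at this
    have h2 : ‖T' a‖ ^ 2 = ‖T a‖ ^ 2 := by exact_mod_cast this
    exact (pow_left_inj₀ (norm_nonneg _) (norm_nonneg _) two_ne_zero).mp h2
  set W := T'.extendOfNorm T
  have hW : ∀ a, W (T a) = T' a := LinearMap.extendOfNorm_eq hd ⟨1, fun a => by rw [hn, one_mul]⟩
  have hWn : ∀ x, ‖W x‖ = ‖x‖ := fun x =>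
    congrFun (hd.equalizer (g := fun x => ‖W x‖) (h := fun x => ‖x‖) (by fun_prop) (by fun_prop)
      (funext fun a => by simp [hW, hn])) x
  let Wi : H →ₗᵢ[ℂ] H' := ⟨W.toLinearMap, hWn⟩
  have hsurj : Function.Surjective Wi := by
    have hcl : IsClosed (Set.range Wi) := Wi.isometry.isClosedEmbedding.isClosed_range
    rw [← Set.range_eq_univ, ← hcl.closure_eq]
    refine Dense.closure_eq (hd'.mono ?_)
    rintro _ ⟨a, rfl⟩
    exact ⟨T a, hW a⟩
  refine ⟨LinearIsometryEquiv.ofSurjective Wi hsurj, fun x => ?_⟩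
  have := hW (Finsupp.single x 1)
  simpa [T, T', Wi] using this

/-- Covariance of the Gram matrix of a family on which a unitary map acts. -/
theorem gram_covariant {S : Set X} {J : X → ℂ} {φ : X → X} {ι : X → H} (T : H ≃ₗᵢ[ℂ] H)
    (hT : ∀ F, ∀ x ∈ S, inner ℂ (ι x) (T F) = J x * inner ℂ (ι (φ x)) F) {x y : X} (hx : x ∈ S)
    (hy : y ∈ S) :
    inner ℂ (ι x) (ι y) = J x * star (J y) * inner ℂ (ι (φ x)) (ι (φ y)) := by
  have h1 := hT (T.symm (ι y)) x hx
  rw [T.apply_symm_apply] at h1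
  have h2 := hT (ι (φ x)) y hy
  have h3 : inner ℂ (ι (φ x)) (T.symm (ι y)) = inner ℂ (T (ι (φ x))) (ι y) := by
    rw [← T.inner_map_map, T.apply_symm_apply]
  rw [h1, h3, ← inner_conj_symm, h2, map_mul, inner_conj_symm]
  simp only [starRingEnd_apply]
  ring

end Hilbert

section Translates

variable {X : Type*} {H : Type*} [NormedAddCommGroup H] [InnerProductSpace ℂ H] [RKHS ℂ H X ℂ]

/-- Translates that exist in both directions are given by a unitary operator. -/
theorem exists_unitary_of_translates {S : Set X} {J : X → ℂ} {φ : X → X}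
    (hS : ∀ F : H, (∀ x ∈ S, F x = 0) → F = 0)
    (h : ∀ F : H, ∃ F' : H, (∀ x ∈ S, F' x = J x * F (φ x)) ∧ ‖F'‖ = ‖F‖)
    (hinv : ∀ G : H, ∃ F : H, ∀ x ∈ S, J x * F (φ x) = G x) :
    ∃ T : H ≃ₗᵢ[ℂ] H, ∀ F, ∀ x ∈ S, T F x = J x * F (φ x) := by
  have heq : ∀ F G : H, (∀ x ∈ S, F x = G x) → F = G := fun F G hFG => by
    rw [← sub_eq_zero]
    exact hS _ fun x hx => by simp [hFG x hx]
  choose t ht htn using h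
  -- Linearity comes for free: elements are determined by their values on `S`, and the prescribed
  -- values depend linearly on `F`.
  let T : H →ₗᵢ[ℂ] H :=
    { toFun := t
      map_add' := fun F G => heq _ _ fun x hx => by
        simp [ht _ x hx, mul_add]
      map_smul' := fun c F => heq _ _ fun x hx => by
        simp [ht _ x hx]
        ring
      norm_map' := htn }
  refine ⟨LinearIsometryEquiv.ofSurjective T fun G => ?_, ht⟩
  obtain ⟨F, hF⟩ := hinv G
  exact ⟨F, heq _ _ fun x hx => by rw [← hF x hx]; exact ht F x hx⟩

end Translates

section Kernel

variable {X : Type*} {H H' : Type*}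
  [NormedAddCommGroup H] [InnerProductSpace ℂ H] [CompleteSpace H] [RKHS ℂ H X ℂ]
  [NormedAddCommGroup H'] [InnerProductSpace ℂ H'] [CompleteSpace H'] [RKHS ℂ H' X ℂ]

variable (H) in
/-- The vector representing the evaluation at `x`. -/
def kv (x : X) : H := RKHS.kerFun H x 1

theorem inner_kv (x : X) (f : H) : inner ℂ (kv H x) f = f x := by
  simp [kv]

theorem kernel_one (x y : X) : RKHS.kernel H x y 1 = inner ℂ (kv H x) (kv H y) := by
  rw [inner_kv, kv, RKHS.kerFun_apply]

theorem kv_apply (x y : X) : kv H y x = RKHS.kernel H x y 1 := by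
  rw [kernel_one, inner_kv]

variable (H) in
theorem span_kv : (Submodule.span ℂ (Set.range (kv H : X → H))).topologicalClosure = ⊤ := by
  rw [← RKHS.kerFun_dense (𝕜 := ℂ) (V := ℂ) (H := H)]
  congr 1
  apply le_antisymm
  · refine Submodule.span_mono ?_
    rintro _ ⟨x, rfl⟩
    exact ⟨x, 1, rfl⟩
  · rw [Submodule.span_le]
    rintro _ ⟨x, c, rfl⟩
    have : RKHS.kerFun H x c = c • kv H x := by
      rw [kv, ← map_smul, smul_eq_mul, mul_one]
    rw [this]
    exact Submodule.smul_mem _ _ (Submodule.subset_span ⟨x, rfl⟩)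

/-- A covariant kernel yields unitary weighted composition operators. -/
theorem exists_translate_of_covariant {J : X → ℂ} {φ : X → X} (hJ : ∀ x, J x ≠ 0)
    (hφ : Function.Surjective φ)
    (h : ∀ x y, RKHS.kernel H x y 1 = J x * star (J y) * RKHS.kernel H (φ x) (φ y) 1) (F : H) :
    ∃ F' : H, (∀ x, F' x = J x * F (φ x)) ∧ ‖F'‖ = ‖F‖ := by
  obtain ⟨e, he⟩ := exists_linearIsometryEquiv_of_gram (v := kv H)
    (v' := fun x => star (J x) • kv H (φ x)) (span_kv H) (by
      rw [← top_le_iff, ← span_kv H]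
      refine Submodule.topologicalClosure_mono (Submodule.span_le.mpr ?_)
      rintro _ ⟨y, rfl⟩
      obtain ⟨x, rfl⟩ := hφ y
      have : kv H (φ x) = (star (J x))⁻¹ • (star (J x) • kv H (φ x)) := by
        rw [smul_smul, inv_mul_cancel₀ (star_ne_zero.mpr (hJ x)), one_smul]
      rw [this]
      exact Submodule.smul_mem _ _ (Submodule.subset_span ⟨x, rfl⟩))
    (fun x y => by
      rw [← kernel_one, h, inner_smul_left, inner_smul_right, ← kernel_one]
      simp only [starRingEnd_apply, star_star]
      ring)
  refine ⟨e.symm F, fun x => ?_, e.symm.norm_map F⟩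
  rw [← inner_kv, ← e.inner_map_map, e.apply_symm_apply, he, inner_smul_left, inner_kv]
  simp

/-- The kernel of `H` dominates a positive multiple of the rank one kernel of `F`; then `F` belongs
to `H`. -/
theorem exists_mem_of_le_kernel {F : X → ℂ} {c : ℝ} (hc : 0 < c)
    (h : (Matrix.of fun x y => RKHS.kernel H x y 1 - c * (F x * star (F y))).PosSemidef) :
    ∃ f : H, ∀ x, f x = F x := by
  set T := Finsupp.linearCombination ℂ (kv H : X → H)
  set Λ := Finsupp.linearCombination ℂ (fun x => star (F x))
  -- Positivity says `c ‖Λ a‖² ≤ ‖T a‖²`. Hence `kv x ↦ star (F x)` extends to a bounded functional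
  -- on `H`, and its Riesz vector is the required element.
  have hb : ∀ a, ‖Λ a‖ ≤ (Real.sqrt c)⁻¹ * ‖T a‖ := by
    intro a
    have h1 := h.2 a
    have e : (a.sum fun i xi => a.sum fun j xj => star xi *
        (Matrix.of fun x y => RKHS.kernel H x y 1 - c * (F x * star (F y))) i j * xj) =
        ((‖T a‖ ^ 2 - c * ‖Λ a‖ ^ 2 : ℝ) : ℂ) := by
      have e1 : ((‖T a‖ ^ 2 : ℝ) : ℂ) = inner ℂ (T a) (T a) := by
        rw [inner_self_eq_norm_sq_to_K]; simp
      have e2 : ((‖Λ a‖ ^ 2 : ℝ) : ℂ) = star (Λ a) * Λ a := by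
        simp [Complex.conj_mul']
      have e3 : star (Λ a) * Λ a =
          ∑ x ∈ a.support, ∑ y ∈ a.support, star (a x) * F x * (a y * star (F y)) := by
        simp only [Λ, Finsupp.linearCombination_apply, Finsupp.sum, star_sum,
          Finset.sum_mul_sum, smul_eq_mul, star_mul, star_star]
        refine Finset.sum_congr rfl fun x _ => Finset.sum_congr rfl fun y _ => by ring
      rw [Complex.ofReal_sub, Complex.ofReal_mul, e1, e2, e3, inner_linearCombination,
        Finset.mul_sum]
      simp only [Finsupp.sum]
      rw [← Finset.sum_sub_distrib]
      refine Finset.sum_congr rfl fun x _ => ?_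
      rw [Finset.mul_sum, ← Finset.sum_sub_distrib]
      refine Finset.sum_congr rfl fun y _ => ?_
      rw [Matrix.of_apply, kernel_one]
      ring
    rw [e] at h1
    have h2 : 0 ≤ ‖T a‖ ^ 2 - c * ‖Λ a‖ ^ 2 := by exact_mod_cast h1
    have hs : Real.sqrt c ^ 2 = c := Real.sq_sqrt hc.le
    have hs0 : 0 < Real.sqrt c := Real.sqrt_pos.mpr hc
    rw [inv_mul_eq_div, le_div_iff₀ hs0]
    refine le_of_sq_le_sq ?_ (norm_nonneg _)
    rw [mul_pow, hs]
    linarith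
  set φ := Λ.extendOfNorm T
  have hφ : ∀ x, φ (kv H x) = star (F x) := by
    intro x
    have := LinearMap.extendOfNorm_eq (denseRange_linearCombination (span_kv H)) ⟨_, hb⟩
      (Finsupp.single x 1)
    simpa [Λ, φ, T] using this
  refine ⟨(InnerProductSpace.toDual ℂ H).symm φ, fun x => ?_⟩
  rw [← inner_kv, ← inner_conj_symm, InnerProductSpace.toDual_symm_apply, hφ]
  simp

end Kernel

/-- Every positive semidefinite kernel is the kernel of a reproducing kernel Hilbert space. -/
theorem exists_rkhs {X : Type} {K : Matrix X X ℂ} (hK : K.PosSemidef) :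
    ∃ (H : Type) (_ : NormedAddCommGroup H) (_ : InnerProductSpace ℂ H)
      (_ : CompleteSpace H) (_ : RKHS ℂ H X ℂ), ∀ x y, RKHS.kernel H x y 1 = K x y := by
  let M : Matrix X X (ℂ →L[ℂ] ℂ) := .of fun x y => K x y • ContinuousLinearMap.id ℂ ℂ
  have hM : M.PosSemidef := by
    suffices key : M.IsHermitian ∧ ∀ vv : X →₀ ℂ,
        0 ≤ RCLike.re (vv.sum fun x w => vv.sum fun x' w' => inner ℂ (M x' x w) w') from
      ((RKHS.posSemidef_tfae (K := M)).out 0 2).mpr key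
    refine ⟨?_, ?_⟩
    · ext x y
      have := hK.1.apply x y
      simp only [M, Matrix.conjTranspose_apply, Matrix.of_apply, star_smul, this]
      simp [ContinuousLinearMap.star_eq_adjoint, ContinuousLinearMap.adjoint_id]
    · intro a
      have h := hK.2 a
      have e : (a.sum fun x w => a.sum fun x' w' => inner ℂ (M x' x w) w') =
          a.sum fun i xi => a.sum fun j xj => star xi * K i j * xj := by
        simp only [Finsupp.sum, M, Matrix.of_apply]
        refine Finset.sum_congr rfl fun x _ => Finset.sum_congr rfl fun y _ => ?_
        rw [← hK.1.apply x y]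
        simp
        ring
      rw [e]
      exact (Complex.le_def.mp h).1
  have : Fact M.PosSemidef := ⟨hM⟩
  refine ⟨RKHS.OfKernel M, inferInstance, inferInstance, inferInstance, inferInstance,
    fun x y => ?_⟩
  rw [RKHS.OfKernel.kernel_ofKernel]
  simp [M]

end BallKernel
end

/-! ### Holomorphic functions on normed spaces: Cauchy estimates, uniform limits, identity theorem
-/

open Filter Topology Asymptotics
noncomputable section
namespace BallKernel

section Holomorphic

variable {E : Type*} [NormedAddCommGroup E] [NormedSpace ℂ E]

theorem hasDerivAt_line {f : E → ℂ} {z v : E} {t : ℂ} (h : DifferentiableAt ℂ f (z + t • v)) :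
    HasDerivAt (fun s : ℂ => f (z + s • v)) (fderiv ℂ f (z + t • v) v) t := by
  have hl : HasDerivAt (fun s : ℂ => z + s • v) v t := by
    simpa using ((hasDerivAt_id t).smul_const v).const_add z
  exact h.hasFDerivAt.comp_hasDerivAt t hl

theorem line_mem_ball {x z v : E} {r s : ℝ} {t : ℂ} (hz : z ∈ Metric.ball x r)
    (ht : ‖t • v‖ ≤ s) : z + t • v ∈ Metric.ball x (r + s) := by
  rw [mem_ball_iff_norm] at hz ⊢
  calc ‖z + t • v - x‖ = ‖(z - x) + t • v‖ := by congr 1; abel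
    _ ≤ ‖z - x‖ + ‖t • v‖ := norm_add_le _ _
    _ < r + s := by linarith

/-- Cauchy estimate for the Fréchet derivative. -/
theorem norm_fderiv_le {f : E → ℂ} {x y : E} {r M : ℝ} (hr : 0 < r)
    (hf : DifferentiableOn ℂ f (Metric.ball x (r + r)))
    (hM : ∀ z ∈ Metric.ball x (r + r), ‖f z‖ ≤ M) (hy : y ∈ Metric.ball x r) :
    ‖fderiv ℂ f y‖ ≤ M / r := by
  have hy2 : y ∈ Metric.ball x (r + r) := Metric.ball_subset_ball (by linarith) hy
  have hM0 : 0 ≤ M := (norm_nonneg _).trans (hM y hy2)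
  refine ContinuousLinearMap.opNorm_le_bound _ (by positivity) fun v => ?_
  rcases eq_or_ne v 0 with rfl | hv
  · simp
  have hv0 : 0 < ‖v‖ := norm_pos_iff.mpr hv
  have hmem : ∀ t ∈ Metric.closedBall (0 : ℂ) (r / ‖v‖), y + t • v ∈ Metric.ball x (r + r) := by
    intro t ht
    refine line_mem_ball hy ?_
    rw [norm_smul, ← le_div_iff₀ hv0]
    simpa using ht
  have hd : ∀ t ∈ Metric.closedBall (0 : ℂ) (r / ‖v‖),
      HasDerivAt (fun s : ℂ => f (y + s • v)) (fderiv ℂ f (y + t • v) v) t := fun t ht =>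
    hasDerivAt_line (hf.differentiableAt (Metric.isOpen_ball.mem_nhds (hmem t ht)))
  have h1 := Complex.norm_deriv_le_of_forall_mem_sphere_norm_le (f := fun s : ℂ => f (y + s • v))
    (c := 0) (R := r / ‖v‖) (C := M) (by positivity)
    (DifferentiableOn.diffContOnCl_ball (U := Metric.closedBall (0 : ℂ) (r / ‖v‖))
      (fun t ht => (hd t ht).differentiableAt.differentiableWithinAt) le_rfl)
    (fun t ht => hM _ (hmem t (Metric.sphere_subset_closedBall ht)))
  rw [(hd 0 (by simp; positivity)).deriv] at h1
  simp only [zero_smul, add_zero] at h1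
  calc _ ≤ M / (r / ‖v‖) := h1
    _ = M / r * ‖v‖ := by field_simp

/-- A locally uniform limit of holomorphic functions is holomorphic. -/
theorem differentiableAt_of_tendstoUniformlyOn {F : ℕ → E → ℂ} {f : E → ℂ} {x : E} {r : ℝ}
    (hr : 0 < r) (hF : ∀ n, DifferentiableOn ℂ (F n) (Metric.ball x (r + r)))
    (h : TendstoUniformlyOn F f atTop (Metric.ball x (r + r))) : DifferentiableAt ℂ f x := by
  -- The Cauchy estimate, applied to differences on the ball of twice the radius, turns uniform
  -- convergence of functions into uniform convergence of derivatives on the smaller ball.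
  have hC : UniformCauchySeqOn (fun n => fderiv ℂ (F n)) atTop (Metric.ball x r) := by
    rw [Metric.uniformCauchySeqOn_iff]
    intro ε hε
    obtain ⟨N, hN⟩ := Metric.uniformCauchySeqOn_iff.mp h.uniformCauchySeqOn (ε / 2 * r)
      (by positivity)
    refine ⟨N, fun m hm n hn y hy => ?_⟩
    have hy2 : y ∈ Metric.ball x (r + r) := Metric.ball_subset_ball (by linarith) hy
    have hd : ∀ n, DifferentiableAt ℂ (F n) y := fun n =>
      (hF n).differentiableAt (Metric.isOpen_ball.mem_nhds hy2)
    rw [dist_eq_norm, ← fderiv_sub (hd m) (hd n)]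
    have := norm_fderiv_le (f := F m - F n) (M := ε / 2 * r) hr ((hF m).sub (hF n))
      (fun z hz => by
        have := hN m hm n hn z hz
        rw [dist_eq_norm] at this
        exact this.le) hy
    calc _ ≤ ε / 2 * r / r := this
      _ < ε := by field_simp; linarith
  have hlim : ∀ y ∈ Metric.ball x r, ∃ L, Tendsto (fun n => fderiv ℂ (F n) y) atTop (𝓝 L) :=
    fun y hy => cauchySeq_tendsto_of_complete (hC.cauchySeq hy)
  choose! g hg using hlim
  have hU := hC.tendstoUniformlyOn_of_tendsto hg
  have hx : x ∈ Metric.ball x r := Metric.mem_ball_self hr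
  refine (hasFDerivAt_of_tendstoLocallyUniformlyOn (f := F) (g := f) Metric.isOpen_ball
    hU.tendstoLocallyUniformlyOn (fun n y hy => ?_) (fun y hy => ?_) hx).differentiableAt
  · exact ((hF n).differentiableAt (Metric.isOpen_ball.mem_nhds
      (Metric.ball_subset_ball (by linarith) hy))).hasFDerivAt
  · exact h.tendsto_at (Metric.ball_subset_ball (by linarith) hy)

/-- Second order remainder of a bounded holomorphic function of one variable. -/
theorem norm_dslope_sub_le {φ : ℂ → ℂ} {ρ M : ℝ} (hρ : 0 < ρ)
    (hφ : DifferentiableOn ℂ φ (Metric.ball 0 ρ)) (hM : ∀ t ∈ Metric.ball (0 : ℂ) ρ, ‖φ t‖ < M)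
    {t : ℂ} (ht : t ∈ Metric.ball (0 : ℂ) ρ) :
    ‖dslope φ 0 t - deriv φ 0‖ ≤ 4 * M / ρ ^ 2 * ‖t‖ * 2 := by
  have h0 : (0 : ℂ) ∈ Metric.ball (0 : ℂ) ρ := Metric.mem_ball_self hρ
  have hM0 : 0 < M := (norm_nonneg _).trans_lt (hM 0 h0)
  have h1 : ∀ t ∈ Metric.ball (0 : ℂ) ρ, ‖dslope φ 0 t‖ ≤ 2 * M / ρ := fun t ht =>
    Complex.norm_dslope_le_div_of_mapsTo_ball hφ (fun s hs => by
      rw [mem_closedBall_iff_norm]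
      calc _ ≤ ‖φ s‖ + ‖φ 0‖ := norm_sub_le _ _
        _ ≤ 2 * M := by linarith [hM s hs, hM 0 h0]) ht
  have hd : DifferentiableOn ℂ (dslope φ 0) (Metric.ball 0 ρ) :=
    (Complex.differentiableOn_dslope (Metric.ball_mem_nhds 0 hρ)).mpr hφ
  -- A second application of the Schwarz lemma, now to the difference quotient, which is itself
  -- bounded by `2M/ρ`. The final bound leaves a spare factor `2`.
  have h2 : ‖dslope (dslope φ 0) 0 t‖ ≤ 4 * M / ρ / ρ :=
    Complex.norm_dslope_le_div_of_mapsTo_ball hd (fun s hs => by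
      rw [mem_closedBall_iff_norm]
      calc _ ≤ ‖dslope φ 0 s‖ + ‖dslope φ 0 0‖ := norm_sub_le _ _
        _ ≤ 2 * M / ρ + 2 * M / ρ := add_le_add (h1 s hs) (h1 0 h0)
        _ = 4 * M / ρ := by ring) ht
  have h3 : dslope φ 0 t - deriv φ 0 = t * dslope (dslope φ 0) 0 t := by
    have := sub_smul_dslope (dslope φ 0) 0 t
    rw [sub_zero, smul_eq_mul, dslope_same] at this
    rw [this]
  rw [h3, norm_mul]
  have : 4 * M / ρ / ρ = 4 * M / ρ ^ 2 := by field_simp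
  rw [this] at h2
  have h5 : 0 ≤ 4 * M / ρ ^ 2 * ‖t‖ := by positivity
  nlinarith [mul_le_mul_of_nonneg_left h2 (norm_nonneg t)]

/-- Directional derivatives of holomorphic functions are holomorphic. -/
theorem differentiableOn_fderiv_apply {f : E → ℂ} {U : Set E} (hU : IsOpen U)
    (hf : DifferentiableOn ℂ f U) (v : E) :
    DifferentiableOn ℂ (fun z => fderiv ℂ f z v) U := by
  intro x hx
  apply DifferentiableAt.differentiableWithinAt
  have hxc : ContinuousAt f x := (hf.differentiableAt (hU.mem_nhds hx)).continuousAt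
  have hb : ∀ᶠ y in 𝓝 x, ‖f y‖ < ‖f x‖ + 1 :=
    hxc.norm.eventually (gt_mem_nhds (by linarith))
  obtain ⟨ε, hε, hball⟩ := Metric.mem_nhds_iff.mp (Filter.inter_mem hb (hU.mem_nhds hx))
  set r := ε / 4 with hr
  have hr0 : 0 < r := by positivity
  set M := ‖f x‖ + 1
  set ρ := r / (‖v‖ + 1) with hρ
  have hv1 : 0 < ‖v‖ + 1 := by positivity
  have hρ0 : 0 < ρ := by positivity
  have hmem : ∀ y ∈ Metric.ball x (r + r), ∀ t ∈ Metric.ball (0 : ℂ) ρ,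
      y + t • v ∈ Metric.ball x ε := by
    intro y hy t ht
    refine Metric.ball_subset_ball (by linarith) (line_mem_ball (s := r) hy ?_)
    rw [norm_smul]
    have ht' : ‖t‖ < r / (‖v‖ + 1) := by simpa using ht
    rw [lt_div_iff₀ hv1] at ht'
    nlinarith [norm_nonneg t, norm_nonneg v]
  have hd : ∀ y ∈ Metric.ball x ε, DifferentiableAt ℂ f y := fun y hy =>
    hf.differentiableAt (hU.mem_nhds (hball hy).2)
  have hline : ∀ y ∈ Metric.ball x (r + r), ∀ t ∈ Metric.ball (0 : ℂ) ρ,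
      HasDerivAt (fun s : ℂ => f (y + s • v)) (fderiv ℂ f (y + t • v) v) t := fun y hy t ht =>
    hasDerivAt_line (hd _ (hmem y hy t ht))
  have h0 : (0 : ℂ) ∈ Metric.ball (0 : ℂ) ρ := Metric.mem_ball_self hρ0
  -- Step sizes that are nonzero, stay inside the disc of radius `ρ` and tend to zero. The remainder
  -- bound makes the difference quotients converge uniformly, so their limit is holomorphic.
  let τ : ℕ → ℂ := fun n => ((ρ / (n + 2) : ℝ) : ℂ)
  have hτn : ∀ n, ‖τ n‖ = ρ / (n + 2) := fun n => by
    simp only [τ, Complex.norm_real, Real.norm_eq_abs]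
    exact abs_of_pos (by positivity)
  have hτ0 : ∀ n, τ n ≠ 0 := fun n => norm_pos_iff.mp (by rw [hτn]; positivity)
  have hτρ : ∀ n, τ n ∈ Metric.ball (0 : ℂ) ρ := fun n => by
    rw [mem_ball_zero_iff, hτn, div_lt_iff₀ (by positivity)]
    have : (0 : ℝ) ≤ n := n.cast_nonneg
    nlinarith
  refine differentiableAt_of_tendstoUniformlyOn (F := fun n y => (τ n)⁻¹ * (f (y + τ n • v) - f y))
    hr0 (fun n y hy => ?_) ?_
  · have h1 : DifferentiableAt ℂ (fun y => f (y + τ n • v)) y :=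
      (hd _ (hmem y hy _ (hτρ n))).comp y (differentiableAt_id.add_const _)
    have h2 := hd y (Metric.ball_subset_ball (by linarith) hy)
    exact ((h1.sub h2).const_mul _).differentiableWithinAt
  · rw [Metric.tendstoUniformlyOn_iff]
    intro δ hδ
    have hlim : Tendsto (fun n : ℕ => 4 * M / ρ ^ 2 * (ρ / (n + 2)) * 2) atTop (𝓝 0) := by
      have h1 : Tendsto (fun n : ℕ => ρ / ((n : ℝ) + 2)) atTop (𝓝 0) :=
        tendsto_const_nhds.div_atTop (tendsto_atTop_add_const_right _ _ tendsto_natCast_atTop_atTop)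
      simpa using (h1.const_mul (4 * M / ρ ^ 2)).mul_const 2
    filter_upwards [hlim.eventually (gt_mem_nhds hδ)] with n hn y hy
    have hφ := norm_dslope_sub_le (φ := fun s : ℂ => f (y + s • v)) (M := M) hρ0
      (fun t ht => (hline y hy t ht).differentiableAt.differentiableWithinAt)
      (fun t ht => (hball (hmem y hy t ht)).1) (hτρ n)
    rw [(hline y hy 0 h0).deriv, dslope_of_ne _ (hτ0 n), slope_def_module, hτn] at hφ
    simp only [zero_smul, add_zero, sub_zero, smul_eq_mul] at hφ
    rw [dist_comm, dist_eq_norm]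
    exact hφ.trans_lt hn

end Holomorphic

/-- The identity theorem at the accumulation point `1` of the circle. It spreads invariance under
rotations to contractions `c` with `‖c‖ ≤ 1`, including `c = 0`. -/
theorem eq_zero_of_unit_circle {f : ℂ → ℂ} {R : ℝ} (hR : 1 < R)
    (hf : DifferentiableOn ℂ f (Metric.ball 0 R)) (h : ∀ c : ℂ, ‖c‖ = 1 → f c = 0) {c : ℂ}
    (hc : ‖c‖ < R) : f c = 0 := by
  have ha : AnalyticOnNhd ℂ f (Metric.ball 0 R) := hf.analyticOnNhd Metric.isOpen_ball
  refine ha.eqOn_zero_of_preconnected_of_frequently_eq_zero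
    (convex_ball (0 : ℂ) R).isPreconnected (z₀ := 1) (by simpa using hR) ?_ (by simpa using hc)
  have ht : Tendsto (fun n : ℕ => Complex.exp (((n + 1 : ℝ)⁻¹ : ℝ) * Complex.I)) atTop
      (𝓝[≠] 1) := by
    refine tendsto_nhdsWithin_iff.mpr ⟨?_, ?_⟩
    · have h1 : Tendsto (fun n : ℕ => ((n : ℝ) + 1)⁻¹) atTop (𝓝 0) := by
        simpa using tendsto_one_div_add_atTop_nhds_zero_nat (𝕜 := ℝ)
      have h2 : Continuous fun s : ℝ => Complex.exp (s * Complex.I) := by fun_prop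
      have h3 := (h2.tendsto 0).comp h1
      rw [Complex.ofReal_zero, zero_mul, Complex.exp_zero] at h3
      exact h3
    · refine Eventually.of_forall fun n => ?_
      -- The approximating points `exp(i/(n+1))` differ from `1` because `0 < 1/(n+1) ≤ 1 < 2π`.
      rw [Set.mem_compl_singleton_iff, Ne, Complex.exp_eq_one_iff]
      rintro ⟨k, hk⟩
      have hk2 : ((n : ℝ) + 1)⁻¹ = k * (2 * Real.pi) := by
        have := congrArg Complex.im hk
        rw [Complex.im_ofReal_mul, Complex.I_im, mul_one] at this
        rw [this]
        simp
      have hpos : 0 < ((n : ℝ) + 1)⁻¹ := by positivity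
      have hle : ((n : ℝ) + 1)⁻¹ ≤ 1 := inv_le_one_of_one_le₀ (by linarith [n.cast_nonneg (α := ℝ)])
      have hkpos : 0 < (k : ℝ) := by
        by_contra! hcon
        nlinarith [Real.pi_pos]
      have hk1 : (1 : ℝ) ≤ k := by exact_mod_cast (Int.cast_pos.mp hkpos)
      nlinarith [Real.pi_gt_three]
  exact ht.frequently (Frequently.of_forall fun n => h _ (Complex.norm_exp_ofReal_mul_I _))

end BallKernel
end

/-! ### Taylor coefficients and the one-variable Möbius identity -/

noncomputable section
namespace BallKernel

/-- The Taylor coefficient of order `k` at `0`. -/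
def tc (f : ℂ → ℂ) (k : ℕ) : ℂ := iteratedDeriv k f 0 / (k.factorial : ℂ)

/-- `f` has the Taylor coefficients `c` to order `N`. -/
def HasTaylor (f : ℂ → ℂ) (N : ℕ) (c : ℕ → ℂ) : Prop :=
  (fun t => f t - ∑ k ∈ Finset.range N, c k * t ^ k) =O[𝓝 0] fun t => t ^ N

theorem hasTaylor_tc {f : ℂ → ℂ} (hf : AnalyticAt ℂ f 0) (N : ℕ) : HasTaylor f N (tc f) := by
  have h := hf.hasFPowerSeriesAt.isBigO_sub_partialSum_pow N
  refine IsBigO.trans (IsBigO.of_bound 1 (Eventually.of_forall fun t => ?_)) (h.trans ?_)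
  · rw [one_mul, zero_add]
    refine le_of_eq (congrArg norm ?_)
    congr 1
    simp [FormalMultilinearSeries.partialSum, tc, mul_comm]
  · exact IsBigO.of_bound 1 (Eventually.of_forall fun t => by simp)

/-- At the least index `m` where the expansions differ, dividing the difference by `t ^ m` leaves a
nonzero limit on one side and `O(t^(N-m))` with `m < N` on the other. -/
theorem HasTaylor.unique {f : ℂ → ℂ} {N : ℕ} {c c' : ℕ → ℂ} (h : HasTaylor f N c)
    (h' : HasTaylor f N c') : ∀ k < N, c k = c' k := by
  have hsub : (fun t : ℂ => ∑ k ∈ Finset.range N, (c k - c' k) * t ^ k) =O[𝓝 0]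
      fun t => t ^ N := by
    refine (h'.sub h).congr_left fun t => ?_
    simp only [sub_mul, Finset.sum_sub_distrib]
    ring
  by_contra! hne
  classical
  set m := Nat.find hne
  obtain ⟨hmN, hm⟩ := Nat.find_spec hne
  have hlt : ∀ k < m, c k = c' k := fun k hk => by
    by_contra hk'
    exact Nat.find_min hne hk ⟨hk.trans hmN, hk'⟩
  have e : ∀ t : ℂ, ∑ k ∈ Finset.range N, (c k - c' k) * t ^ k =
      t ^ m * ∑ k ∈ Finset.Ico m N, (c k - c' k) * t ^ (k - m) := by
    intro t
    rw [Finset.range_eq_Ico, ← Finset.sum_Ico_consecutive _ (Nat.zero_le m) hmN.le,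
      Finset.sum_eq_zero (s := Finset.Ico 0 m), zero_add, Finset.mul_sum]
    · refine Finset.sum_congr rfl fun k hk => ?_
      rw [mul_left_comm, ← pow_add, Nat.add_sub_cancel' (Finset.mem_Ico.mp hk).1]
    · intro k hk
      rw [hlt k (Finset.mem_Ico.mp hk).2, sub_self, zero_mul]
  have hcont : Continuous fun t : ℂ => ∑ k ∈ Finset.Ico m N, (c k - c' k) * t ^ (k - m) := by
    fun_prop
  have hq : (fun t : ℂ => ∑ k ∈ Finset.Ico m N, (c k - c' k) * t ^ (k - m)) =O[𝓝[≠] 0]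
      fun t => t ^ (N - m) := by
    obtain ⟨C, hC⟩ := hsub.bound
    refine IsBigO.of_bound C ?_
    filter_upwards [nhdsWithin_le_nhds hC, self_mem_nhdsWithin] with t ht ht0
    have hpos : 0 < ‖t ^ m‖ := norm_pos_iff.mpr (pow_ne_zero _ ht0)
    rw [e, norm_mul] at ht
    have : ‖t ^ N‖ = ‖t ^ m‖ * ‖t ^ (N - m)‖ := by
      rw [← norm_mul, ← pow_add, Nat.add_sub_cancel' hmN.le]
    rw [this, mul_left_comm] at ht
    exact le_of_mul_le_mul_left ht hpos
  have hlim : Tendsto (fun t : ℂ => t ^ (N - m)) (𝓝[≠] 0) (𝓝 0) := by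
    have : Continuous fun t : ℂ => t ^ (N - m) := by fun_prop
    have h2 := this.tendsto 0
    rw [zero_pow (Nat.sub_ne_zero_of_lt hmN)] at h2
    exact h2.mono_left nhdsWithin_le_nhds
  have h0 := tendsto_nhds_unique ((hcont.tendsto 0).mono_left nhdsWithin_le_nhds)
    (hq.trans_tendsto hlim)
  rw [Finset.sum_eq_single m] at h0
  · simp only [Nat.sub_self, pow_zero, mul_one] at h0
    exact hm (sub_eq_zero.mp h0)
  · intro k hk hkm
    have : k - m ≠ 0 := by
      have := (Finset.mem_Ico.mp hk).1
      omega
    rw [zero_pow this, mul_zero]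
  · intro h
    exact absurd (Finset.mem_Ico.mpr ⟨le_rfl, hmN⟩) h

theorem poch_succ (x : ℝ) (k : ℕ) : poch x (k + 1) = poch x k * (x + k) := by
  rw [poch, Finset.prod_range_succ, ← poch]

theorem poch_add (x : ℝ) (j i : ℕ) : poch x (j + i) = poch x j * poch (x + j) i := by
  rw [poch, Finset.prod_range_add]
  congr 1
  refine Finset.prod_congr rfl fun i _ => ?_
  push_cast
  ring

theorem poch_zero (x : ℝ) : poch x 0 = 1 := by simp [poch]

theorem poch_pos {x : ℝ} (hx : 0 < x) (k : ℕ) : 0 < poch x k :=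
  Finset.prod_pos fun i _ => by positivity

/-- Also valid for `i > N`, where both sides vanish. It supplies the signed binomial coefficients
that make the intertwining sum collapse. -/
theorem poch_neg_nat (N i : ℕ) : poch (-(N : ℝ)) i = (-1) ^ i * i.factorial * N.choose i := by
  induction i with
  | zero => simp [poch]
  | succ i ih =>
    rw [poch_succ, ih, Nat.factorial_succ, pow_succ]
    have h : ((N.choose (i + 1) * (i + 1) : ℕ) : ℝ) = ((N.choose i * (N - i) : ℕ) : ℝ) := by
      rw [Nat.choose_succ_right_eq]
    rcases le_or_gt i N with hi | hi
    · push_cast [Nat.cast_sub hi] at h ⊢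
      linear_combination (-1) ^ i * (i.factorial : ℝ) * h
    · rw [Nat.choose_eq_zero_of_lt hi, Nat.choose_eq_zero_of_lt (by omega)]
      simp

theorem factorial_mul_choose {K : Type*} [Field K] [BinomialRing K] (r : K) (i : ℕ) :
    (i.factorial : K) * Ring.choose r i = ∏ j ∈ Finset.range i, (r - j) := by
  rw [← nsmul_eq_mul, ← Ring.descPochhammer_eq_factorial_smul_choose,
    ← Polynomial.aeval_eq_smeval, Polynomial.aeval_def, Polynomial.eval₂_eq_eval_map,
    descPochhammer_map, descPochhammer_eval_eq_prod_range]

theorem choose_neg (x : ℝ) (i : ℕ) :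
    Ring.choose (-(x : ℂ)) i = (-1) ^ i * ((poch x i / i.factorial : ℝ) : ℂ) := by
  have hf : (i.factorial : ℂ) ≠ 0 := by exact_mod_cast i.factorial_ne_zero
  have h1 : (i.factorial : ℂ) * Ring.choose (-(x : ℂ)) i = (-1) ^ i * (poch x i : ℂ) := by
    rw [factorial_mul_choose, poch, Complex.ofReal_prod, ← Finset.card_range i,
      ← Finset.prod_const, Finset.card_range, ← Finset.prod_mul_distrib]
    refine Finset.prod_congr rfl fun j _ => ?_
    push_cast
    ring
  push_cast
  field_simp
  linear_combination h1

theorem hasTaylor_one_add_cpow (x : ℝ) (a : ℂ) (N : ℕ) :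
    HasTaylor (fun t => (1 + a * t) ^ (-(x : ℂ))) N
      (fun i => (-a) ^ i * ((poch x i / i.factorial : ℝ) : ℂ)) := by
  have h := (Complex.one_add_cpow_hasFPowerSeriesAt_zero
    (a := -(x : ℂ))).isBigO_sub_partialSum_pow N
  have ht : Tendsto (fun t : ℂ => a * t) (𝓝 0) (𝓝 0) := by
    have : Continuous fun t : ℂ => a * t := by fun_prop
    simpa using this.tendsto 0
  have h2 := h.comp_tendsto ht
  refine IsBigO.trans (IsBigO.of_bound 1 (Eventually.of_forall fun t => ?_)) (h2.trans ?_)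
  · rw [one_mul]
    refine le_of_eq (congrArg norm ?_)
    simp only [Function.comp_apply, zero_add]
    congr 1
    simp only [FormalMultilinearSeries.partialSum, binomialSeries_apply, List.ofFn_const,
      List.prod_replicate, smul_eq_mul, choose_neg]
    refine Finset.sum_congr rfl fun i _ => ?_
    rw [mul_pow, neg_pow a]
    ring
  · refine IsBigO.of_bound (‖a‖ ^ N) (Eventually.of_forall fun t => ?_)
    simp [mul_pow]

theorem HasTaylor.mul_pow {f : ℂ → ℂ} {N : ℕ} {c : ℕ → ℂ} (h : HasTaylor f N c) (j : ℕ) :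
    HasTaylor (fun t => t ^ j * f t) N (fun k => if j ≤ k then c (k - j) else 0) := by
  have h1 : (fun t => t ^ j * (f t - ∑ k ∈ Finset.range N, c k * t ^ k)) =O[𝓝 0]
      fun t => t ^ N := by
    have hb : (fun t : ℂ => t ^ j) =O[𝓝 0] fun _ => (1 : ℂ) :=
      (Continuous.tendsto (by fun_prop : Continuous fun t : ℂ => t ^ j) 0).isBigO_one ℂ
    simpa using hb.mul h
  -- The shift by `j` produces terms of degree `N` to `N + j - 1`, which lie beyond the order of the
  -- expansion and are absorbed in the error.
  have h2 : (fun t : ℂ => ∑ k ∈ Finset.Ico N (N + j), (if j ≤ k then c (k - j) else 0) * t ^ k)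
      =O[𝓝 0] fun t => t ^ N := by
    refine IsBigO.fun_sum fun k hk => ?_
    have hNk := (Finset.mem_Ico.mp hk).1
    have hb : (fun t : ℂ => (if j ≤ k then c (k - j) else 0) * t ^ (k - N)) =O[𝓝 0]
        fun _ => (1 : ℂ) := (Continuous.tendsto (by fun_prop) 0).isBigO_one ℂ
    refine (hb.mul (isBigO_refl (fun t : ℂ => t ^ N) _)).congr (fun t => ?_) fun t => by simp
    rw [mul_assoc, ← pow_add, Nat.sub_add_cancel hNk]
  refine (h1.add h2).congr_left fun t => ?_
  have e : t ^ j * ∑ k ∈ Finset.range N, c k * t ^ k =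
      ∑ k ∈ Finset.range (N + j), (if j ≤ k then c (k - j) else 0) * t ^ k := by
    rw [Finset.range_eq_Ico, Finset.range_eq_Ico,
      ← Finset.sum_Ico_consecutive _ (Nat.zero_le j) (Nat.le_add_left j N),
      Finset.sum_eq_zero (s := Finset.Ico 0 j), zero_add, Finset.mul_sum, Finset.sum_Ico_eq_sum_range,
      Finset.sum_Ico_eq_sum_range]
    · simp only [Nat.sub_zero, zero_add, Nat.add_sub_cancel]
      refine Finset.sum_congr rfl fun k _ => ?_
      rw [if_pos (Nat.le_add_right j k), Nat.add_sub_cancel_left, pow_add]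
      ring
    · intro k hk
      rw [if_neg (by have := (Finset.mem_Ico.mp hk).2; omega), zero_mul]
  rw [mul_sub, e, ← Finset.sum_range_add_sum_Ico _ (Nat.le_add_right N j)]
  ring

/-- Taylor coefficients under a change of variables `t ↦ t / (1 + a t)` with a multiplier. -/
theorem tc_moebius {f Φ : ℂ → ℂ} {x : ℝ} {a : ℂ} (hΦ : AnalyticAt ℂ Φ 0) (hf : AnalyticAt ℂ f 0)
    (h : ∀ᶠ t in 𝓝 0, f t = (1 + a * t) ^ (-(x : ℂ)) * Φ (t / (1 + a * t))) (k : ℕ) :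
    tc f k = ∑ j ∈ Finset.range (k + 1),
      tc Φ j * ((-a) ^ (k - j) * ((poch (x + j) (k - j) / (k - j).factorial : ℝ) : ℂ)) := by
  set N := k + 1 with hN
  have hden : Tendsto (fun t : ℂ => 1 + a * t) (𝓝 0) (𝓝 1) := by
    have : Continuous fun t : ℂ => 1 + a * t := by fun_prop
    simpa using this.tendsto 0
  have hne : ∀ᶠ t : ℂ in 𝓝 0, 1 + a * t ≠ 0 := hden.eventually_ne one_ne_zero
  have hσ : Tendsto (fun t : ℂ => t / (1 + a * t)) (𝓝 0) (𝓝 0) := by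
    have := (tendsto_id (α := ℂ) (x := 𝓝 0)).div hden one_ne_zero
    rwa [zero_div] at this
  have hm : (fun t : ℂ => (1 + a * t) ^ (-(x : ℂ))) =O[𝓝 0] fun _ => (1 : ℂ) :=
    (hden.cpow tendsto_const_nhds (by simp)).isBigO_one ℂ
  have hσO : (fun t : ℂ => t / (1 + a * t)) =O[𝓝 0] fun t => t := by
    have h1 : (fun t : ℂ => (1 + a * t)⁻¹) =O[𝓝 0] fun _ => (1 : ℂ) :=
      (hden.inv₀ one_ne_zero).isBigO_one ℂ
    simpa [div_eq_mul_inv] using (isBigO_refl (fun t : ℂ => t) (𝓝 0)).mul h1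
  -- Replacing `Φ` by its Taylor polynomial costs only `O(t^N)`, as `t/(1+at) = O(t)` and the
  -- multiplier is bounded near `0`.
  have h1 : (fun t => (1 + a * t) ^ (-(x : ℂ)) * (Φ (t / (1 + a * t)) -
      ∑ j ∈ Finset.range N, tc Φ j * (t / (1 + a * t)) ^ j)) =O[𝓝 0] fun t => t ^ N := by
    simpa using hm.mul (((hasTaylor_tc hΦ N).comp_tendsto hσ).trans (hσO.pow N))
  -- The `j`-th power of `t/(1+at)`, times the multiplier, is `t^j (1+at)^(-(x+j))`: the exponent is
  -- shifted by `j`, whence the symbol `(x+j)_{k-j}`.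
  have h2 : ∀ j : ℕ, HasTaylor (fun t => t ^ j * (1 + a * t) ^ (-((x + j : ℝ) : ℂ))) N
      (fun k => if j ≤ k then
        (-a) ^ (k - j) * ((poch (x + j) (k - j) / (k - j).factorial : ℝ) : ℂ) else 0) :=
    fun j => (hasTaylor_one_add_cpow (x + j) a N).mul_pow j
  have h3 : HasTaylor f N (fun k => ∑ j ∈ Finset.range N, tc Φ j * (if j ≤ k then
        (-a) ^ (k - j) * ((poch (x + j) (k - j) / (k - j).factorial : ℝ) : ℂ) else 0)) := by
    have h4 := h1.add (IsBigO.fun_sum fun j (_ : j ∈ Finset.range N) =>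
      (h2 j).const_mul_left (tc Φ j))
    refine IsBigO.congr' h4 ?_ EventuallyEq.rfl
    filter_upwards [h, hne] with t ht hnet
    rw [ht]
    have e : ∀ j : ℕ, (1 + a * t) ^ (-((x + j : ℝ) : ℂ)) =
        (1 + a * t) ^ (-(x : ℂ)) * ((1 + a * t) ^ j)⁻¹ := by
      intro j
      rw [← Complex.cpow_natCast, ← Complex.cpow_neg, ← Complex.cpow_add _ _ hnet]
      congr 1
      push_cast
      ring
    simp only [e, mul_sub, Finset.mul_sum, Finset.sum_sub_distrib, Finset.sum_mul, div_pow]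
    rw [Finset.sum_comm (s := Finset.range N) (t := Finset.range N)]
    have e2 : ∀ A B C C' D : ℂ, B = C → D = C' → A - B + (C - D) = A - C' := by
      rintro A B C C' D rfl rfl
      ring
    refine e2 _ _ _ _ _ ?_ ?_
    · refine Finset.sum_congr rfl fun j _ => by
        rw [div_eq_mul_inv]
        ring
    · refine Finset.sum_congr rfl fun j _ => Finset.sum_congr rfl fun i _ => by ring
  rw [(hasTaylor_tc hf N).unique h3 k (Nat.lt_succ_self k)]
  refine Finset.sum_congr rfl fun j hj => ?_
  rw [if_pos (Nat.lt_succ_iff.mp (Finset.mem_range.mp hj))]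

/-- The coefficients of the intertwining operators. -/
def icoeff (N : ℕ) (x : ℝ) (k : ℕ) : ℝ := poch (-(N : ℝ)) k / poch x k

/-- The one-variable identity behind the intertwining property. -/
theorem sum_icoeff_tc_moebius {f Φ : ℂ → ℂ} {x : ℝ} (hx : 0 < x) {a : ℂ} (N : ℕ)
    (hΦ : AnalyticAt ℂ Φ 0) (hf : AnalyticAt ℂ f 0)
    (h : ∀ᶠ t in 𝓝 0, f t = (1 + a * t) ^ (-(x : ℂ)) * Φ (t / (1 + a * t))) :
    ∑ k ∈ Finset.range (N + 1), (icoeff N x k : ℂ) * tc f k =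
      ∑ k ∈ Finset.range (N + 1), (icoeff N x k : ℂ) * (1 + a) ^ (N - k) * tc Φ k := by
  simp only [tc_moebius hΦ hf h, Finset.mul_sum]
  rw [Finset.sum_comm' (t' := Finset.range (N + 1)) (s' := fun j => Finset.Ico j (N + 1))
    (fun k j => by simp only [Finset.mem_range, Finset.mem_Ico]; omega)]
  refine Finset.sum_congr rfl fun j hj => ?_
  have hjN : j ≤ N := Nat.lt_succ_iff.mp (Finset.mem_range.mp hj)
  rw [Finset.sum_Ico_eq_sum_range, add_comm (1 : ℂ) a, add_pow, Finset.mul_sum, Finset.sum_mul,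
    Nat.succ_sub hjN]
  refine Finset.sum_congr rfl fun i _ => ?_
  -- This fixes the choice of `icoeff`. The factor `(x+j)_i` cancels against the denominator of
  -- `A_{j+i}` and leaves `A_j (-1)^i` times a binomial coefficient, so the inner sum is the
  -- expansion of `(1+a)^(N-j)`.
  have h1 : icoeff N x (j + i) * (poch (x + j) i / i.factorial) =
      icoeff N x j * ((-1) ^ i * (N - j).choose i) := by
    have hp : poch (x + j) i ≠ 0 := (poch_pos (by positivity) i).ne'
    have hp2 : poch x j ≠ 0 := (poch_pos hx j).ne'
    have hi : (i.factorial : ℝ) ≠ 0 := by exact_mod_cast i.factorial_ne_zero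
    have e : -(N : ℝ) + j = -((N - j : ℕ) : ℝ) := by
      rw [Nat.cast_sub hjN]
      ring
    rw [icoeff, icoeff, poch_add, poch_add, e, poch_neg_nat (N - j)]
    field_simp
  have h2 := congrArg (fun r : ℝ => (r : ℂ)) h1
  push_cast at h2
  rw [Nat.add_sub_cancel_left, neg_pow a]
  have h3 : ((-1 : ℂ) ^ i) * (-1) ^ i = 1 := by
    rw [← mul_pow]
    simp
  push_cast
  linear_combination (tc Φ j * (-1) ^ i * a ^ i) * h2 +
    tc Φ j * a ^ i * (icoeff N x j * (N - j).choose i) * h3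

end BallKernel
end

/-! ### Polynomial-valued maps and their Taylor coefficients along lines -/

noncomputable section
namespace BallKernel
variable {d : ℕ}

theorem tc_comp_mul {f : ℂ → ℂ} (hf : AnalyticAt ℂ f 0) (r : ℂ) (k : ℕ) :
    tc (fun t => f (r * t)) k = r ^ k * tc f k := by
  have hg : AnalyticAt ℂ (fun t => f (r * t)) 0 := by
    have : AnalyticAt ℂ f (r * 0) := by simpa using hf
    exact this.fun_comp_of_eq (by fun_prop) rfl
  have ht : Tendsto (fun t : ℂ => r * t) (𝓝 0) (𝓝 0) := by
    have : Continuous fun t : ℂ => r * t := by fun_prop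
    simpa using this.tendsto 0
  refine (hasTaylor_tc hg (k + 1)).unique (c' := fun k => r ^ k * tc f k) ?_ k k.lt_succ_self
  have h := (hasTaylor_tc hf (k + 1)).comp_tendsto ht
  refine (h.trans ?_).congr_left fun t => ?_
  · refine IsBigO.of_bound (‖r‖ ^ (k + 1)) (Eventually.of_forall fun t => ?_)
    simp [mul_pow]
  · simp only [Function.comp_apply]
    congr 1
    refine Finset.sum_congr rfl fun i _ => ?_
    ring

theorem tc_congr {f g : ℂ → ℂ} (h : f =ᶠ[𝓝 0] g) (k : ℕ) : tc f k = tc g k := by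
  rw [tc, tc, h.iteratedDeriv_eq]

theorem tc_zero (f : ℂ → ℂ) : tc f 0 = f 0 := by simp [tc]

theorem tc_const (c : ℂ) {k : ℕ} (hk : k ≠ 0) : tc (fun _ => c) k = 0 := by
  simp [tc, iteratedDeriv_const, hk]

/-- Complex polynomials in `d` variables. -/
abbrev Poly (d : ℕ) : Type := MvPolynomial (Fin d) ℂ

/-- The homogeneous polynomials of degree `l`. -/
abbrev Hom (d l : ℕ) : Submodule ℂ (Poly d) := MvPolynomial.homogeneousSubmodule (Fin d) ℂ l

theorem homogeneous_le_restrictTotalDegree {l n : ℕ} (h : l ≤ n) :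
    Hom d l ≤ MvPolynomial.restrictTotalDegree (Fin d) ℂ n := fun _ hq =>
  (MvPolynomial.mem_restrictTotalDegree _ _ _).mpr
    ((((MvPolynomial.mem_homogeneousSubmodule _ _).mp hq).totalDegree_le).trans h)

instance (l : ℕ) : FiniteDimensional ℂ (Hom d l) :=
  Submodule.finiteDimensional_of_le (homogeneous_le_restrictTotalDegree le_rfl)

theorem eval_smul_of_homogeneous {l : ℕ} {q : Poly d} (hq : q ∈ Hom d l) (s : ℂ) (ζ : Z d) :
    MvPolynomial.eval (s • ζ) q = s ^ l * MvPolynomial.eval ζ q := by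
  rw [MvPolynomial.eval_eq, MvPolynomial.eval_eq, Finset.mul_sum]
  refine Finset.sum_congr rfl fun β hβ => ?_
  have hdeg := hq.degree_eq_sum_deg_support hβ
  simp only [PiLp.smul_apply, smul_eq_mul, mul_pow, Finset.prod_mul_distrib]
  rw [Finset.prod_pow_eq_pow_sum, ← hdeg]
  ring

theorem eval_eq_sum_homogeneous {n : ℕ} {q : Poly d}
    (hq : q ∈ MvPolynomial.restrictTotalDegree (Fin d) ℂ n) :
    q = ∑ m ∈ Finset.range (n + 1), MvPolynomial.homogeneousComponent m q := by
  have hq' := (MvPolynomial.mem_restrictTotalDegree _ _ _).mp hq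
  conv_lhs => rw [← MvPolynomial.sum_homogeneousComponent q]
  refine Finset.sum_subset (Finset.range_mono (by omega)) fun m _ hm => ?_
  exact MvPolynomial.homogeneousComponent_eq_zero _ _ (by simpa using hm)

theorem differentiable_eval (q : Poly d) :
    Differentiable ℂ fun ζ : Z d => MvPolynomial.eval ζ q := by
  induction q using MvPolynomial.induction_on with
  | C a => simp
  | add p q hp hq =>
    simp only [map_add]
    exact hp.add hq
  | mul_X p i hp =>
    simp only [map_mul, MvPolynomial.eval_X]
    exact hp.mul (EuclideanSpace.proj (𝕜 := ℂ) i).differentiable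

/-- A polynomial is determined by its values near the origin. -/
theorem eval_eq_of_eqOn_ball {p q : Poly d} {r : ℝ} (hr : 0 < r)
    (h : ∀ ζ : Z d, ‖ζ‖ < r → MvPolynomial.eval ζ p = MvPolynomial.eval ζ q) (ζ : Z d) :
    MvPolynomial.eval ζ p = MvPolynomial.eval ζ q := by
  have hd : ∀ p : Poly d, Differentiable ℂ fun t : ℂ => MvPolynomial.eval (t • ζ) p :=
    fun p => (differentiable_eval p).comp (differentiable_id.smul_const ζ)
  have ha : ∀ p : Poly d, AnalyticOnNhd ℂ (fun t : ℂ => MvPolynomial.eval (t • ζ) p) Set.univ :=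
    fun p => (hd p).differentiableOn.analyticOnNhd isOpen_univ
  have hev : ∀ᶠ t : ℂ in 𝓝 0, MvPolynomial.eval (t • ζ) p = MvPolynomial.eval (t • ζ) q := by
    have hc : Continuous fun t : ℂ => ‖t • ζ‖ := by fun_prop
    have : ∀ᶠ t : ℂ in 𝓝 0, ‖t • ζ‖ < r := hc.continuousAt.eventually (gt_mem_nhds (by simpa))
    filter_upwards [this] with t ht using h _ ht
  have := (ha p).eqOn_of_preconnected_of_eventuallyEq (ha q) isPreconnected_univ
    (Set.mem_univ 0) hev (Set.mem_univ 1)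
  simpa using this

/-- A class of coefficient functions that are holomorphic on the ball and closed under
directional derivatives there. -/
structure IsCoeffClass (A : Submodule ℂ (Z d → ℂ)) : Prop where
  differentiableOn : ∀ a ∈ A, DifferentiableOn ℂ a (Metric.ball 0 1)
  deriv : ∀ a ∈ A, ∀ v, ∃ b ∈ A, ∀ z ∈ Metric.ball (0 : Z d) 1, fderiv ℂ a z v = b z

variable (d) in
/-- The functions that are holomorphic on the ball. -/
def holClass : Submodule ℂ (Z d → ℂ) where
  carrier := {a | DifferentiableOn ℂ a (Metric.ball 0 1)}
  add_mem' ha hb := DifferentiableOn.add ha hb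
  zero_mem' := differentiableOn_const 0
  smul_mem' c _ ha := DifferentiableOn.const_smul ha c

theorem isCoeffClass_holClass : IsCoeffClass (holClass d) :=
  ⟨fun _ ha => ha, fun _ ha v => ⟨_, differentiableOn_fderiv_apply Metric.isOpen_ball ha v,
    fun _ _ => rfl⟩⟩

variable (d) in
/-- The polynomial functions. -/
def polyClass : Submodule ℂ (Z d → ℂ) where
  carrier := {a | ∃ p : Poly d, ∀ z : Z d, a z = MvPolynomial.eval z p}
  add_mem' := by
    rintro a b ⟨p, hp⟩ ⟨q, hq⟩
    exact ⟨p + q, fun z => by simp [hp, hq]⟩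
  zero_mem' := ⟨0, fun z => by simp⟩
  smul_mem' := by
    rintro c a ⟨p, hp⟩
    exact ⟨c • p, fun z => by simp [hp, MvPolynomial.smul_eval]⟩

theorem exists_fderiv_eval (p : Poly d) (v : Z d) :
    ∃ q : Poly d, ∀ z : Z d,
      HasFDerivAt (fun z : Z d => MvPolynomial.eval z p)
        (fderiv ℂ (fun z : Z d => MvPolynomial.eval z p) z) z ∧
      fderiv ℂ (fun z : Z d => MvPolynomial.eval z p) z v = MvPolynomial.eval z q := by
  suffices h : ∃ q : Poly d, ∀ z : Z d,
      fderiv ℂ (fun z : Z d => MvPolynomial.eval z p) z v = MvPolynomial.eval z q by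
    obtain ⟨q, hq⟩ := h
    exact ⟨q, fun z => ⟨(differentiable_eval p z).hasFDerivAt, hq z⟩⟩
  induction p using MvPolynomial.induction_on with
  | C a => exact ⟨0, fun z => by simp⟩
  | add p q hp hq =>
    obtain ⟨p', hp⟩ := hp
    obtain ⟨q', hq⟩ := hq
    refine ⟨p' + q', fun z => ?_⟩
    simp only [map_add]
    rw [fderiv_fun_add (differentiable_eval p z) (differentiable_eval q z), add_apply, hp, hq]
  | mul_X p i hp =>
    obtain ⟨p', hp⟩ := hp
    refine ⟨p' * MvPolynomial.X i + MvPolynomial.C (v i) * p, fun z => ?_⟩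
    simp only [map_mul, MvPolynomial.eval_X]
    have hX : HasFDerivAt (fun z : Z d => z i) (EuclideanSpace.proj (𝕜 := ℂ) i) z :=
      (EuclideanSpace.proj (𝕜 := ℂ) i).hasFDerivAt
    rw [((differentiable_eval p z).hasFDerivAt.fun_mul hX).fderiv]
    simp [hp]
    ring

theorem isCoeffClass_polyClass : IsCoeffClass (polyClass d) := by
  refine ⟨?_, ?_⟩
  · rintro a ⟨p, hp⟩
    rw [show a = fun z : Z d => MvPolynomial.eval z p from funext hp]
    exact (differentiable_eval p).differentiableOn
  · rintro a ⟨p, hp⟩ v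
    rw [show a = fun z : Z d => MvPolynomial.eval z p from funext hp]
    obtain ⟨q, hq⟩ := exists_fderiv_eval p v
    exact ⟨_, ⟨q, fun z => rfl⟩, fun z _ => (hq z).2⟩

/-- The maps `∑ aᵢ(z) qᵢ(ζ)` with `aᵢ` in a class of coefficients and `qᵢ` in a space of
polynomials. -/
def PMaps (A : Submodule ℂ (Z d → ℂ)) (V : Submodule ℂ (Poly d)) : Submodule ℂ (Z d → Z d → ℂ) :=
  Submodule.span ℂ {G | ∃ a ∈ A, ∃ q ∈ V, G = fun (z ζ : Z d) => a z * MvPolynomial.eval ζ q}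

theorem mul_eval_mem_PMaps {A : Submodule ℂ (Z d → ℂ)} {V : Submodule ℂ (Poly d)} {a : Z d → ℂ}
    (ha : a ∈ A) {q : Poly d} (hq : q ∈ V) :
    (fun (z ζ : Z d) => a z * MvPolynomial.eval ζ q) ∈ PMaps A V :=
  Submodule.subset_span ⟨a, ha, q, hq, rfl⟩

theorem PMaps_mono {A : Submodule ℂ (Z d → ℂ)} {V W : Submodule ℂ (Poly d)} (h : V ≤ W) :
    PMaps A V ≤ PMaps A W := Submodule.span_mono fun _ ⟨a, ha, q, hq, e⟩ => ⟨a, ha, q, h hq, e⟩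

/-- Every property of the maps `a(z) q(ζ)` that is linear holds for all elements of `PMaps`. -/
theorem PMaps_induction {A : Submodule ℂ (Z d → ℂ)} {V : Submodule ℂ (Poly d)}
    {P : (Z d → Z d → ℂ) → Prop} (h1 : ∀ a ∈ A, ∀ q ∈ V, P fun (z ζ : Z d) => a z * MvPolynomial.eval ζ q)
    (h0 : P 0) (hadd : ∀ F G, P F → P G → P (F + G)) (hs : ∀ (c : ℂ) F, P F → P (c • F))
    {G : Z d → Z d → ℂ} (hG : G ∈ PMaps A V) : P G := by
  induction hG using Submodule.span_induction with
  | mem x h =>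
    obtain ⟨a, ha, q, hq, rfl⟩ := h
    exact h1 a ha q hq
  | zero => exact h0
  | add x y _ _ hx hy => exact hadd _ _ hx hy
  | smul c x _ hx => exact hs c x hx

theorem PMaps_isHolomorphicMap {A : Submodule ℂ (Z d → ℂ)} (hA : IsCoeffClass A)
    {V : Submodule ℂ (Poly d)} {G : Z d → Z d → ℂ} (hG : G ∈ PMaps A V) :
    IsHolomorphicMap V (fun x => G x.1 x.2) := by
  refine PMaps_induction (P := fun G => IsHolomorphicMap V (fun x => G x.1 x.2))
    (fun a ha q hq => ?_) ?_ ?_ ?_ hG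
  · exact ⟨fun z => ⟨a z • q, V.smul_mem _ hq, fun ζ => by simp [MvPolynomial.smul_eval]⟩,
      fun ζ => ⟨fun z => a z * MvPolynomial.eval ζ q,
        (hA.differentiableOn a ha).mul_const _, fun z => rfl⟩⟩
  · exact ⟨fun z => ⟨0, V.zero_mem, fun ζ => by simp⟩,
      fun ζ => ⟨0, differentiableOn_const 0, fun z => rfl⟩⟩
  · rintro F G ⟨hF1, hF2⟩ ⟨hG1, hG2⟩
    refine ⟨fun z => ?_, fun ζ => ?_⟩
    · obtain ⟨p, hp, hp'⟩ := hF1 z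
      obtain ⟨q, hq, hq'⟩ := hG1 z
      exact ⟨p + q, V.add_mem hp hq, fun ζ => by
        rw [map_add, ← hp', ← hq']
        rfl⟩
    · obtain ⟨f, hf, hf'⟩ := hF2 ζ
      obtain ⟨g, hg, hg'⟩ := hG2 ζ
      exact ⟨f + g, hf.add hg, fun z => by
        rw [Pi.add_apply, ← hf', ← hg']
        rfl⟩
  · rintro c F ⟨hF1, hF2⟩
    refine ⟨fun z => ?_, fun ζ => ?_⟩
    · obtain ⟨p, hp, hp'⟩ := hF1 z
      exact ⟨c • p, V.smul_mem c hp, fun ζ => by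
        rw [MvPolynomial.smul_eval, ← hp']
        rfl⟩
    · obtain ⟨f, hf, hf'⟩ := hF2 ζ
      exact ⟨c • f, hf.const_smul c, fun z => by
        rw [Pi.smul_apply, ← hf']
        rfl⟩

/-- Linear functionals on a finite-dimensional space of polynomials are combinations of
evaluations. -/
theorem exists_eq_sum_eval {V : Submodule ℂ (Poly d)} [FiniteDimensional ℂ V]
    (φ : Module.Dual ℂ V) :
    ∃ c : Z d →₀ ℂ, ∀ q : V, φ q = c.sum fun ζ s => s * MvPolynomial.eval ζ (q : Poly d) := by
  let ev : Z d → Module.Dual ℂ V := fun ζ =>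
    { toFun := fun q => MvPolynomial.eval ζ (q : Poly d)
      map_add' := fun p q => by simp
      map_smul' := fun c q => by simp [MvPolynomial.smul_eval] }
  -- A polynomial killed by all evaluations is zero, so the evaluations have trivial common kernel
  -- and, in finite dimension, span the dual.
  have htop : Submodule.span ℂ (Set.range ev) = ⊤ := by
    rw [← Subspace.dualCoannihilator_dualAnnihilator_eq (W := Submodule.span ℂ (Set.range ev))]
    have : (Submodule.span ℂ (Set.range ev)).dualCoannihilator = ⊥ := by
      rw [eq_bot_iff]
      intro q hq
      rw [Submodule.mem_dualCoannihilator] at hq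
      have h0 : (q : Poly d) = 0 := MvPolynomial.funext fun x => by
        have := hq (ev (WithLp.toLp 2 x)) (Submodule.subset_span ⟨_, rfl⟩)
        simpa [ev] using this
      simpa using h0
    rw [this, Submodule.dualAnnihilator_bot]
  have hφ : φ ∈ Submodule.span ℂ (Set.range ev) := htop ▸ Submodule.mem_top
  obtain ⟨c, hc⟩ := Finsupp.mem_span_range_iff_exists_finsupp.mp hφ
  refine ⟨c, fun q => ?_⟩
  rw [← hc, Finsupp.sum, Finsupp.sum, LinearMap.sum_apply]
  rfl

/-- Holomorphy is given only for each fixed `ζ`. The coordinates of `F_z` in a basis of `V` are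
finite combinations of values `F (z, η)`, hence holomorphic in `z`. -/
theorem IsHolomorphicMap.exists_PMaps {V : Submodule ℂ (Poly d)} [FiniteDimensional ℂ V]
    {F : Pt d → ℂ} (hF : IsHolomorphicMap V F) :
    ∃ G ∈ PMaps (holClass d) V, ∀ (z : D d) (ζ : Z d), F (z, ζ) = G z ζ := by
  let b := Module.finBasis ℂ V
  choose c hc using fun k => exists_eq_sum_eval (b.coord k)
  choose f hf hf' using hF.2
  have hc' : ∀ k, (fun z => (c k).sum fun η s => s * f η z) ∈ holClass d := fun k =>
    DifferentiableOn.fun_sum fun η _ => (hf η).const_mul _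
  refine ⟨∑ k, fun z ζ => ((c k).sum fun η s => s * f η z) * MvPolynomial.eval ζ (b k : Poly d),
    Submodule.sum_mem _ fun k _ => mul_eval_mem_PMaps (hc' k) (b k).2, fun z ζ => ?_⟩
  · obtain ⟨q, hq, hq'⟩ := hF.1 z
    have h1 : (q : Poly d) = ∑ k, b.coord k ⟨q, hq⟩ • (b k : Poly d) := by
      have := congrArg V.subtype (b.sum_repr ⟨q, hq⟩)
      rw [map_sum] at this
      exact this.symm
    rw [hq', h1, Finset.sum_apply, Finset.sum_apply, map_sum]
    refine Finset.sum_congr rfl fun k _ => ?_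
    rw [MvPolynomial.smul_eval, hc]
    congr 1
    refine Finset.sum_congr rfl fun η _ => ?_
    simp only
    rw [← hq', hf']

/-- The derivative along the second variable increases the degree by one. -/
theorem PMaps_hasDerivAt {A : Submodule ℂ (Z d → ℂ)} (hA : IsCoeffClass A) {l : ℕ}
    {G : Z d → Z d → ℂ} (hG : G ∈ PMaps A (Hom d l)) :
    ∃ G' ∈ PMaps A (Hom d (l + 1)), ∀ z ζ : Z d, ∀ t : ℂ, z + t • ζ ∈ Metric.ball (0 : Z d) 1 →
      HasDerivAt (fun t : ℂ => G (z + t • ζ) ζ) (G' (z + t • ζ) ζ) t := by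
  refine PMaps_induction (P := fun G => ∃ G' ∈ PMaps A (Hom d (l + 1)), ∀ z ζ : Z d, ∀ t : ℂ,
    z + t • ζ ∈ Metric.ball (0 : Z d) 1 →
      HasDerivAt (fun t : ℂ => G (z + t • ζ) ζ) (G' (z + t • ζ) ζ) t)
    (fun a ha q hq => ?_) ?_ ?_ ?_ hG
  · choose b hb hb' using fun i => hA.deriv a ha (EuclideanSpace.single i 1)
    have hX : ∀ i, MvPolynomial.X i * q ∈ Hom d (l + 1) := fun i => by
      rw [MvPolynomial.mem_homogeneousSubmodule, add_comm]
      exact (MvPolynomial.isHomogeneous_X ℂ i).mul hq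
    refine ⟨∑ i, fun z ζ => b i z * MvPolynomial.eval ζ (MvPolynomial.X i * q),
      Submodule.sum_mem _ fun i _ => mul_eval_mem_PMaps (hb i) (hX i), fun z ζ t ht => ?_⟩
    · have h1 := (hasDerivAt_line ((hA.differentiableOn a ha).differentiableAt
        (Metric.isOpen_ball.mem_nhds ht))).mul_const (MvPolynomial.eval ζ q)
      refine h1.congr_deriv ?_
      have hζ : ζ = ∑ i, ζ i • EuclideanSpace.single i (1 : ℂ) := by
        conv_lhs => rw [← (EuclideanSpace.basisFun (Fin d) ℂ).sum_repr ζ]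
        simp
      have h2 : fderiv ℂ a (z + t • ζ) ζ = ∑ i, ζ i * b i (z + t • ζ) := by
        generalize z + t • ζ = w at ht
        conv_lhs => rw [hζ]
        simp only [map_sum, map_smul, hb' _ _ ht, smul_eq_mul]
      rw [h2]
      simp only [Finset.sum_apply, map_mul, MvPolynomial.eval_X, Finset.sum_mul]
      refine Finset.sum_congr rfl fun i _ => by ring
  · exact ⟨0, Submodule.zero_mem _, fun z ζ t _ => hasDerivAt_const t 0⟩
  · rintro F G ⟨F', hF, hF'⟩ ⟨G', hG, hG'⟩
    exact ⟨F' + G', Submodule.add_mem _ hF hG, fun z ζ t ht => (hF' z ζ t ht).add (hG' z ζ t ht)⟩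
  · rintro c F ⟨F', hF, hF'⟩
    exact ⟨c • F', Submodule.smul_mem _ c hF, fun z ζ t ht => (hF' z ζ t ht).const_smul c⟩

theorem eventually_line_mem {z : Z d} (hz : z ∈ Metric.ball (0 : Z d) 1) (ζ : Z d) :
    ∀ᶠ t : ℂ in 𝓝 0, z + t • ζ ∈ Metric.ball (0 : Z d) 1 := by
  have hc : Continuous fun t : ℂ => z + t • ζ := by fun_prop
  exact hc.continuousAt.eventually (Metric.isOpen_ball.mem_nhds (by simpa using hz))

/-- Each derivative along `t ↦ z + tζ` contributes one factor linear in `ζ`, so the coefficient of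
order `k` has degree `l + k`. Keeping the class `A` general serves both holomorphic maps and
polynomial maps. -/
theorem PMaps_tc {A : Submodule ℂ (Z d → ℂ)} (hA : IsCoeffClass A) (k : ℕ) {l : ℕ}
    {G : Z d → Z d → ℂ} (hG : G ∈ PMaps A (Hom d l)) :
    ∃ G' ∈ PMaps A (Hom d (l + k)), ∀ z ∈ Metric.ball (0 : Z d) 1, ∀ ζ : Z d,
      tc (fun t : ℂ => G (z + t • ζ) ζ) k = G' z ζ := by
  suffices h : ∃ G' ∈ PMaps A (Hom d (l + k)), ∀ z ∈ Metric.ball (0 : Z d) 1, ∀ ζ : Z d,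
      iteratedDeriv k (fun t : ℂ => G (z + t • ζ) ζ) 0 = G' z ζ by
    obtain ⟨G', hG', h⟩ := h
    refine ⟨(k.factorial : ℂ)⁻¹ • G', Submodule.smul_mem _ _ hG', fun z hz ζ => ?_⟩
    rw [tc, h z hz, div_eq_inv_mul]
    rfl
  induction k generalizing l G with
  | zero => exact ⟨G, hG, fun z _ ζ => by simp⟩
  | succ k ih =>
    obtain ⟨G1, hG1, h1⟩ := PMaps_hasDerivAt hA hG
    obtain ⟨G2, hG2, h2⟩ := ih hG1
    refine ⟨G2, by rwa [show l + (k + 1) = l + 1 + k by ring], fun z hz ζ => ?_⟩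
    rw [← h2 z hz ζ, iteratedDeriv_succ']
    refine Filter.EventuallyEq.iteratedDeriv_eq _ ?_
    filter_upwards [eventually_line_mem hz ζ] with t ht using (h1 z ζ t ht).deriv

theorem PMaps_analyticAt {A : Submodule ℂ (Z d → ℂ)} (hA : IsCoeffClass A)
    {V : Submodule ℂ (Poly d)} {G : Z d → Z d → ℂ} (hG : G ∈ PMaps A V) {z : Z d}
    (hz : z ∈ Metric.ball (0 : Z d) 1) (ζ η : Z d) :
    AnalyticAt ℂ (fun t : ℂ => G (z + t • ζ) η) 0 := by
  rw [Complex.analyticAt_iff_eventually_differentiableAt]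
  obtain ⟨f, hf, hf'⟩ := (PMaps_isHolomorphicMap hA hG).2 η
  filter_upwards [(eventually_line_mem hz ζ).eventually_nhds] with t ht
  refine (hasDerivAt_line (hf.differentiableAt
    (Metric.isOpen_ball.mem_nhds ht.self_of_nhds))).differentiableAt.congr_of_eventuallyEq ?_
  filter_upwards [ht] with s hs using hf' ⟨_, hs⟩

end BallKernel
end

/-! ### The intertwining differential operator -/

noncomputable section
namespace BallKernel
variable {d : ℕ}

open scoped Classical in
/-- The function `t ↦ F_{z + tζ}(ζ)`, extended by `0`. -/
def line (F : Pt d → ℂ) (z : D d) (ζ : Z d) (t : ℂ) : ℂ :=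
  if h : (z : Z d) + t • ζ ∈ Metric.ball (0 : Z d) 1 then F (⟨_, h⟩, ζ) else 0

theorem line_of_mem (F : Pt d → ℂ) (z : D d) (ζ : Z d) {t : ℂ}
    (h : (z : Z d) + t • ζ ∈ Metric.ball (0 : Z d) 1) : line F z ζ t = F (⟨_, h⟩, ζ) := dif_pos h

theorem line_zero (F : Pt d → ℂ) (z : D d) (ζ : Z d) : line F z ζ 0 = F (z, ζ) := by
  rw [line_of_mem F z ζ (by simp)]
  congr 2
  simp

theorem line_eventuallyEq {F : Pt d → ℂ} {G : Z d → Z d → ℂ}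
    (h : ∀ (z : D d) (ζ : Z d), F (z, ζ) = G z ζ) (z : D d) (ζ : Z d) :
    line F z ζ =ᶠ[𝓝 0] fun t => G (z + t • ζ) ζ := by
  filter_upwards [eventually_line_mem z.2 ζ] with t ht
  rw [line_of_mem F z ζ ht, h]

/-- The differential operator `∑ A_k (ζ·∂_z)^k / k!` intertwining the multiplier actions. -/
def iop (N : ℕ) (x : ℝ) (F : Pt d → ℂ) : Pt d → ℂ := fun p =>
  ∑ k ∈ Finset.range (N + 1), (icoeff N x k : ℂ) * tc (line F p.1 p.2) k

theorem icoeff_zero (N : ℕ) (x : ℝ) : icoeff N x 0 = 1 := by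
  simp [icoeff, poch_zero]

variable {V : Submodule ℂ (Poly d)} [FiniteDimensional ℂ V]

theorem line_analyticAt {F : Pt d → ℂ} (hF : IsHolomorphicMap V F) (z : D d) (ζ : Z d) :
    AnalyticAt ℂ (line F z ζ) 0 := by
  obtain ⟨G, hG, h⟩ := hF.exists_PMaps
  exact (PMaps_analyticAt isCoeffClass_holClass hG z.2 ζ ζ).congr (line_eventuallyEq h z ζ).symm

theorem tc_const_mul (c : ℂ) (f : ℂ → ℂ) (k : ℕ) : tc (fun t => c * f t) k = c * tc f k := by
  rw [tc, tc, iteratedDeriv_const_mul_field, mul_div_assoc]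

theorem tc_add {f g : ℂ → ℂ} (hf : AnalyticAt ℂ f 0) (hg : AnalyticAt ℂ g 0) (k : ℕ) :
    tc (fun t => f t + g t) k = tc f k + tc g k := by
  rw [tc, tc, tc, ← add_div]
  congr 1
  exact iteratedDeriv_add hf.contDiffAt hg.contDiffAt

theorem line_add (F G : Pt d → ℂ) (z : D d) (ζ : Z d) :
    line (F + G) z ζ = fun t => line F z ζ t + line G z ζ t := by
  ext t
  by_cases h : (z : Z d) + t • ζ ∈ Metric.ball (0 : Z d) 1
  · simp [line_of_mem _ z ζ h]
  · simp [line, h]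

theorem line_smul (c : ℂ) (F : Pt d → ℂ) (z : D d) (ζ : Z d) :
    line (c • F) z ζ = fun t => c * line F z ζ t := by
  ext t
  by_cases h : (z : Z d) + t • ζ ∈ Metric.ball (0 : Z d) 1
  · simp [line_of_mem _ z ζ h]
  · simp [line, h]

theorem iop_add {F G : Pt d → ℂ} (hF : IsHolomorphicMap V F) (hG : IsHolomorphicMap V G) (N : ℕ)
    (x : ℝ) : iop N x (F + G) = iop N x F + iop N x G := by
  ext p
  simp only [iop, line_add, Pi.add_apply, ← Finset.sum_add_distrib]
  refine Finset.sum_congr rfl fun k _ => ?_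
  rw [tc_add (line_analyticAt hF _ _) (line_analyticAt hG _ _), mul_add]

theorem iop_smul (c : ℂ) (F : Pt d → ℂ) (N : ℕ) (x : ℝ) : iop N x (c • F) = c • iop N x F := by
  ext p
  simp only [iop, line_smul, tc_const_mul, Pi.smul_apply, smul_eq_mul, Finset.mul_sum]
  refine Finset.sum_congr rfl fun k _ => by ring

/-- Only the term `k = 0` survives, and `A_0 = 1`. This is the normalization demanded of the
intertwiners. -/
theorem iop_of_const {F : Pt d → ℂ} (hF : ∀ (z w : D d) (ζ : Z d), F (z, ζ) = F (w, ζ)) (N : ℕ)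
    (x : ℝ) : iop N x F = F := by
  ext ⟨z, ζ⟩
  have h : line F z ζ =ᶠ[𝓝 0] fun _ => F (z, ζ) :=
    line_eventuallyEq (G := fun _ ζ => F (origin d, ζ)) (fun w η => hF w _ η) z ζ |>.trans
      (Eventually.of_forall fun t => hF _ _ _)
  rw [iop, Finset.sum_range_succ', Finset.sum_eq_zero, icoeff_zero, tc_congr h, tc_zero]
  · simp
  · intro k _
    rw [tc_congr h, tc_const _ k.succ_ne_zero, mul_zero]

/-- The image of a map under the intertwining operator, by degree in the second variable. -/
theorem iop_eq_sum {A : Submodule ℂ (Z d → ℂ)} (hA : IsCoeffClass A) {l : ℕ} {F : Pt d → ℂ}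
    {G : Z d → Z d → ℂ} (hG : G ∈ PMaps A (Hom d l))
    (h : ∀ (z : D d) (ζ : Z d), F (z, ζ) = G z ζ) (N : ℕ) (x : ℝ) :
    ∃ R : ℕ → Z d → Z d → ℂ, (∀ k, R k ∈ PMaps A (Hom d (l + k))) ∧
      (∀ (z : D d) (ζ : Z d) (k : ℕ), (icoeff N x k : ℂ) * tc (line F z ζ) k = R k z ζ) ∧
      ∀ (z : D d) (ζ : Z d), iop N x F (z, ζ) = ∑ k ∈ Finset.range (N + 1), R k z ζ := by
  choose R hR hR' using fun k => PMaps_tc hA k hG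
  have h1 : ∀ (z : D d) (ζ : Z d) (k : ℕ), (icoeff N x k : ℂ) * tc (line F z ζ) k =
      ((icoeff N x k : ℂ) • R k) z ζ := fun z ζ k => by
    rw [tc_congr (line_eventuallyEq h z ζ), hR' k z z.2]
    rfl
  exact ⟨fun k => (icoeff N x k : ℂ) • R k, fun k => Submodule.smul_mem _ _ (hR k), h1,
    fun z ζ => Finset.sum_congr rfl fun k _ => h1 z ζ k⟩

theorem iop_isHolomorphicMap {l n : ℕ} (hl : l ≤ n) {F : Pt d → ℂ}
    (hF : IsHolomorphicMap (Hom d l) F) (x : ℝ) :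
    IsHolomorphicMap (MvPolynomial.restrictTotalDegree (Fin d) ℂ n) (iop (n - l) x F) := by
  obtain ⟨G, hG, h⟩ := hF.exists_PMaps
  obtain ⟨R, hR, -, h2⟩ := iop_eq_sum isCoeffClass_holClass hG h (n - l) x
  have : iop (n - l) x F =
      fun p => (∑ k ∈ Finset.range (n - l + 1), R k) (p.1 : Z d) p.2 := by
    ext ⟨z, ζ⟩
    rw [h2, Finset.sum_apply, Finset.sum_apply]
  rw [this]
  refine PMaps_isHolomorphicMap isCoeffClass_holClass (Submodule.sum_mem _ fun k hk => ?_)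
  exact PMaps_mono (homogeneous_le_restrictTotalDegree
    (by have := Finset.mem_range.mp hk; omega)) (hR k)

theorem IsHolomorphicMap.apply_smul {l : ℕ} {F : Pt d → ℂ} (hF : IsHolomorphicMap (Hom d l) F)
    (z : D d) (s : ℂ) (ζ : Z d) : F (z, s • ζ) = s ^ l * F (z, ζ) := by
  obtain ⟨q, hq, h⟩ := hF.1 z
  rw [h, h, eval_smul_of_homogeneous hq]

/-- Scaling `ζ` by `s` reparametrizes the line, giving `s ^ k`, and scales the polynomial argument,
giving `s ^ l`. -/
theorem tc_line_smul {l : ℕ} {F : Pt d → ℂ} (hF : IsHolomorphicMap (Hom d l) F) (z : D d) (s : ℂ)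
    (ζ : Z d) (k : ℕ) : tc (line F z (s • ζ)) k = s ^ (l + k) * tc (line F z ζ) k := by
  have h : line F z (s • ζ) = fun t => s ^ l * line F z ζ (s * t) := by
    ext t
    have e : (z : Z d) + t • s • ζ = z + (s * t) • ζ := by rw [smul_smul, mul_comm]
    by_cases hm : (z : Z d) + (s * t) • ζ ∈ Metric.ball (0 : Z d) 1
    · rw [line_of_mem F z ζ hm, line_of_mem F z _ (by rw [e]; exact hm), hF.apply_smul]
      simp only [e]
    · rw [line, line, dif_neg hm, dif_neg (by rw [e]; exact hm), mul_zero]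
  rw [h, tc_const_mul, tc_comp_mul (line_analyticAt hF z ζ), pow_add, mul_assoc]

theorem actDeriv_add_smul (g : Mat d) (z ζ : Z d) (t : ℂ) (hz : den g z ≠ 0)
    (ht : den g (z + t • ζ) ≠ 0) :
    actDeriv g (z + t • ζ) ζ = ((den g z / den g (z + t • ζ)) ^ 2) • actDeriv g z ζ := by
  ext i
  simp only [actDeriv, PiLp.smul_apply, smul_eq_mul]
  rw [num_add_smul]
  field_simp
  rw [den_add_smul]
  ring

/-- The exponent `ν + 2l` has two sources: `ν` from the determinant factor, and `2l` from evaluating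
an `l`-homogeneous polynomial at a derivative that scales by the square of the denominator ratio
along the line. -/
theorem line_translate {ν : ℝ} {g : SU d} {l : ℕ} {F F' : Pt d → ℂ}
    (hF : IsHolomorphicMap (Hom d l) F) (h : IsLittleTranslate ν g F F') (z : D d) (ζ : Z d) :
    ∀ᶠ t in 𝓝 0, line F' z ζ t =
      (1 + denLin g.1 ζ / den g.1 z * t) ^ (-((ν + 2 * l : ℝ) : ℂ)) *
      (detPow ν g z * line F (actBall g z) (actDeriv g.1 z ζ)
        (t / (1 + denLin g.1 ζ / den g.1 z * t))) := by
  have hz := den_ne_zero g z.2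
  set a := denLin g.1 ζ / den g.1 z with ha
  have hcont : Continuous fun t : ℂ => (1 + a * t).re := by fun_prop
  have hre : ∀ᶠ t : ℂ in 𝓝 0, 0 < (1 + a * t).re :=
    hcont.continuousAt.eventually (lt_mem_nhds (by simp))
  filter_upwards [eventually_line_mem z.2 ζ, hre] with t ht hret
  have hu : 1 + a * t ≠ 0 := fun h0 => by simp [h0] at hret
  have hdt := den_ne_zero g ht
  have hden : den g.1 ((z : Z d) + t • ζ) = den g.1 z * (1 + a * t) := by
    rw [den_add_smul, ha]
    field_simp
  have hdet : detPow ν g ⟨_, ht⟩ = detPow ν g z * (1 + a * t) ^ (-(ν : ℂ)) := by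
    simp only [detPow]
    rw [hden, mul_div_right_comm, mul_cpow_of_re_pos (re_den_div_pos g z.2) hret]
    ring
  have hact : act g.1 ((z : Z d) + t • ζ) = act g.1 z + (t / (1 + a * t)) • actDeriv g.1 z ζ := by
    rw [act_add_smul g.1 z ζ t hz hdt, hden]
    congr 2
    field_simp
  have hmem : ((actBall g z : D d) : Z d) + (t / (1 + a * t)) • actDeriv g.1 z ζ ∈
      Metric.ball (0 : Z d) 1 := by
    rw [show ((actBall g z : D d) : Z d) = act g.1 z from rfl, ← hact]
    exact act_mem_ball g.2 ⟨_, ht⟩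
  rw [line_of_mem F' z ζ ht, h, hdet, line_of_mem _ _ _ hmem, fderiv_act _ hdt,
    actDeriv_add_smul g.1 z ζ t hz hdt, hF.apply_smul, hden]
  have e1 : actBall g ⟨_, ht⟩ = ⟨_, hmem⟩ := Subtype.ext hact
  have e2 : (1 + a * t) ^ (-((ν + 2 * l : ℝ) : ℂ)) =
      (1 + a * t) ^ (-(ν : ℂ)) * ((den g.1 z / (den g.1 z * (1 + a * t))) ^ 2) ^ l := by
    have : den g.1 z / (den g.1 z * (1 + a * t)) = (1 + a * t)⁻¹ := by field_simp
    rw [this, ← pow_mul, inv_pow, ← Complex.cpow_natCast, ← Complex.cpow_neg,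
      ← Complex.cpow_add _ _ hu]
    congr 1
    push_cast
    ring
  rw [e1, e2]
  ring

/-- The intertwining property. -/
theorem iop_translate {ν : ℝ} (hν : 0 < ν) {g : SU d} {l n : ℕ} (hl : l ≤ n) {F F' : Pt d → ℂ}
    (hF : IsHolomorphicMap (Hom d l) F) (hF' : IsHolomorphicMap (Hom d l) F')
    (h : IsLittleTranslate ν g F F') :
    IsBigTranslate ν n g (iop (n - l) (ν + 2 * l) F) (iop (n - l) (ν + 2 * l) F') := by
  intro z ζ hden
  have hz := den_ne_zero g z.2
  set a := denLin g.1 ζ / den g.1 z with ha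
  have hden1 : den g.1 ((z : Z d) + ζ) = den g.1 z * (1 + a) := by
    have := den_add_smul g.1 z ζ 1
    rw [one_smul, one_mul] at this
    rw [this, ha]
    field_simp
  have ha1 : 1 + a ≠ 0 := fun h0 => hden (by rw [hden1, h0, mul_zero])
  have hact : act g.1 ((z : Z d) + ζ) - act g.1 z = (1 + a)⁻¹ • actDeriv g.1 z ζ := by
    have := act_add_smul g.1 z ζ 1 hz (by rwa [one_smul])
    rw [one_smul, one_mul] at this
    rw [this, add_sub_cancel_left, hden1]
    congr 1
    field_simp
  have key := sum_icoeff_tc_moebius (x := ν + 2 * l) (a := a) (by positivity) (n - l)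
    (Φ := fun t => detPow ν g z * line F (actBall g z) (actDeriv g.1 z ζ) t)
    (analyticAt_const.mul (line_analyticAt hF _ _)) (line_analyticAt hF' z ζ)
    (line_translate hF h z ζ)
  simp only [iop]
  rw [key, hact, Finset.mul_sum]
  refine Finset.sum_congr rfl fun k hk => ?_
  have hkn : l + k ≤ n := by have := Finset.mem_range.mp hk; omega
  rw [tc_const_mul, tc_line_smul hF, hden1, mul_div_cancel_left₀ _ hz, inv_pow]
  -- The factor `(1+a)^n` of the big action splits into the power produced by the one-variable
  -- identity and the power that compensates the scaling `(1+a)⁻¹` in a term of degree `l + k`.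
  have : (1 + a) ^ n = (1 + a) ^ (n - l - k) * (1 + a) ^ (l + k) := by
    rw [← pow_add]
    congr 1
    omega
  rw [this]
  field_simp

section Continuity

variable {L : Type*} [NormedAddCommGroup L] [InnerProductSpace ℂ L] [CompleteSpace L]
  [RKHS ℂ L (Pt d) ℂ]

/-- Each `F` is bounded on a small disc of the line, so Banach–Steinhaus bounds the evaluations
there uniformly; Cauchy's estimate then bounds the Taylor coefficient. Thus `iop` composed with an
evaluation is continuous and has a Riesz vector. -/
theorem exists_norm_tc_le {W : Submodule ℂ (Poly d)} (hL : ∀ F : L, IsHolomorphicMap W F) (z : D d) (ζ : Z d) (k : ℕ) :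
    ∃ C, ∀ F : L, ‖tc (line F z ζ) k‖ ≤ C * ‖F‖ := by
  obtain ⟨ε, hε, hball⟩ := Metric.eventually_nhds_iff_ball.mp (eventually_line_mem z.2 ζ)
  set r := ε / 2
  have hr : 0 < r := by positivity
  have hmem : ∀ t ∈ Metric.closedBall (0 : ℂ) r, (z : Z d) + t • ζ ∈ Metric.ball (0 : Z d) 1 :=
    fun t ht => hball t (Metric.closedBall_subset_ball (half_lt_self hε) ht)
  have hdiff : ∀ F : L, DifferentiableOn ℂ (line F z ζ) (Metric.closedBall 0 r) := by
    intro F t ht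
    obtain ⟨f, hf, hf'⟩ := (hL F).2 ζ
    have hd := (hasDerivAt_line (hf.differentiableAt
      (Metric.isOpen_ball.mem_nhds (hmem t ht)))).differentiableAt
    refine (hd.congr_of_eventuallyEq ?_).differentiableWithinAt
    have : ∀ᶠ s in 𝓝 t, s ∈ Metric.ball (0 : ℂ) ε :=
      Metric.isOpen_ball.mem_nhds (Metric.closedBall_subset_ball (half_lt_self hε) ht)
    filter_upwards [this] with s hs
    rw [line_of_mem _ _ _ (hball s hs), hf']
  obtain ⟨C, hC⟩ := banach_steinhaus (E := L) (F := ℂ)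
    (g := fun t : Metric.closedBall (0 : ℂ) r => innerSL ℂ (kv L (⟨_, hmem t t.2⟩, ζ)))
    (fun F => by
      obtain ⟨C, hC⟩ := (isCompact_closedBall (0 : ℂ) r).exists_bound_of_continuousOn
        (hdiff F).continuousOn
      refine ⟨C, fun t => ?_⟩
      rw [innerSL_apply_apply, inner_kv, ← line_of_mem F z ζ (hmem t t.2)]
      exact hC t t.2)
  refine ⟨C / r ^ k, fun F => ?_⟩
  have h1 := Complex.norm_iteratedDeriv_le_of_forall_mem_sphere_norm_le k hr
    ((hdiff F).diffContOnCl_ball le_rfl) (C := C * ‖F‖) (fun t ht => by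
      have ht' := Metric.sphere_subset_closedBall ht
      have := (innerSL ℂ (kv L (⟨_, hmem t ht'⟩, ζ))).le_of_opNorm_le (hC ⟨t, ht'⟩) F
      rwa [innerSL_apply_apply, inner_kv, ← line_of_mem F z ζ (hmem t ht')] at this)
  have hf : (0 : ℝ) < k.factorial := by exact_mod_cast k.factorial_pos
  rw [tc, norm_div, Complex.norm_natCast, div_le_iff₀ hf]
  calc _ ≤ _ := h1
    _ = _ := by ring

theorem exists_iop_vector (hL : ∀ F : L, IsHolomorphicMap V F) (N : ℕ) (x : ℝ) (p : Pt d) :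
    ∃ v : L, ∀ F : L, inner ℂ v F = iop N x F p := by
  choose C hC using fun k => exists_norm_tc_le hL p.1 p.2 k
  let φ : L →ₗ[ℂ] ℂ :=
    { toFun := fun F => iop N x F p
      map_add' := fun F G => by rw [RKHS.coe_add, iop_add (hL F) (hL G)]; rfl
      map_smul' := fun c F => by rw [RKHS.coe_smul, iop_smul]; rfl }
  let ψ : L →L[ℂ] ℂ := φ.mkContinuous (∑ k ∈ Finset.range (N + 1), ‖(icoeff N x k : ℂ)‖ * C k)
    fun F => by
      rw [Finset.sum_mul]
      refine norm_sum_le_of_le (Finset.range (N + 1))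
        (f := fun k => (icoeff N x k : ℂ) * tc (line F p.1 p.2) k) fun k _ => ?_
      rw [norm_mul, mul_assoc]
      exact mul_le_mul_of_nonneg_left (hC k F) (norm_nonneg _)
  exact ⟨(InnerProductSpace.toDual ℂ L).symm ψ, fun F => by
    rw [InnerProductSpace.toDual_symm_apply]
    rfl⟩

end Continuity

end BallKernel
end

/-! ### Positivity of the little kernel and domination of monomials -/

noncomputable section
namespace BallKernel
variable {d : ℕ}

section PSD

variable {X : Type*}

/-- Positive semidefinite scalar kernels. -/
def PSD (K : X → X → ℂ) : Prop := (Matrix.of K).PosSemidef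

theorem PSD.add {K M : X → X → ℂ} (hK : PSD K) (hM : PSD M) : PSD fun x y => K x y + M x y :=
  Matrix.PosSemidef.add hK hM

theorem PSD.mul {K M : X → X → ℂ} (hK : PSD K) (hM : PSD M) : PSD fun x y => K x y * M x y :=
  Matrix.PosSemidef.hadamard hK hM

theorem psd_rankOne (f : X → ℂ) : PSD fun x y => f x * star (f y) := by
  refine ⟨Matrix.IsHermitian.ext fun x y => by simp [mul_comm], fun a => ?_⟩
  have : (a.sum fun i xi => a.sum fun j xj =>
      star xi * (Matrix.of fun x y => f x * star (f y)) i j * xj) =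
      star (∑ i ∈ a.support, a i * star (f i)) * ∑ i ∈ a.support, a i * star (f i) := by
    simp only [Finsupp.sum, star_sum, Finset.sum_mul_sum, star_mul, star_star, Matrix.of_apply]
    refine Finset.sum_congr rfl fun x _ => Finset.sum_congr rfl fun y _ => by ring
  rw [this]
  exact star_mul_self_nonneg _

theorem PSD.const_mul {K : X → X → ℂ} (hK : PSD K) {c : ℝ} (hc : 0 ≤ c) :
    PSD fun x y => (c : ℂ) * K x y := by
  have h := (psd_rankOne fun _ : X => (Real.sqrt c : ℂ)).mul hK
  convert h using 5
  simp [← Complex.ofReal_mul, Real.mul_self_sqrt hc]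

theorem psd_zero : PSD fun _ _ : X => (0 : ℂ) := by
  simpa using psd_rankOne fun _ : X => (0 : ℂ)

theorem psd_one : PSD fun _ _ : X => (1 : ℂ) := by
  simpa using psd_rankOne fun _ : X => (1 : ℂ)

theorem psd_sum {ι : Type*} (s : Finset ι) {K : ι → X → X → ℂ} (hK : ∀ i ∈ s, PSD (K i)) :
    PSD fun x y => ∑ i ∈ s, K i x y := by
  classical
  induction s using Finset.induction_on with
  | empty => simpa using psd_zero
  | insert i s hi ih =>
    simp only [Finset.sum_insert hi]
    exact (hK i (Finset.mem_insert_self i s)).add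
      (ih fun j hj => hK j (Finset.mem_insert_of_mem hj))

theorem PSD.pow {K : X → X → ℂ} (hK : PSD K) (l : ℕ) : PSD fun x y => K x y ^ l := by
  induction l with
  | zero => simpa using psd_one
  | succ l ih =>
    simp only [pow_succ]
    exact ih.mul hK

theorem psd_of_tendsto {K : ℕ → X → X → ℂ} {M : X → X → ℂ} (hK : ∀ n, PSD (K n))
    (h : ∀ x y, Tendsto (fun n => K n x y) atTop (𝓝 (M x y))) : PSD M := by
  refine ⟨Matrix.IsHermitian.ext fun x y => ?_, fun a => ?_⟩
  · refine tendsto_nhds_unique ?_ (h x y)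
    have h1 := (h y x).star
    refine h1.congr fun n => ?_
    exact (hK n).1.apply x y
  · refine ge_of_tendsto' (x := atTop) (f := fun n => a.sum fun i xi => a.sum fun j xj =>
      star xi * (Matrix.of (K n)) i j * xj) ?_ fun n => (hK n).2 a
    simp only [Finsupp.sum]
    exact tendsto_finsetSum _ fun x _ => tendsto_finsetSum _ fun y _ =>
      ((h x y).const_mul _).mul_const _

theorem psd_of_hasSum {K : ℕ → X → X → ℂ} {M : X → X → ℂ} (hK : ∀ n, PSD (K n))
    (h : ∀ x y, HasSum (fun n => K n x y) (M x y)) : PSD M :=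
  psd_of_tendsto (fun n => psd_sum (Finset.range n) fun i _ => hK i)
    fun x y => (h x y).tendsto_sum_nat

/-- The kernel `K` dominates a positive multiple of the rank one kernel of `f`. -/
def Dom (K : X → X → ℂ) (f : X → ℂ) : Prop :=
  ∃ c : ℝ, 0 < c ∧ PSD fun x y => K x y - c * (f x * star (f y))

theorem dom_rankOne (f : X → ℂ) : Dom (fun x y => f x * star (f y)) f :=
  ⟨1, one_pos, by simpa using psd_zero⟩

theorem Dom.add_psd {K M : X → X → ℂ} {f : X → ℂ} (h : Dom K f) (hM : PSD M) :
    Dom (fun x y => K x y + M x y) f := by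
  obtain ⟨c, hc, h⟩ := h
  refine ⟨c, hc, ?_⟩
  convert h.add hM using 3
  ring

theorem Dom.const_mul {K : X → X → ℂ} {f : X → ℂ} (h : Dom K f) {c : ℝ} (hc : 0 < c) :
    Dom (fun x y => (c : ℂ) * K x y) f := by
  obtain ⟨b, hb, h⟩ := h
  refine ⟨c * b, by positivity, ?_⟩
  convert h.const_mul hc.le using 3
  push_cast
  ring

/-- With `P = b f f*` and `Q = c g g*` one has `KM - PQ = (K - P) M + P (M - Q)`, a sum of Schur
products of positive kernels. -/
theorem Dom.mul {K M : X → X → ℂ} {f g : X → ℂ} (hK : Dom K f) (hM : Dom M g) (hM' : PSD M) :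
    Dom (fun x y => K x y * M x y) (fun x => f x * g x) := by
  obtain ⟨b, hb, h⟩ := hK
  obtain ⟨c, hc, h'⟩ := hM
  refine ⟨b * c, by positivity, ?_⟩
  convert (h.mul hM').add (((psd_rankOne f).const_mul hb.le).mul h') using 3
  push_cast
  simp only [star_mul]
  ring

theorem Dom.prod {K : X → X → ℂ} (hK : PSD K) {k : ℕ} {f : Fin k → X → ℂ}
    (h : ∀ j, Dom K (f j)) : Dom (fun x y => K x y ^ k) (fun x => ∏ j, f j x) := by
  induction k with
  | zero => simpa using dom_rankOne fun _ : X => (1 : ℂ)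
  | succ k ih =>
    have := (ih fun j => h j.castSucc).mul (h (Fin.last k)) hK
    simpa only [pow_succ, Fin.prod_univ_castSucc] using this

/-- The sum of a series of kernels dominates what a term dominates. -/
theorem dom_of_hasSum {K : ℕ → X → X → ℂ} {M : X → X → ℂ} (hK : ∀ n, PSD (K n))
    (h : ∀ x y, HasSum (fun n => K n x y) (M x y)) {n : ℕ} {f : X → ℂ} (hf : Dom (K n) f) :
    Dom M f := by
  have h2 : PSD fun x y => M x y - K n x y := by
    refine psd_of_hasSum (K := fun m x y => if m = n then 0 else K m x y) (fun m => ?_)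
      fun x y => ?_
    · by_cases hm : m = n
      · simpa [hm] using psd_zero
      · simpa [hm] using hK m
    · have h3 := (h x y).sub (hasSum_ite_eq n (K n x y))
      refine h3.congr_fun fun m => ?_
      by_cases hm : m = n
      · simp [hm]
      · simp [hm]
  convert hf.add_psd h2 using 3
  ring

end PSD

/-- The kernel `1 - (z|w)`. -/
def hK (x y : Pt d) : ℂ := 1 - inner ℂ (y.1 : Z d) (x.1 : Z d)

/-- The kernel `(B(z,w)⁻¹ζ|ω)` of the inverse Bergman operator. -/
def bK (x y : Pt d) : ℂ := inner ℂ y.2 x.2 / hK x y +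
  inner ℂ (y.1 : Z d) x.2 * inner ℂ y.2 (x.1 : Z d) / hK x y ^ 2

/-- The kernel of the little space. -/
def lK (ν : ℝ) (l : ℕ) (x y : Pt d) : ℂ :=
  hK x y ^ (-(ν : ℂ)) * (bK x y ^ l / (l.factorial : ℂ))

theorem norm_inner_lt (z w : D d) : ‖(inner ℂ (w : Z d) (z : Z d) : ℂ)‖ < 1 := by
  have hz := mem_ball_zero_iff.mp z.2
  have hw := mem_ball_zero_iff.mp w.2
  refine (norm_inner_le_norm _ _).trans_lt ?_
  nlinarith [norm_nonneg (z : Z d), norm_nonneg (w : Z d)]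

theorem re_hK_pos (x y : Pt d) : 0 < (hK x y).re := by
  have h1 := norm_inner_lt x.1 y.1
  have h2 := Complex.re_le_norm (inner ℂ (y.1 : Z d) (x.1 : Z d) : ℂ)
  simp only [hK, Complex.sub_re, Complex.one_re]
  linarith

theorem hK_ne_zero (x y : Pt d) : hK x y ≠ 0 := fun h => by
  have := re_hK_pos x y
  simp [h] at this

theorem psd_inner_fst : PSD fun x y : Pt d => (inner ℂ (y.1 : Z d) (x.1 : Z d) : ℂ) := by
  have := psd_sum Finset.univ fun (i : Fin d) _ => psd_rankOne fun x : Pt d => (x.1 : Z d) i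
  simpa [PiLp.inner_apply] using this

theorem dom_inner {E : Pt d → Z d} (i : Fin d) :
    Dom (fun x y : Pt d => (inner ℂ (E y) (E x) : ℂ)) (fun x => E x i) := by
  have := (dom_rankOne fun x : Pt d => E x i).add_psd
    (psd_sum (Finset.univ.erase i) fun (j : Fin d) _ => psd_rankOne fun x : Pt d => E x j)
  convert this using 3
  rw [Finset.add_sum_erase _ (fun j => E _ j * star (E _ j)) (Finset.mem_univ i)]
  simp [PiLp.inner_apply]

theorem sum_prod_mul_star (z w : Z d) (k : ℕ) :
    ∑ i : Fin k → Fin d, (∏ j, z (i j)) * star (∏ j, w (i j)) = (inner ℂ w z : ℂ) ^ k := by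
  rw [PiLp.inner_apply, Fintype.sum_pow]
  refine Finset.sum_congr rfl fun i _ => ?_
  rw [star_prod, ← Finset.prod_mul_distrib]
  simp

/-- The derivative of `z ↦ z_{i₁} ⋯ z_{iₖ}` at `z` in the direction `ζ`. -/
def monoDeriv {k : ℕ} (i : Fin k → Fin d) (x : Z d × Z d) : ℂ :=
  deriv (fun t : ℂ => ∏ j, (x.1 + t • x.2) (i j)) 0

theorem hasDerivAt_mono {k : ℕ} (i : Fin k → Fin d) (x : Z d × Z d) :
    HasDerivAt (fun t : ℂ => ∏ j, (x.1 + t • x.2) (i j)) (monoDeriv i x) 0 := by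
  have : Differentiable ℂ fun t : ℂ => ∏ j, (x.1 + t • x.2) (i j) := by
    simp only [PiLp.add_apply, PiLp.smul_apply, smul_eq_mul]
    fun_prop
  exact (this 0).hasDerivAt

theorem sum_monoDeriv_mul_star (z ζ w : Z d) (k : ℕ) :
    ∑ i : Fin (k + 1) → Fin d, monoDeriv i (z, ζ) * star (∏ j, w (i j)) =
      (k + 1) * (inner ℂ w z : ℂ) ^ k * inner ℂ w ζ := by
  have h1 : HasDerivAt (fun t : ℂ => ∑ i : Fin (k + 1) → Fin d,
      (∏ j, (z + t • ζ) (i j)) * star (∏ j, w (i j)))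
      (∑ i : Fin (k + 1) → Fin d, monoDeriv i (z, ζ) * star (∏ j, w (i j))) 0 :=
    HasDerivAt.fun_sum fun i _ => (hasDerivAt_mono i (z, ζ)).mul_const _
  simp only [sum_prod_mul_star, inner_add_right, inner_smul_right] at h1
  have h2 : HasDerivAt (fun t : ℂ => (inner ℂ w z + t * inner ℂ w ζ : ℂ) ^ (k + 1))
      ((k + 1) * (inner ℂ w z : ℂ) ^ k * inner ℂ w ζ) 0 := by
    have := (((hasDerivAt_id (0 : ℂ)).mul_const (inner ℂ w ζ : ℂ)).const_add
      (inner ℂ w z : ℂ)).fun_pow (k + 1)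
    simpa using this
  exact h1.unique h2

/-- Differentiate the expansion of `(z|w)^(k+1)` in monomials along `ζ` in `z` and, after
conjugation, along `ω` in `w`. The left side is a Gram kernel. For `k = 0` the truncated exponent `k
- 1` is harmless, since its coefficient is zero. -/
theorem sum_monoDeriv (z ζ w ω : Z d) (k : ℕ) :
    ∑ i : Fin (k + 1) → Fin d, monoDeriv i (z, ζ) * star (monoDeriv i (w, ω)) =
      (k + 1) * ((inner ℂ w z : ℂ) ^ k * inner ℂ ω ζ +
        k * (inner ℂ w z : ℂ) ^ (k - 1) * (inner ℂ w ζ * inner ℂ ω z)) := by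
  have h1 : HasDerivAt (fun t : ℂ => ∑ i : Fin (k + 1) → Fin d,
      star (monoDeriv i (z, ζ)) * (∏ j, (w + t • ω) (i j)))
      (∑ i : Fin (k + 1) → Fin d, star (monoDeriv i (z, ζ)) * monoDeriv i (w, ω)) 0 :=
    HasDerivAt.fun_sum fun i _ => (hasDerivAt_mono i (w, ω)).const_mul _
  have e : (fun t : ℂ => ∑ i : Fin (k + 1) → Fin d,
      star (monoDeriv i (z, ζ)) * (∏ j, (w + t • ω) (i j))) = fun t : ℂ =>
      (k + 1) * (inner ℂ z w + t * inner ℂ z ω : ℂ) ^ k * (inner ℂ ζ w + t * inner ℂ ζ ω) := by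
    ext t
    have := congrArg star (sum_monoDeriv_mul_star z ζ (w + t • ω) k)
    simp only [star_sum, star_mul, star_star] at this
    rw [show (∑ i : Fin (k + 1) → Fin d, star (monoDeriv i (z, ζ)) * (∏ j, (w + t • ω) (i j))) =
      ∑ i : Fin (k + 1) → Fin d, (∏ j, (w + t • ω) (i j)) * star (monoDeriv i (z, ζ)) from
      Finset.sum_congr rfl fun i _ => mul_comm _ _, this]
    simp only [← starRingEnd_apply, map_pow, inner_conj_symm, inner_add_right, inner_smul_right,
      map_add, map_one, map_natCast]
    ring
  rw [e] at h1
  have h2 : HasDerivAt (fun t : ℂ =>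
      (k + 1) * (inner ℂ z w + t * inner ℂ z ω : ℂ) ^ k * (inner ℂ ζ w + t * inner ℂ ζ ω))
      ((k + 1) * ((inner ℂ z w : ℂ) ^ k * inner ℂ ζ ω +
        k * (inner ℂ z w : ℂ) ^ (k - 1) * (inner ℂ ζ w * inner ℂ z ω))) 0 := by
    have h3 := ((((hasDerivAt_id (0 : ℂ)).mul_const (inner ℂ z ω : ℂ)).const_add
      (inner ℂ z w : ℂ)).fun_pow k).const_mul ((k : ℂ) + 1)
    have h4 := ((hasDerivAt_id (0 : ℂ)).mul_const (inner ℂ ζ ω : ℂ)).const_add (inner ℂ ζ w : ℂ)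
    refine (h3.mul h4).congr_deriv ?_
    simp
    ring
  have h5 := congrArg star (h1.unique h2)
  simp only [← starRingEnd_apply, map_sum, map_mul, map_pow, Complex.conj_conj,
    inner_conj_symm, map_add, map_one, map_natCast] at h5
  simp only [← starRingEnd_apply]
  rw [h5]

/-- The terms of the expansion of `bK` in powers of `(z|w)`. -/
def bTerm (k : ℕ) (x y : Pt d) : ℂ :=
  (inner ℂ (y.1 : Z d) (x.1 : Z d) : ℂ) ^ k * inner ℂ y.2 x.2 +
    k * (inner ℂ (y.1 : Z d) (x.1 : Z d) : ℂ) ^ (k - 1) *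
      (inner ℂ (y.1 : Z d) x.2 * inner ℂ y.2 (x.1 : Z d))

/-- `bTerm k` is the mixed derivative of `(z|w)^(k+1) / (k+1)`, a term of the series of `-log(1 -
(z|w))`. -/
theorem psd_bTerm (k : ℕ) : PSD (bTerm k : Pt d → Pt d → ℂ) := by
  have h := (psd_sum Finset.univ fun (i : Fin (k + 1) → Fin d) _ =>
    psd_rankOne fun x : Pt d => monoDeriv i ((x.1 : Z d), x.2)).const_mul
      (c := ((k : ℝ) + 1)⁻¹) (by positivity)
  convert h using 3 with x y
  rw [sum_monoDeriv, bTerm]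
  have : (k : ℂ) + 1 ≠ 0 := by exact_mod_cast k.succ_ne_zero
  push_cast
  field_simp

theorem hasSum_bTerm (x y : Pt d) : HasSum (fun k => bTerm k x y) (bK x y) := by
  have hs := norm_inner_lt x.1 y.1
  rw [bK, hK]
  set s : ℂ := inner ℂ (y.1 : Z d) (x.1 : Z d)
  have h1 := (hasSum_geometric_of_norm_lt_one hs).mul_right (inner ℂ y.2 x.2 : ℂ)
  have h2 : HasSum (fun k : ℕ => (k : ℂ) * s ^ (k - 1)) (1 / (1 - s) ^ 2) := by
    rw [← hasSum_nat_add_iff' 1]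
    simpa using hasSum_choose_mul_geometric_of_norm_lt_one 1 hs
  have h3 := h1.add (h2.mul_right (inner ℂ (y.1 : Z d) x.2 * inner ℂ y.2 (x.1 : Z d) : ℂ))
  rw [show (inner ℂ y.2 x.2 : ℂ) / (1 - s) + inner ℂ (y.1 : Z d) x.2 * inner ℂ y.2 (x.1 : Z d) /
    (1 - s) ^ 2 = (1 - s)⁻¹ * inner ℂ y.2 x.2 + 1 / (1 - s) ^ 2 *
      (inner ℂ (y.1 : Z d) x.2 * inner ℂ y.2 (x.1 : Z d)) by ring]
  exact h3

theorem psd_bK : PSD (bK : Pt d → Pt d → ℂ) := psd_of_hasSum psd_bTerm hasSum_bTerm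

theorem dom_bK (i : Fin d) : Dom (bK : Pt d → Pt d → ℂ) (fun x => x.2 i) := by
  refine dom_of_hasSum psd_bTerm hasSum_bTerm (n := 0) ?_
  convert dom_inner (E := fun x : Pt d => x.2) i using 3
  simp [bTerm]

theorem hasSum_hK_cpow (ν : ℝ) (x y : Pt d) :
    HasSum (fun k => ((poch ν k / k.factorial : ℝ) : ℂ) *
      (inner ℂ (y.1 : Z d) (x.1 : Z d) : ℂ) ^ k) (hK x y ^ (-(ν : ℂ))) := by
  have hs := norm_inner_lt x.1 y.1
  rw [hK]
  set s : ℂ := inner ℂ (y.1 : Z d) (x.1 : Z d)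
  have h := (Complex.one_add_cpow_hasFPowerSeriesOnBall_zero (a := -(ν : ℂ))).hasSum (y := -s)
    (by rw [← ENNReal.ofReal_one, Metric.eball_ofReal]; simpa using hs)
  rw [zero_add, ← sub_eq_add_neg] at h
  refine h.congr_fun fun k => ?_
  simp only [binomialSeries_apply, List.ofFn_const, List.prod_replicate, smul_eq_mul, choose_neg]
  rw [neg_pow s]
  have : ((-1 : ℂ) ^ k) * (-1) ^ k = 1 := by
    rw [← mul_pow]
    simp
  linear_combination (-((poch ν k / k.factorial : ℝ) : ℂ) * s ^ k) * this

theorem psd_hK_term {ν : ℝ} (hν : 0 < ν) (k : ℕ) :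
    PSD fun x y : Pt d => ((poch ν k / k.factorial : ℝ) : ℂ) *
      (inner ℂ (y.1 : Z d) (x.1 : Z d) : ℂ) ^ k :=
  (psd_inner_fst.pow k).const_mul (div_nonneg (poch_pos hν k).le (Nat.cast_nonneg _))

/-- The binomial series has coefficients `(ν)_k / k!`, which are positive for `ν > 0`. -/
theorem psd_hK_cpow {ν : ℝ} (hν : 0 < ν) : PSD fun x y : Pt d => hK x y ^ (-(ν : ℂ)) :=
  psd_of_hasSum (psd_hK_term hν) (hasSum_hK_cpow ν)

theorem psd_lK {ν : ℝ} (hν : 0 < ν) (l : ℕ) : PSD (lK ν l : Pt d → Pt d → ℂ) := by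
  have := (psd_hK_cpow (d := d) hν).mul
    ((psd_bK.pow l).const_mul (c := (l.factorial : ℝ)⁻¹) (by positivity))
  convert this using 3
  rw [lK]
  push_cast
  ring

/-- The little kernel dominates the monomials. -/
theorem dom_lK {ν : ℝ} (hν : 0 < ν) {k l : ℕ} (i : Fin k → Fin d) (j : Fin l → Fin d) :
    Dom (lK ν l : Pt d → Pt d → ℂ) (fun x => (∏ a, (x.1 : Z d) (i a)) * ∏ b, x.2 (j b)) := by
  have h1 : Dom (fun x y : Pt d => hK x y ^ (-(ν : ℂ))) (fun x => ∏ a, (x.1 : Z d) (i a)) :=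
    dom_of_hasSum (psd_hK_term hν) (hasSum_hK_cpow ν) (n := k)
      ((Dom.prod psd_inner_fst fun a => dom_inner (E := fun x : Pt d => (x.1 : Z d)) (i a)).const_mul
        (div_pos (poch_pos hν k) (by exact_mod_cast k.factorial_pos)))
  have h2 : Dom (fun x y : Pt d => (((l.factorial : ℝ)⁻¹ : ℝ) : ℂ) * bK x y ^ l)
      (fun x => ∏ b, x.2 (j b)) :=
    (Dom.prod psd_bK fun b => dom_bK (j b)).const_mul (by positivity)
  have := h1.mul h2 ((psd_bK.pow l).const_mul (by positivity))
  convert this using 3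
  rw [lK]
  push_cast
  ring

end BallKernel
end

/-! ### Covariance of the little kernel -/

noncomputable section
namespace BallKernel
variable {d : ℕ}

/-- The tangent vector `(ζ, 0)` in homogeneous coordinates. -/
def homL (ζ : Z d) : Fin d ⊕ Unit → ℂ := Sum.elim (fun i => ζ i) (fun _ => 0)

theorem homL_injective : Function.Injective (homL : Z d → _) := fun ζ η h => by
  ext i
  simpa [homL] using congrFun h (Sum.inl i)

/-- The image of a tangent vector acquires a multiple of the base point; modulo that multiple it is
the derivative scaled by `den g z`. -/
theorem mulVec_homL (g : Mat d) {z : Z d} (hz : den g z ≠ 0) (ζ : Z d) :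
    g.mulVec (homL ζ) = den g z • homL (actDeriv g z ζ) + denLin g ζ • hom (act g z) := by
  ext (i | i)
  · have : g.mulVec (homL ζ) (Sum.inl i) = numLin g ζ i := by
      simp [Matrix.mulVec, dotProduct, numLin, homL]
    rw [this]
    simp only [Pi.add_apply, Pi.smul_apply, smul_eq_mul, hom, homL, actDeriv, act, Sum.elim_inl]
    field_simp
    ring
  · simp [Matrix.mulVec, dotProduct, denLin, homL, hom]

theorem sig_form_homL_hom (ω z : Z d) :
    star (homL ω) ⬝ᵥ (sig d).mulVec (hom z) = inner ℂ ω z := by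
  simp [dotProduct, sig, Matrix.mulVec_diagonal, hom, homL, PiLp.inner_apply, mul_comm]

theorem sig_form_hom_homL (w ζ : Z d) :
    star (hom w) ⬝ᵥ (sig d).mulVec (homL ζ) = inner ℂ w ζ := by
  simp [dotProduct, sig, Matrix.mulVec_diagonal, hom, homL, PiLp.inner_apply, mul_comm]

theorem sig_form_homL (ω ζ : Z d) :
    star (homL ω) ⬝ᵥ (sig d).mulVec (homL ζ) = inner ℂ ω ζ := by
  simp [dotProduct, sig, Matrix.mulVec_diagonal, homL, PiLp.inner_apply, mul_comm]

/-- The action of the group on the tangent bundle of the ball. -/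
def tangentAct (g : SU d) (x : Pt d) : Pt d := (actBall g x.1, actDeriv g.1 x.1 x.2)

theorem den_actBall (g : SU d) (z : D d) :
    den g.1 (z : Z d) * den (inv g).1 (actBall g z : Z d) = 1 := den_inv_act g (den_ne_zero g z.2)

theorem actBall_inv_actBall (g : SU d) (z : D d) : actBall (inv g) (actBall g z) = z :=
  Subtype.ext (act_inv_act g (den_ne_zero g z.2))

theorem tangentAct_inv_tangentAct (g : SU d) (x : Pt d) :
    tangentAct (inv g) (tangentAct g x) = x := by
  refine Prod.ext (actBall_inv_actBall g x.1) (homL_injective ?_)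
  have hz := den_ne_zero g x.1.2
  have hw := den_ne_zero (inv g) (actBall g x.1).2
  have h1 := mulVec_homL g.1 hz x.2
  have h2 := congrArg (inv g).1.mulVec h1
  have e : (inv g).1 * g.1 = 1 := inv_mul_of_mem g.2
  have hN : den g.1 (x.1 : Z d) * den (inv g).1 (act g.1 (x.1 : Z d)) = 1 := den_actBall g x.1
  rw [Matrix.mulVec_mulVec, e, Matrix.one_mulVec, Matrix.mulVec_add, Matrix.mulVec_smul,
    Matrix.mulVec_smul, mulVec_homL (inv g).1 hw, mulVec_hom (inv g).1 (act g.1 (x.1 : Z d)) hw] at h2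
  have h3 := congrFun h2 (Sum.inr ())
  ext i
  have h4 := congrFun h2 i
  simp only [Pi.add_apply, Pi.smul_apply, smul_eq_mul, hom, homL, Sum.elim_inr, mul_zero,
    zero_add, mul_one, tangentAct, smul_add, actBall] at h3 h4 hN ⊢
  rw [h4]
  linear_combination (- Sum.elim (fun i => (actDeriv (inv g).1 (act g.1 (x.1 : Z d))
    (actDeriv g.1 (x.1 : Z d) x.2)) i) (fun _ => 0) i) * hN +
    (Sum.elim (fun i => (act (inv g).1 (act g.1 (x.1 : Z d))) i) (fun _ => 1) i) * h3

theorem tangentAct_surjective (g : SU d) : Function.Surjective (tangentAct g) := fun x =>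
  ⟨tangentAct (inv g) x, by simpa only [inv_inv] using tangentAct_inv_tangentAct (inv g) x⟩

theorem hK_tangentAct (g : SU d) (x y : Pt d) :
    hK x y = den g.1 (x.1 : Z d) * star (den g.1 (y.1 : Z d)) *
      hK (tangentAct g x) (tangentAct g y) :=
  (one_sub_inner_act g (den_ne_zero g x.1.2) (den_ne_zero g y.1.2)).symm

/-- The pairings of `(z,1)`, `(ζ,0)` with `(w,1)`, `(ω,0)` are preserved by `g`. Substituting the
images, the base point multiples cancel in the combination `bK`, and so do the denominators. -/
theorem bK_tangentAct (g : SU d) (x y : Pt d) : bK x y = bK (tangentAct g x) (tangentAct g y) := by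
  have hz := den_ne_zero g x.1.2
  have hw := den_ne_zero g y.1.2
  have hw' : star (den g.1 (y.1 : Z d)) ≠ 0 := star_ne_zero.mpr hw
  have h0 := hK_ne_zero (tangentAct g x) (tangentAct g y)
  have hh := hK_tangentAct g x y
  have hP := sig_form_mulVec g.2.1 (hom (y.1 : Z d)) (homL x.2)
  have hQ := sig_form_mulVec g.2.1 (homL y.2) (hom (x.1 : Z d))
  have hA := sig_form_mulVec g.2.1 (homL y.2) (homL x.2)
  rw [mulVec_hom _ _ hw, mulVec_homL _ hz, sig_form_hom_homL] at hP
  rw [mulVec_hom _ _ hz, mulVec_homL _ hw, sig_form_homL_hom] at hQ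
  rw [mulVec_homL _ hz x.2, mulVec_homL _ hw y.2, sig_form_homL] at hA
  simp only [star_smul, star_add, Matrix.mulVec_add, Matrix.mulVec_smul, smul_dotProduct,
    dotProduct_smul, add_dotProduct, dotProduct_add, sig_form_hom, sig_form_homL_hom,
    sig_form_hom_homL, sig_form_homL, smul_eq_mul] at hP hQ hA
  rw [bK, bK, ← hP, ← hQ, ← hA, hh]
  have h1 : (inner ℂ (act g.1 (y.1 : Z d)) (act g.1 (x.1 : Z d)) : ℂ) - 1 =
      - hK (tangentAct g x) (tangentAct g y) := by
    simp [hK, tangentAct, actBall]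
  rw [h1]
  generalize hK (tangentAct g x) (tangentAct g y) = h at h0
  simp only [tangentAct, actBall]
  field_simp
  ring

/-- The argument of the product and the sum of the three arguments differ by a multiple of `2π`. The
difference is below `π/2 + 3π/2 = 2π` in modulus, hence zero. -/
theorem mul_mul_cpow_of_re_pos {x y z : ℂ} (hx : 0 < x.re) (hy : 0 < y.re) (hz : 0 < z.re)
    (h : 0 < (x * y * z).re) (a : ℂ) : (x * y * z) ^ a = x ^ a * y ^ a * z ^ a := by
  have ne : ∀ {u : ℂ}, 0 < u.re → u ≠ 0 := fun hu h0 => by simp [h0] at hu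
  have arg : ∀ {u : ℂ}, 0 < u.re → |u.arg| < Real.pi / 2 := fun hu =>
    Complex.abs_arg_lt_pi_div_two_iff.mpr (Or.inl hu)
  have key : Complex.log (x * y * z) = Complex.log x + Complex.log y + Complex.log z := by
    have h1 : Complex.exp (Complex.log (x * y * z) -
        (Complex.log x + Complex.log y + Complex.log z)) = 1 := by
      rw [Complex.exp_sub, Complex.exp_add, Complex.exp_add, Complex.exp_log (ne h),
        Complex.exp_log (ne hx), Complex.exp_log (ne hy), Complex.exp_log (ne hz), div_self (ne h)]
    obtain ⟨k, hk⟩ := Complex.exp_eq_one_iff.mp h1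
    have h2 := congrArg Complex.im hk
    simp only [Complex.sub_im, Complex.add_im, Complex.log_im] at h2
    have h3 : ((k : ℂ) * (2 * Real.pi * Complex.I)).im = k * (2 * Real.pi) := by
      simp [Complex.mul_im]
    rw [h3] at h2
    have a1 := abs_lt.mp (arg hx)
    have a2 := abs_lt.mp (arg hy)
    have a3 := abs_lt.mp (arg hz)
    have a4 := abs_lt.mp (arg h)
    have hp := Real.pi_pos
    have k1 : (k : ℝ) < 1 := by
      by_contra! hc
      nlinarith
    have k2 : (-1 : ℝ) < k := by
      by_contra! hc
      nlinarith
    have k0 : k = 0 := by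
      have : k < 1 := by exact_mod_cast k1
      have : -1 < k := by exact_mod_cast k2
      omega
    rw [k0] at hk
    simpa [sub_eq_zero] using hk
  rw [Complex.cpow_def_of_ne_zero (ne h), Complex.cpow_def_of_ne_zero (ne hx),
    Complex.cpow_def_of_ne_zero (ne hy), Complex.cpow_def_of_ne_zero (ne hz), key, add_mul,
    add_mul, Complex.exp_add, Complex.exp_add]

theorem hK_cpow_tangentAct (ν : ℝ) (g : SU d) (x y : Pt d) :
    hK x y ^ (-(ν : ℂ)) = detPow ν g x.1 * star (detPow ν g y.1) *
      hK (tangentAct g x) (tangentAct g y) ^ (-(ν : ℂ)) := by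
  have hr : 0 < ‖den g.1 0‖ := norm_pos_iff.mpr (den_zero_ne g)
  set r := ‖den g.1 0‖ with hr_def
  have hu := re_den_div_pos g x.1.2
  have hv := re_den_div_pos g y.1.2
  have hN := den_zero_ne g
  have hv' : 0 < (star (den g.1 (y.1 : Z d) / den g.1 0)).re := by
    rwa [← starRingEnd_apply, Complex.conj_re]
  have hh := re_hK_pos (tangentAct g x) (tangentAct g y)
  have h0 := re_hK_pos x y
  -- Extracting the positive factor `|den g 0|²` leaves normalized denominators, so every factor and
  -- the product lie in the right half plane and the principal powers multiply.
  have e1 : hK x y = ((r * r : ℝ) : ℂ) * ((den g.1 (x.1 : Z d) / den g.1 0) *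
      star (den g.1 (y.1 : Z d) / den g.1 0) * hK (tangentAct g x) (tangentAct g y)) := by
    have hrr : ((r * r : ℝ) : ℂ) = den g.1 0 * star (den g.1 0) := by
      rw [hr_def, ← starRingEnd_apply, Complex.mul_conj, Complex.normSq_eq_norm_sq, sq]
    have hN' : star (den g.1 0) ≠ 0 := star_ne_zero.mpr hN
    rw [hK_tangentAct g x y, hrr, star_div₀]
    field_simp
  have h2 : 0 < (((r * r : ℝ) : ℂ)).re := by
    rw [Complex.ofReal_re]
    positivity
  have h3 : 0 < ((den g.1 (x.1 : Z d) / den g.1 0) *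
      star (den g.1 (y.1 : Z d) / den g.1 0) * hK (tangentAct g x) (tangentAct g y)).re := by
    rw [e1, Complex.re_ofReal_mul] at h0
    exact pos_of_mul_pos_right h0 (by positivity)
  rw [e1, mul_cpow_of_re_pos h2 h3, mul_mul_cpow_of_re_pos hu hv' hh h3]
  have h4 : (((r * r : ℝ) : ℂ)) ^ (-(ν : ℂ)) = ((r ^ (-ν) : ℝ) : ℂ) * ((r ^ (-ν) : ℝ) : ℂ) := by
    rw [← Complex.ofReal_neg, ← Complex.ofReal_cpow (by positivity), Real.mul_rpow hr.le hr.le,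
      Complex.ofReal_mul]
  have h5 : star (den g.1 (y.1 : Z d) / den g.1 0) ^ (-(ν : ℂ)) =
      star ((den g.1 (y.1 : Z d) / den g.1 0) ^ (-(ν : ℂ))) := by
    have hne : (star (den g.1 (y.1 : Z d) / den g.1 0)).arg ≠ Real.pi := by
      have h6 := abs_lt.mp (Complex.abs_arg_lt_pi_div_two_iff.mpr (Or.inl hv'))
      have := Real.pi_pos
      linarith
    have h6 := Complex.cpow_conj _ (-(ν : ℂ)) hne
    rw [map_neg, Complex.conj_ofReal] at h6
    rw [h6]
    simp only [starRingEnd_apply, star_star]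
  rw [h4, h5, detPow, detPow, star_mul, ← hr_def]
  have h7 : star ((r ^ (-ν) : ℝ) : ℂ) = ((r ^ (-ν) : ℝ) : ℂ) := Complex.conj_ofReal _
  rw [h7]
  ring

theorem lK_tangentAct (ν : ℝ) (l : ℕ) (g : SU d) (x y : Pt d) :
    lK ν l x y = detPow ν g x.1 * star (detPow ν g y.1) *
      lK ν l (tangentAct g x) (tangentAct g y) := by
  rw [lK, lK, hK_cpow_tangentAct ν g, bK_tangentAct g]
  ring

theorem isLittleTranslate_iff {ν : ℝ} {g : SU d} {F F' : Pt d → ℂ} :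
    IsLittleTranslate ν g F F' ↔ ∀ x, F' x = detPow ν g x.1 * F (tangentAct g x) := by
  constructor
  · intro h x
    have := h x.1 x.2
    rwa [fderiv_act g.1 (den_ne_zero g x.1.2)] at this
  · intro h z ζ
    rw [fderiv_act g.1 (den_ne_zero g z.2)]
    exact h (z, ζ)

end BallKernel
end

/-! ### Existence of the little spaces -/

noncomputable section
namespace BallKernel
variable {d : ℕ}

/-- The holomorphic maps from the ball to `V`. -/
def holMaps (V : Submodule ℂ (Poly d)) : Submodule ℂ (Pt d → ℂ) where
  carrier := {F | IsHolomorphicMap V F}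
  add_mem' := by
    rintro F G ⟨hF, hF'⟩ ⟨hG, hG'⟩
    refine ⟨fun z => ?_, fun ζ => ?_⟩
    · obtain ⟨p, hp, hp'⟩ := hF z
      obtain ⟨q, hq, hq'⟩ := hG z
      exact ⟨p + q, V.add_mem hp hq, fun ζ => by simp [hp', hq']⟩
    · obtain ⟨f, hf, hf'⟩ := hF' ζ
      obtain ⟨g, hg, hg'⟩ := hG' ζ
      exact ⟨f + g, hf.add hg, fun z => by simp [hf', hg']⟩
  zero_mem' := ⟨fun z => ⟨0, V.zero_mem, fun ζ => by simp⟩, fun ζ =>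
    ⟨fun _ => 0, differentiableOn_const 0, fun z => by simp⟩⟩
  smul_mem' := by
    rintro c F ⟨hF, hF'⟩
    refine ⟨fun z => ?_, fun ζ => ?_⟩
    · obtain ⟨p, hp, hp'⟩ := hF z
      exact ⟨c • p, V.smul_mem c hp, fun ζ => by simp [hp']⟩
    · obtain ⟨f, hf, hf'⟩ := hF' ζ
      exact ⟨c • f, hf.const_smul c, fun z => by simp [hf']⟩

variable (d) in
/-- Evaluation of polynomials, as a linear map. -/
def evalFun : Poly d →ₗ[ℂ] (Z d → ℂ) where
  toFun p ζ := MvPolynomial.eval ζ p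
  map_add' p q := by ext; simp
  map_smul' c p := by ext; simp

section RKHS

variable {H : Type*} [NormedAddCommGroup H] [InnerProductSpace ℂ H] [CompleteSpace H]

section General

variable {X : Type*} [RKHS ℂ H X ℂ]

variable (H X) in
/-- An element of the space as a function. -/
def coeLin : H →ₗ[ℂ] (X → ℂ) where
  toFun F := F
  map_add' F G := by ext x; exact congrFun (RKHS.coe_add (𝕜 := ℂ) F G) x
  map_smul' c F := by ext x; exact congrFun (RKHS.coe_smul (𝕜 := ℂ) F c) x

theorem tendsto_apply {f : ℕ → H} {F : H} (h : Tendsto f atTop (𝓝 F)) (x : X) :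
    Tendsto (fun n => f n x) atTop (𝓝 (F x)) := by
  simp only [← inner_kv]
  exact (continuous_const.inner continuous_id).continuousAt.tendsto.comp h

theorem norm_kv_sq (x : X) : ‖kv H x‖ ^ 2 = ‖RKHS.kernel H x x 1‖ := by
  rw [kernel_one, inner_self_eq_norm_sq_to_K]
  simp

end General

/-- A space whose kernel functions are holomorphic maps consists of holomorphic maps if its kernel
is locally bounded on the diagonal. -/
theorem isHolomorphicMap_of_kernel [RKHS ℂ H (Pt d) ℂ] {V : Submodule ℂ (Poly d)}
    [FiniteDimensional ℂ V] (hk : ∀ y, IsHolomorphicMap V fun x => ker H x y)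
    (hb : ∀ r < 1, ∀ ζ : Z d, ∃ C, ∀ z : D d, ‖(z : Z d)‖ ≤ r → ‖ker H (z, ζ) (z, ζ)‖ ≤ C)
    (F : H) : IsHolomorphicMap V F := by
  have hspan : ∀ f ∈ Submodule.span ℂ (Set.range (kv H : Pt d → H)),
      (f : Pt d → ℂ) ∈ holMaps V := by
    intro f hf
    have : Submodule.span ℂ (Set.range (kv H : Pt d → H)) ≤
        (holMaps V).comap (coeLin H (Pt d)) := by
      rw [Submodule.span_le]
      rintro _ ⟨y, rfl⟩
      change IsHolomorphicMap V (kv H y)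
      have h : (kv H y : Pt d → ℂ) = fun x => ker H x y := by
        ext x
        exact kv_apply x y
      rw [h]
      exact hk y
    exact this hf
  have hF : F ∈ closure (Submodule.span ℂ (Set.range (kv H : Pt d → H)) : Set H) := by
    rw [← Submodule.topologicalClosure_coe, span_kv]
    trivial
  obtain ⟨f, hf, hlim⟩ := mem_closure_iff_seq_limit.mp hF
  constructor
  · intro z
    -- Polynomial functions coming from a finite-dimensional `V` are closed under pointwise limits.
    have hW := (V.map (evalFun d)).closed_of_finiteDimensional
    have hmem : (fun ζ => F (z, ζ)) ∈ V.map (evalFun d) := by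
      refine hW.mem_of_tendsto (f := fun n ζ => f n (z, ζ)) (b := atTop)
        (tendsto_pi_nhds.mpr fun ζ => tendsto_apply hlim _) (Eventually.of_forall fun n => ?_)
      obtain ⟨q, hq, hq'⟩ := (hspan (f n) (hf n)).1 z
      exact ⟨q, hq, funext fun ζ => (hq' ζ).symm⟩
    obtain ⟨q, hq, hq'⟩ := hmem
    exact ⟨q, hq, fun ζ => (congrFun hq' ζ).symm⟩
  · intro ζ
    have hn := fun n => (hspan (f n) (hf n)).2 ζ
    choose g hg hg' using hn
    classical
    let G : Z d → ℂ := fun z =>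
      if h : z ∈ Metric.ball (0 : Z d) 1 then F (⟨z, h⟩, ζ) else 0
    refine ⟨G, fun x hx => ?_, fun z => ?_⟩
    · have hx' := mem_ball_zero_iff.mp hx
      set r := (1 - ‖x‖) / 4 with hr
      have hr0 : 0 < r := by rw [hr]; linarith
      have hball : ∀ y ∈ Metric.ball x (r + r), ‖y‖ ≤ (1 + ‖x‖) / 2 := by
        intro y hy
        rw [mem_ball_iff_norm] at hy
        have := norm_le_norm_add_norm_sub x y
        rw [hr, norm_sub_rev] at hy
        linarith
      have hsub : Metric.ball x (r + r) ⊆ Metric.ball 0 1 := fun y hy => by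
        rw [mem_ball_zero_iff]
        have := hball y hy
        linarith
      obtain ⟨C, hC⟩ := hb ((1 + ‖x‖) / 2) (by linarith) ζ
      refine (differentiableAt_of_tendstoUniformlyOn hr0 (F := g)
        (fun n => (hg n).mono hsub) ?_).differentiableWithinAt
      have hC0 : 0 ≤ C := (norm_nonneg _).trans (hC ⟨x, hx⟩ (hball x (by simpa using hr0)))
      rw [Metric.tendstoUniformlyOn_iff]
      intro ε hε
      -- By Cauchy–Schwarz, the bound `C` for the kernel on the diagonal turns norm convergence into
      -- uniform convergence near `x`.
      have h1 : Tendsto (fun n => Real.sqrt C * ‖F - f n‖) atTop (𝓝 0) := by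
        have := ((tendsto_const_nhds (x := F)).sub hlim).norm.const_mul (Real.sqrt C)
        simpa using this
      filter_upwards [h1.eventually (gt_mem_nhds hε)] with n hn y hy
      have hyb := hsub hy
      refine lt_of_le_of_lt ?_ hn
      simp only [G, dif_pos hyb]
      rw [← hg' n ⟨y, hyb⟩, dist_eq_norm, ← inner_kv, ← inner_kv, ← inner_sub_right]
      refine (norm_inner_le_norm _ _).trans (mul_le_mul_of_nonneg_right ?_ (norm_nonneg _))
      refine Real.le_sqrt_of_sq_le ?_
      rw [norm_kv_sq]
      exact hC _ (hball y hy)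
    · simp only [G, dif_pos z.2]

end RKHS

theorem lK_isHolomorphicMap (ν : ℝ) (l : ℕ) (y : Pt d) :
    IsHolomorphicMap (Hom d l) fun x => lK ν l x y := by
  constructor
  · intro z
    set h := hK (z, (0 : Z d)) y with hh
    let a : Fin d → ℂ := fun i => star (y.2 i) / h +
      star ((y.1 : Z d) i) * inner ℂ y.2 (z : Z d) / h ^ 2
    let q : Poly d := ∑ i, MvPolynomial.C (a i) * MvPolynomial.X i
    have hq : q.IsHomogeneous 1 := MvPolynomial.IsHomogeneous.sum _ _ _ fun i _ => by
      simpa using (MvPolynomial.isHomogeneous_C (Fin d) (a i)).mul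
        (MvPolynomial.isHomogeneous_X ℂ i)
    refine ⟨(h ^ (-(ν : ℂ)) / (l.factorial : ℂ)) • q ^ l, (Hom d l).smul_mem _ ?_, fun ζ => ?_⟩
    · rw [MvPolynomial.mem_homogeneousSubmodule]
      simpa using hq.pow l
    · have hb : bK (z, ζ) y = MvPolynomial.eval ζ q := by
        have hh' : hK (z, ζ) y = h := rfl
        simp only [bK, hh', q, a, map_sum, map_mul, MvPolynomial.eval_C, MvPolynomial.eval_X,
          PiLp.inner_apply, add_mul, Finset.sum_add_distrib, Finset.sum_div]
        congr 1
        · refine Finset.sum_congr rfl fun i _ => ?_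
          simp
          ring
        · rw [Finset.sum_mul, Finset.sum_div]
          refine Finset.sum_congr rfl fun i _ => ?_
          simp
          ring
      simp only [lK]
      rw [hb, MvPolynomial.smul_eval, map_pow]
      have hh' : hK (z, ζ) y = h := rfl
      rw [hh']
      ring
  · intro ζ
    refine ⟨fun z => (1 - inner ℂ (y.1 : Z d) z) ^ (-(ν : ℂ)) *
      ((inner ℂ y.2 ζ / (1 - inner ℂ (y.1 : Z d) z) +
        inner ℂ (y.1 : Z d) ζ * inner ℂ y.2 z / (1 - inner ℂ (y.1 : Z d) z) ^ 2) ^ l /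
          (l.factorial : ℂ)), ?_, fun z => rfl⟩
    have hd : ∀ w : Z d, Differentiable ℂ fun z : Z d => (inner ℂ w z : ℂ) := fun w =>
      (innerSL ℂ w).differentiable
    have hne : ∀ z ∈ Metric.ball (0 : Z d) 1, (1 - inner ℂ (y.1 : Z d) z : ℂ) ≠ 0 :=
      fun z hz => hK_ne_zero (⟨z, hz⟩, ζ) y
    have h1 : DifferentiableOn ℂ (fun z : Z d => (1 - inner ℂ (y.1 : Z d) z : ℂ))
        (Metric.ball 0 1) := ((hd _).const_sub 1).differentiableOn
    have h2 : DifferentiableOn ℂ (fun z : Z d => (inner ℂ y.2 ζ / (1 - inner ℂ (y.1 : Z d) z) +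
        inner ℂ (y.1 : Z d) ζ * inner ℂ y.2 z / (1 - inner ℂ (y.1 : Z d) z) ^ 2 : ℂ))
        (Metric.ball 0 1) :=
      DifferentiableOn.fun_add (by
        simp only [div_eq_mul_inv]
        exact (h1.fun_inv hne).const_mul _) (by
        simp only [div_eq_mul_inv]
        exact ((hd _).differentiableOn.const_mul _).mul
          ((h1.fun_pow 2).fun_inv fun z hz => pow_ne_zero _ (hne z hz)))
    simp only [div_eq_mul_inv _ (l.factorial : ℂ)]
    exact (h1.cpow_const fun z hz => Or.inl (re_hK_pos (⟨z, hz⟩, ζ) y)).mul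
      ((h2.fun_pow l).mul_const _)

theorem exists_norm_lK_le (ν : ℝ) (l : ℕ) {r : ℝ} (hr : r < 1) (ζ : Z d) :
    ∃ C, ∀ z : D d, ‖(z : Z d)‖ ≤ r → ‖lK ν l (z, ζ) (z, ζ)‖ ≤ C := by
  have hlt : ∀ z ∈ Metric.closedBall (0 : Z d) r, z ∈ Metric.ball (0 : Z d) 1 := fun z hz => by
    rw [mem_closedBall_zero_iff] at hz
    rw [mem_ball_zero_iff]
    linarith
  have hne : ∀ z ∈ Metric.closedBall (0 : Z d) r, (1 - inner ℂ z z : ℂ) ≠ 0 :=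
    fun z hz => hK_ne_zero (⟨z, hlt z hz⟩, ζ) (⟨z, hlt z hz⟩, ζ)
  have h1 : ContinuousOn (fun z : Z d => (1 - inner ℂ z z : ℂ)) (Metric.closedBall 0 r) :=
    (continuous_const.sub (continuous_id.inner continuous_id)).continuousOn
  have h2 : ContinuousOn (fun z : Z d => (1 - inner ℂ z z : ℂ) ^ (-(ν : ℂ)) *
      ((inner ℂ ζ ζ / (1 - inner ℂ z z) + inner ℂ z ζ * inner ℂ ζ z / (1 - inner ℂ z z) ^ 2) ^ l /
          (l.factorial : ℂ))) (Metric.closedBall 0 r) := by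
    refine (h1.cpow_const fun z hz =>
      Or.inl (re_hK_pos (⟨z, hlt z hz⟩, ζ) (⟨z, hlt z hz⟩, ζ))).mul
      ((ContinuousOn.fun_pow ?_ l).div_const _)
    exact (continuousOn_const.div h1 hne).add
      (((continuous_id.inner continuous_const).mul
        (continuous_const.inner continuous_id)).continuousOn.div (h1.fun_pow 2)
          fun z hz => pow_ne_zero _ (hne z hz))
  obtain ⟨C, hC⟩ := (isCompact_closedBall (0 : Z d) r).exists_bound_of_continuousOn h2
  exact ⟨C, fun z hz => hC z (mem_closedBall_zero_iff.mpr hz)⟩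

theorem lK_origin (ν : ℝ) (l : ℕ) (ζ ω : Z d) :
    lK ν l (origin d, ζ) (origin d, ω) = inner ℂ ω ζ ^ l / (l.factorial : ℂ) := by
  simp [lK, bK, hK, origin]

/-- Translates exponents into products over index tuples, the form in which domination of monomials
is proved. -/
theorem exists_list_monomial (m : Fin d →₀ ℕ) : ∃ s : List (Fin d), s.length = m.degree ∧
    ∀ z : Z d, ∏ i, z i ^ m i = (s.map z).prod := by
  induction m using Finsupp.induction_linear with
  | zero => exact ⟨[], by simp⟩
  | add a b ha hb =>
    obtain ⟨s, hs, hs'⟩ := ha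
    obtain ⟨t, ht, ht'⟩ := hb
    refine ⟨s ++ t, by simp [hs, ht], fun z => ?_⟩
    simp [pow_add, Finset.prod_mul_distrib, hs', ht']
  | single i k =>
    refine ⟨List.replicate k i, by simp, fun z => ?_⟩
    rw [Finset.prod_eq_single i (fun j _ hj => by simp [hj.symm]) (by simp)]
    simp

theorem exists_monomial (m : Fin d →₀ ℕ) : ∃ i : Fin m.degree → Fin d,
    ∀ z : Z d, ∏ i, z i ^ m i = ∏ j, z (i j) := by
  obtain ⟨s, hs, hs'⟩ := exists_list_monomial m
  rw [← hs]
  exact ⟨fun j => s[j], fun z => by rw [hs']; exact (Fin.prod_univ_fun_getElem s z).symm⟩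

/-- The little space exists. -/
theorem exists_littleSpace {ν : ℝ} (hν : 0 < ν) (l : ℕ) :
    ∃ (L : Type) (_ : NormedAddCommGroup L) (_ : InnerProductSpace ℂ L)
      (_ : CompleteSpace L) (_ : RKHS ℂ L (Pt d) ℂ), IsLittleSpace L ν l := by
  obtain ⟨L, _, _, _, _, hL⟩ := exists_rkhs (psd_lK (d := d) hν l)
  have hker : ∀ x y : Pt d, ker L x y = lK ν l x y := hL
  have hL' : ∀ x y : Pt d, RKHS.kernel L x y 1 = lK ν l x y := hL
  refine ⟨L, _, _, ‹_›, _, ⟨fun F => ?_, fun p q hq => ?_⟩, fun g F => ?_, fun ζ ω => ?_⟩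
  · refine isHolomorphicMap_of_kernel (fun y => ?_) (fun r hr ζ => ?_) F
    · simp only [hker]
      exact lK_isHolomorphicMap ν l y
    · simp only [hker]
      exact exists_norm_lK_le ν l hr ζ
  · suffices h : (fun x : Pt d => MvPolynomial.eval (x.1 : Z d) p * MvPolynomial.eval x.2 q) ∈
        LinearMap.range (coeLin L (Pt d)) by
      obtain ⟨F, hF⟩ := h
      exact ⟨F, fun z ζ => congrFun hF (z, ζ)⟩
    -- Membership is known for functions whose rank one kernel is dominated, that is for monomials
    -- in `(z, ζ)`; linearity gives the rest.
    have h1 : (fun x : Pt d => MvPolynomial.eval (x.1 : Z d) p * MvPolynomial.eval x.2 q) =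
        ∑ a ∈ p.support, ∑ b ∈ q.support, (p.coeff a * q.coeff b) •
          fun x : Pt d => (∏ i, (x.1 : Z d) i ^ a i) * ∏ i, x.2 i ^ b i := by
      ext x
      simp only [Finset.sum_apply, Pi.smul_apply, smul_eq_mul]
      rw [MvPolynomial.eval_eq', MvPolynomial.eval_eq', Finset.sum_mul_sum]
      refine Finset.sum_congr rfl fun a _ => Finset.sum_congr rfl fun b _ => ?_
      ring
    rw [h1]
    refine Submodule.sum_mem _ fun a _ => Submodule.sum_mem _ fun b hb =>
      Submodule.smul_mem _ _ ?_
    have hb' : b.degree = l := by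
      by_contra hne
      exact MvPolynomial.mem_support_iff.mp hb
        (((MvPolynomial.mem_homogeneousSubmodule _ _).mp hq).coeff_eq_zero hne)
    obtain ⟨i, hi⟩ := exists_monomial a
    obtain ⟨j, hj⟩ := exists_monomial b
    subst hb'
    obtain ⟨c, hc, hpsd⟩ := dom_lK (d := d) hν i j
    obtain ⟨f, hf⟩ := exists_mem_of_le_kernel (H := L) (X := Pt d)
      (F := fun x => (∏ k, (x.1 : Z d) (i k)) * ∏ k, x.2 (j k)) hc (by
        rw [PSD] at hpsd
        simpa only [hL'] using hpsd)
    refine ⟨f, funext fun x => ?_⟩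
    rw [hi, hj]
    exact hf x
  · obtain ⟨F', h1, h2⟩ := exists_translate_of_covariant (H := L)
      (J := fun x : Pt d => detPow ν g x.1) (φ := tangentAct g)
      (fun x => detPow_ne_zero ν g x.1) (tangentAct_surjective g)
      (fun x y => by rw [hL', hL', lK_tangentAct ν l g]) F
    exact ⟨F', isLittleTranslate_iff.mpr h1, h2⟩
  · rw [hker, lK_origin]

end BallKernel
end

/-! ### Covariant kernels are determined at the origin -/

noncomputable section
namespace BallKernel
variable {d : ℕ}

open Classical in
/-- Scaling of points of the ball, extended by a junk value. -/
def bsmul (c : ℂ) (z : D d) : D d :=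
  if h : c • (z : Z d) ∈ Metric.ball (0 : Z d) 1 then ⟨_, h⟩ else origin d

/-- Scaling of points of the tangent bundle. -/
def psmul (c : ℂ) (x : Pt d) : Pt d := (bsmul c x.1, c • x.2)

theorem smul_mem_ball {c : ℂ} {R : ℝ} (hc : ‖c‖ < R) {z : Z d} (hz : R * ‖z‖ ≤ 1) :
    c • z ∈ Metric.ball (0 : Z d) 1 := by
  rw [mem_ball_zero_iff, norm_smul]
  by_cases h : ‖z‖ = 0
  · simp [h]
  · have : 0 < ‖z‖ := lt_of_le_of_ne (norm_nonneg _) (Ne.symm h)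
    nlinarith

theorem coe_bsmul {c : ℂ} {z : D d} (h : c • (z : Z d) ∈ Metric.ball (0 : Z d) 1) :
    (bsmul c z : Z d) = c • (z : Z d) := by
  rw [bsmul, dif_pos h]

theorem coe_bsmul_of_le {c : ℂ} (hc : ‖c‖ ≤ 1) (z : D d) :
    (bsmul c z : Z d) = c • (z : Z d) := by
  have hz := mem_ball_zero_iff.mp z.2
  refine coe_bsmul ?_
  rw [mem_ball_zero_iff, norm_smul]
  nlinarith [norm_nonneg (z : Z d), norm_nonneg c]

theorem bsmul_bsmul {a b : ℂ} (ha : ‖a‖ ≤ 1) (hb : ‖b‖ ≤ 1) (z : D d) :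
    bsmul a (bsmul b z) = bsmul (a * b) z := by
  apply Subtype.ext
  rw [coe_bsmul_of_le ha, coe_bsmul_of_le hb, coe_bsmul_of_le, smul_smul]
  rw [norm_mul]
  nlinarith [norm_nonneg a, norm_nonneg b]

theorem psmul_psmul {a b : ℂ} (ha : ‖a‖ ≤ 1) (hb : ‖b‖ ≤ 1) (x : Pt d) :
    psmul a (psmul b x) = psmul (a * b) x := by
  simp only [psmul, bsmul_bsmul ha hb, smul_smul]

theorem psmul_one (x : Pt d) : psmul 1 x = x := by
  refine Prod.ext (Subtype.ext ?_) (by simp [psmul])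
  simp [psmul, coe_bsmul_of_le]

theorem PMaps_differentiableOn_smul {V : Submodule ℂ (Poly d)} {G : Z d → Z d → ℂ}
    (hG : G ∈ PMaps (holClass d) V) {z : Z d} {R : ℝ} (hR : R * ‖z‖ ≤ 1) (ζ : Z d) :
    DifferentiableOn ℂ (fun c : ℂ => G (c • z) (c • ζ)) (Metric.ball 0 R) := by
  refine PMaps_induction (P := fun G => DifferentiableOn ℂ (fun c : ℂ => G (c • z) (c • ζ))
    (Metric.ball 0 R)) (fun a ha q hq => ?_) ?_ (fun F G hF hG => ?_) (fun c F hF => ?_) hG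
  · refine DifferentiableOn.fun_mul ?_ ?_
    · have h1 : DifferentiableOn ℂ (fun c : ℂ => c • z) (Metric.ball 0 R) :=
        (differentiable_id.smul_const z).differentiableOn
      exact DifferentiableOn.comp (t := Metric.ball 0 1) ha h1
        fun c hc => smul_mem_ball (mem_ball_zero_iff.mp hc) hR
    · exact ((differentiable_eval q).comp (differentiable_id.smul_const ζ)).differentiableOn
  · exact differentiableOn_const 0
  · exact hF.fun_add hG
  · exact hF.const_smul c

section Hol

variable {V : Submodule ℂ (Poly d)} {F : Pt d → ℂ}

theorem IsHolomorphicMap.differentiableOn_psmul [FiniteDimensional ℂ V] (hF : IsHolomorphicMap V F) {x : Pt d} {R : ℝ}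
    (hR : R * ‖(x.1 : Z d)‖ ≤ 1) :
    DifferentiableOn ℂ (fun c : ℂ => F (psmul c x)) (Metric.ball 0 R) := by
  obtain ⟨G, hG, h⟩ := hF.exists_PMaps
  refine (PMaps_differentiableOn_smul hG hR x.2).congr fun c hc => ?_
  rw [psmul, h, coe_bsmul (smul_mem_ball (mem_ball_zero_iff.mp hc) hR)]

theorem IsHolomorphicMap.eq_zero_of_small (hF : IsHolomorphicMap V F) {z : D d} {r : ℝ}
    (hr : 0 < r) (h : ∀ ζ : Z d, ‖ζ‖ < r → F (z, ζ) = 0) (ζ : Z d) : F (z, ζ) = 0 := by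
  obtain ⟨q, -, hq⟩ := hF.1 z
  rw [hq, eval_eq_of_eqOn_ball (q := 0) hr (fun ζ hζ => by rw [← hq, h ζ hζ, map_zero]) ζ, map_zero]

/-- A holomorphic map vanishes at the origin if it vanishes on a ray. -/
theorem IsHolomorphicMap.eq_zero_of_ray (hF : IsHolomorphicMap V F) {w : D d} {ζ : Z d}
    (h : ∀ r : ℝ, 0 < r → r ≤ 1 → F (bsmul ((r : ℂ) ^ 2) w, ζ) = 0) : F (origin d, ζ) = 0 := by
  obtain ⟨f, hf, hf'⟩ := hF.2 ζ
  rw [hf']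
  have hc : ContinuousAt f 0 :=
    (hf.continuousOn.continuousAt (Metric.isOpen_ball.mem_nhds (by simp)))
  have h1 : Tendsto (fun r : ℝ => ((r : ℂ) ^ 2) • (w : Z d)) (𝓝[>] 0) (𝓝 0) := by
    have : Continuous fun r : ℝ => ((r : ℂ) ^ 2) • (w : Z d) := by fun_prop
    have h2 := this.tendsto 0
    simp only [Complex.ofReal_zero, ne_eq, OfNat.ofNat_ne_zero, not_false_eq_true, zero_pow,
      zero_smul] at h2
    exact h2.mono_left nhdsWithin_le_nhds
  refine tendsto_nhds_unique (hc.tendsto.comp h1) (tendsto_const_nhds.congr' ?_)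
  filter_upwards [Ioc_mem_nhdsGT (zero_lt_one' ℝ)] with r hr
  have hle : ‖(r : ℂ) ^ 2‖ ≤ 1 := by
    rw [norm_pow, Complex.norm_real, Real.norm_eq_abs, abs_of_pos hr.1]
    exact pow_le_one₀ hr.1.le hr.2
  have h3 := h r hr.1 hr.2
  rw [hf', coe_bsmul_of_le hle] at h3
  exact h3.symm

end Hol

/-- A multiplier action of `SU(d,1)` on functions on `S`. -/
structure IsMultiplier (S : Set (Pt d)) (J : SU d → Pt d → ℂ) (φ : SU d → Pt d → Pt d) : Prop where
  near : ∀ z : D d, ∃ r > 0, ∀ ζ : Z d, ‖ζ‖ < r → (z, ζ) ∈ S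
  smul_mem : ∀ c : ℂ, ‖c‖ ≤ 1 → ∀ x ∈ S, psmul c x ∈ S
  fst : ∀ g x, (φ g x).1 = actBall g x.1
  maps : ∀ g, ∀ x ∈ S, φ g x ∈ S
  inv : ∀ g, ∀ x ∈ S, φ (BallKernel.inv g) (φ g x) = x
  mul_inv : ∀ g, ∀ x ∈ S, J g x * J (BallKernel.inv g) (φ g x) = 1
  const : ∀ g : SU d, (∃ b, ∀ z, den g.1 z = b) → act g.1 0 = 0 → ∀ x ∈ S, ∀ y ∈ S, J g x * star (J g y) = 1
  linear : ∀ (g : SU d), (∃ b, ∀ z, den g.1 z = b) → act g.1 0 = 0 → ∀ x : Pt d,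
    (φ g x).2 = act g.1 x.2

/-- Covariance of a kernel under a multiplier action. -/
def Covariant (S : Set (Pt d)) (J : SU d → Pt d → ℂ) (φ : SU d → Pt d → Pt d)
    (E : Pt d → Pt d → ℂ) : Prop :=
  ∀ g, ∀ x ∈ S, ∀ y ∈ S, E x y = J g x * star (J g y) * E (φ g x) (φ g y)

section Uniqueness

variable {S : Set (Pt d)} {J : SU d → Pt d → ℂ} {φ : SU d → Pt d → Pt d}
  {V : Submodule ℂ (Poly d)} {E : Pt d → Pt d → ℂ}

theorem Covariant.circle (hJ : IsMultiplier S J φ) (hE : Covariant S J φ E) {c : ℂ} (hc : ‖c‖ = 1)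
    {x y : Pt d} (hx : x ∈ S) (hy : y ∈ S) : E (psmul c x) (psmul c y) = E x y := by
  obtain ⟨g, b, hb, hg⟩ := exists_SU_circle d hc
  have h : ∀ x, φ g x = psmul c x := fun x => by
    refine Prod.ext (Subtype.ext ?_) ?_
    · rw [hJ.fst, psmul, coe_bsmul_of_le hc.le]
      exact hg _
    · rw [hJ.linear g ⟨b, hb⟩ (by rw [hg, smul_zero]), hg]
      rfl
  rw [hE g x hx y hy, hJ.const g ⟨b, hb⟩ (by rw [hg, smul_zero]) x hx y hy, one_mul, h, h]

/-- For `‖c‖ = 1` this is circle invariance. Both sides are holomorphic in `c` on a disc of radius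
larger than one, the right side because conjugation occurs twice. -/
theorem Covariant.psmul_left [FiniteDimensional ℂ V] (hJ : IsMultiplier S J φ) (hE : Covariant S J φ E)
    (hol : ∀ y, IsHolomorphicMap V fun x => E x y) (herm : ∀ x y, E y x = star (E x y))
    {x y : Pt d} (hx : x ∈ S) (hy : y ∈ S) {c : ℂ} (hc : ‖c‖ ≤ 1) :
    E (psmul c x) y = E x (psmul (star c) y) := by
  set m := max ‖(x.1 : Z d)‖ ‖(y.1 : Z d)‖ with hm
  have hm1 : m < 1 := max_lt (mem_ball_zero_iff.mp x.1.2) (mem_ball_zero_iff.mp y.1.2)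
  have hm0 : 0 ≤ m := (norm_nonneg _).trans (le_max_left _ _)
  -- The radius `2/(1+m)` exceeds `1` and still keeps both scaled base points in the ball.
  have hR : 1 < 2 / (1 + m) := by rw [lt_div_iff₀ (by linarith)]; linarith
  have hle : ∀ t ≤ m, 2 / (1 + m) * t ≤ 1 := fun t ht => by
    rw [div_mul_eq_mul_div, div_le_one (by linarith)]
    linarith
  have h1 := (hol y).differentiableOn_psmul (hle _ (le_max_left _ _))
  have h2 := (hol x).differentiableOn_psmul (hle _ (le_max_right _ _))
  have h3 : DifferentiableOn ℂ (fun c : ℂ => E x (psmul (star c) y))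
      (Metric.ball 0 (2 / (1 + m))) := by
    intro c hc
    have hc' : star c ∈ Metric.ball (0 : ℂ) (2 / (1 + m)) := by simpa using hc
    have h4 := ((h2 (star c) hc').differentiableAt (Metric.isOpen_ball.mem_nhds hc')).conj_conj
    rw [starRingEnd_apply, star_star] at h4
    refine (h4.congr_of_eventuallyEq (Eventually.of_forall fun a => ?_)).differentiableWithinAt
    simp only [Function.comp_apply, starRingEnd_apply]
    exact herm _ _
  refine sub_eq_zero.mp (eq_zero_of_unit_circle hR (h1.fun_sub h3) (fun c hc => ?_)
    (hc.trans_lt hR))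
  have hc' : ‖star c‖ = 1 := by simpa using hc
  have hcc : star c * c = 1 := by
    have := Complex.conj_mul' c
    rw [hc] at this
    simpa using this
  rw [sub_eq_zero, ← hE.circle hJ hc' (hJ.smul_mem c hc.le x hx) hy, psmul_psmul hc'.le hc.le, hcc,
    psmul_one]

/-- A covariant Hermitian holomorphic kernel is determined by its values at the origin. -/
theorem Covariant.eq_zero [FiniteDimensional ℂ V] (hJ : IsMultiplier S J φ) (hE : Covariant S J φ E)
    (hol : ∀ y, IsHolomorphicMap V fun x => E x y) (herm : ∀ x y, E y x = star (E x y))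
    (h0 : ∀ ζ ω, E (origin d, ζ) (origin d, ω) = 0) (x y : Pt d) : E x y = 0 := by
  have orig : ∀ z : D d, ∃ g : SU d, ∀ x : Pt d, x.1 = z → φ g x = (origin d, (φ g x).2) := by
    intro z
    obtain ⟨g, hg⟩ := exists_SU_act_eq_zero z.2
    refine ⟨g, fun x hx => Prod.ext (Subtype.ext ?_) rfl⟩
    rw [hJ.fst, hx]
    exact hg
  -- A single group element moves the common base point to the origin.
  have diag : ∀ x ∈ S, ∀ y ∈ S, x.1 = y.1 → E x y = 0 := by
    intro x hx y hy hxy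
    obtain ⟨g, hg⟩ := orig y.1
    rw [hE g x hx y hy, hg x hxy, hg y rfl, h0, mul_zero]
  have left : ∀ ζ, ∀ y ∈ S, E (origin d, ζ) y = 0 := by
    intro ζ y hy
    -- Write the base point `r² w` as `r · (r w)` and move one factor `r` to the second argument:
    -- both base points become `r w`, where the kernel is already zero. Then let `r → 0`.
    refine (hol y).eq_zero_of_ray (w := y.1) fun r hr hr1 => ?_
    have hn : ‖(r : ℂ)‖ ≤ 1 := by rwa [Complex.norm_real, Real.norm_eq_abs, abs_of_pos hr]
    obtain ⟨ρ, hρ, hnear⟩ := hJ.near (bsmul r y.1)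
    refine (hol y).eq_zero_of_small (r := r * ρ) (by positivity) (fun η hη => ?_) ζ
    have hx : (bsmul (r : ℂ) y.1, (r : ℂ)⁻¹ • η) ∈ S := by
      refine hnear _ ?_
      rw [norm_smul, norm_inv, Complex.norm_real, Real.norm_eq_abs, abs_of_pos hr,
        inv_mul_lt_iff₀ hr]
      exact hη
    have e : ((bsmul ((r : ℂ) ^ 2) y.1, η) : Pt d) =
        psmul (r : ℂ) (bsmul (r : ℂ) y.1, (r : ℂ)⁻¹ • η) := by
      simp only [psmul, bsmul_bsmul hn hn, sq, smul_smul]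
      rw [mul_inv_cancel₀ (by exact_mod_cast hr.ne'), one_smul]
    rw [e, hE.psmul_left hJ hol herm hx hy hn]
    have hs : star (r : ℂ) = r := Complex.conj_ofReal r
    rw [hs]
    exact diag _ hx _ (hJ.smul_mem _ hn _ hy) rfl
  have onS : ∀ x ∈ S, ∀ y ∈ S, E x y = 0 := by
    intro x hx y hy
    obtain ⟨g, hg⟩ := orig x.1
    rw [hE g x hx y hy, hg x rfl, left _ _ (hJ.maps g y hy), mul_zero]
  -- Over each base point, `S` contains all small `ζ`, and a polynomial vanishing there is zero.
  have half : ∀ x, ∀ y ∈ S, E x y = 0 := by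
    intro x y hy
    obtain ⟨r, hr, hnear⟩ := hJ.near x.1
    exact (hol y).eq_zero_of_small hr (fun ζ hζ => onS _ (hnear ζ hζ) y hy) x.2
  obtain ⟨r, hr, hnear⟩ := hJ.near y.1
  have := (hol x).eq_zero_of_small hr (fun ζ hζ => by
    rw [herm x, half x _ (hnear ζ hζ), star_zero]) y.2
  rw [herm y x]
  exact this ▸ star_zero ℂ

end Uniqueness

section Spaces

variable {H : Type*} [NormedAddCommGroup H] [InnerProductSpace ℂ H] [CompleteSpace H]
  [RKHS ℂ H (Pt d) ℂ]

theorem ker_eq_inner (x y : Pt d) : ker H x y = inner ℂ (kv H x) (kv H y) := kernel_one x y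

theorem ker_symm (x y : Pt d) : ker H y x = star (ker H x y) := by
  rw [ker_eq_inner, ker_eq_inner, ← starRingEnd_apply, inner_conj_symm]

theorem ker_isHolomorphicMap {V : Submodule ℂ (Poly d)} (hH : IsSpaceOfMaps H V) (y : Pt d) :
    IsHolomorphicMap V fun x => ker H x y := by
  have : (fun x => ker H x y) = (kv H y : Pt d → ℂ) := by
    ext x
    exact (kv_apply x y).symm
  rw [this]
  exact hH.1 _

theorem exists_unitary_of_multiplier {S : Set (Pt d)} {J : SU d → Pt d → ℂ}
    {φ : SU d → Pt d → Pt d} (hJ : IsMultiplier S J φ) {V : Submodule ℂ (Poly d)}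
    (hH : IsSpaceOfMaps H V)
    (h : ∀ g, ∀ F : H, ∃ F' : H, (∀ x ∈ S, F' x = J g x * F (φ g x)) ∧ ‖F'‖ = ‖F‖) (g : SU d) :
    ∃ T : H ≃ₗᵢ[ℂ] H, ∀ F, ∀ x ∈ S, T F x = J g x * F (φ g x) := by
  refine exists_unitary_of_translates (fun F hF => ?_) (h g) fun G => ?_
  · ext x
    obtain ⟨r, hr, hnear⟩ := hJ.near x.1
    rw [RKHS.coe_zero]
    exact (hH.1 F).eq_zero_of_small hr (fun ζ hζ => hF _ (hnear ζ hζ)) x.2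
  · obtain ⟨F, hF, -⟩ := h (inv g) G
    refine ⟨F, fun x hx => ?_⟩
    rw [hF _ (hJ.maps g x hx), hJ.inv g x hx, ← mul_assoc, hJ.mul_inv g x hx, one_mul]

theorem covariant_ker {S : Set (Pt d)} {J : SU d → Pt d → ℂ} {φ : SU d → Pt d → Pt d}
    (hJ : IsMultiplier S J φ) {V : Submodule ℂ (Poly d)} (hH : IsSpaceOfMaps H V)
    (h : ∀ g, ∀ F : H, ∃ F' : H, (∀ x ∈ S, F' x = J g x * F (φ g x)) ∧ ‖F'‖ = ‖F‖) :
    Covariant S J φ (ker H) := by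
  intro g x hx y hy
  obtain ⟨T, hT⟩ := exists_unitary_of_multiplier hJ hH h g
  rw [ker_eq_inner, ker_eq_inner]
  exact gram_covariant (S := S) (J := J g) (φ := φ g) (ι := kv H) T
    (fun F x hx => by rw [inner_kv, inner_kv, hT F x hx]) hx hy

end Spaces

theorem norm_den_of_const {g : SU d} {b : ℂ} (hb : ∀ z, den g.1 z = b) (h0 : act g.1 0 = 0) :
    b * star b = 1 := by
  have hz := den_zero_ne g
  have := one_sub_inner_act g hz hz
  simpa [hb, h0] using this

theorem norm_den_zero_of_const {g : SU d} {b : ℂ} (hb : ∀ z, den g.1 z = b)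
    (h0 : act g.1 0 = 0) : ‖den g.1 0‖ = 1 := by
  have h := norm_den_of_const hb h0
  rw [← starRingEnd_apply, Complex.mul_conj'] at h
  have h' : ‖b‖ ^ 2 = 1 := by exact_mod_cast h
  rw [hb]
  nlinarith [norm_nonneg b]

theorem detPow_of_const (ν : ℝ) {g : SU d} {b : ℂ} (hb : ∀ z, den g.1 z = b)
    (h0 : act g.1 0 = 0) (z : D d) : detPow ν g z = 1 := by
  have hz := den_zero_ne g
  rw [detPow, norm_den_zero_of_const hb h0, hb, ← hb 0, div_self hz]
  simp

theorem isMultiplier_little (ν : ℝ) :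
    IsMultiplier Set.univ (fun g (x : Pt d) => detPow ν g x.1) tangentAct where
  near _ := ⟨1, one_pos, fun _ _ => trivial⟩
  smul_mem _ _ _ _ := trivial
  fst _ _ := rfl
  maps _ _ _ := trivial
  inv g x _ := tangentAct_inv_tangentAct g x
  mul_inv g x _ := detPow_mul_detPow_inv ν g x.1
  const := by
    rintro g ⟨b, hb⟩ h0 x - y -
    rw [detPow_of_const ν hb h0, detPow_of_const ν hb h0, star_one, mul_one]
  linear := by
    rintro g ⟨b, hb⟩ h0 x
    have hz := den_zero_ne g
    have hb0 : b ≠ 0 := by rwa [hb] at hz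
    ext i
    have hd : denLin g.1 x.2 = 0 := by
      have := den_eq g.1 x.2
      rwa [hb, hb, right_eq_add] at this
    have h1 : num g.1 0 i = 0 := by
      have := congrFun (congrArg (fun v : Z d => (v : Fin d → ℂ)) h0) i
      simpa [act, hz] using this
    have h2 := num_add_smul g.1 0 x.2 1 i
    rw [h1, zero_add, one_smul, zero_add, one_mul] at h2
    simp only [tangentAct, actDeriv, act, hd, hb, h2]
    field_simp
    ring

/-- The action of the group in the big picture. -/
def bigAct (g : SU d) (x : Pt d) : Pt d :=
  (actBall g x.1, act g.1 ((x.1 : Z d) + x.2) - act g.1 (x.1 : Z d))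

/-- The multiplier of the big action. -/
def bigMul (ν : ℝ) (n : ℕ) (g : SU d) (x : Pt d) : ℂ :=
  detPow ν g x.1 * (den g.1 ((x.1 : Z d) + x.2) / den g.1 (x.1 : Z d)) ^ n

variable (d) in
/-- The points `(z, ζ)` with `z + ζ` in the ball. -/
def bigSet : Set (Pt d) := {x | (x.1 : Z d) + x.2 ∈ Metric.ball (0 : Z d) 1}

/-- In the coordinates `(z, z + ζ)` this is the diagonal action of the group on two points of the
ball, which explains the choice of `bigSet`. -/
theorem isMultiplier_big (ν : ℝ) (n : ℕ) :
    IsMultiplier (bigSet d) (bigMul ν n) bigAct where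
  near z := by
    have hz := mem_ball_zero_iff.mp z.2
    refine ⟨1 - ‖(z : Z d)‖, by linarith, fun ζ hζ => ?_⟩
    refine mem_ball_zero_iff.mpr ((norm_add_le _ _).trans_lt ?_)
    linarith
  smul_mem c hc x hx := by
    have hx' := mem_ball_zero_iff.mp hx
    refine mem_ball_zero_iff.mpr ?_
    rw [psmul, coe_bsmul_of_le hc, ← smul_add, norm_smul]
    nlinarith [norm_nonneg c, norm_nonneg ((x.1 : Z d) + x.2)]
  fst _ _ := rfl
  maps g x hx := by
    have : (act g.1 (x.1 : Z d)) + (act g.1 ((x.1 : Z d) + x.2) - act g.1 (x.1 : Z d)) ∈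
        Metric.ball (0 : Z d) 1 := by
      rw [add_sub_cancel]
      exact act_mem_ball g.2 ⟨_, hx⟩
    exact this
  inv g x hx := by
    refine Prod.ext (actBall_inv_actBall g x.1) ?_
    simp only [bigAct, actBall, add_sub_cancel]
    rw [act_inv_act g (den_ne_zero g hx), act_inv_act g (den_ne_zero g x.1.2), add_sub_cancel_left]
  mul_inv g x hx := by
    have h1 := detPow_mul_detPow_inv ν g x.1
    have h2 := den_inv_act g (den_ne_zero g hx)
    have h3 := den_inv_act g (den_ne_zero g x.1.2)
    simp only [bigMul, bigAct]
    rw [mul_mul_mul_comm, h1, one_mul, ← mul_pow]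
    simp only [actBall, add_sub_cancel]
    rw [div_mul_div_comm, h2, h3, div_one, one_pow]
  const := by
    rintro g ⟨b, hb⟩ h0 x - y -
    have hz := den_zero_ne g
    have hb0 : b ≠ 0 := by rwa [hb] at hz
    simp [bigMul, detPow_of_const ν hb h0, hb, hb0]
  linear := by
    rintro g ⟨b, hb⟩ h0 x
    have hz := den_zero_ne g
    ext i
    have h1 : num g.1 0 i = 0 := by
      have := congrFun (congrArg (fun v : Z d => (v : Fin d → ℂ)) h0) i
      simpa [act, hz] using this
    have h2 := num_add_smul g.1 0 x.2 1 i
    have h3 := num_add_smul g.1 (x.1 : Z d) x.2 1 i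
    rw [h1, zero_add, one_smul, zero_add, one_mul] at h2
    rw [one_smul, one_mul] at h3
    simp only [bigAct, act, hb, h2, h3, PiLp.sub_apply]
    ring

section Spaces

variable {H : Type*} [NormedAddCommGroup H] [InnerProductSpace ℂ H] [CompleteSpace H]
  [RKHS ℂ H (Pt d) ℂ]

theorem IsLittleSpace.translate {ν : ℝ} {l : ℕ} (hH : IsLittleSpace H ν l) (g : SU d) (F : H) :
    ∃ F' : H, (∀ x ∈ Set.univ, F' x = detPow ν g x.1 * F (tangentAct g x)) ∧ ‖F'‖ = ‖F‖ := by
  obtain ⟨F', h1, h2⟩ := hH.unitary g F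
  exact ⟨F', fun x _ => isLittleTranslate_iff.mp h1 x, h2⟩

theorem IsBigSpace.translate {ν : ℝ} {n : ℕ} (hH : IsBigSpace H ν n) (g : SU d) (F : H) :
    ∃ F' : H, (∀ x ∈ bigSet d, F' x = bigMul ν n g x * F (bigAct g x)) ∧ ‖F'‖ = ‖F‖ := by
  obtain ⟨F', h1, h2⟩ := hH.unitary g F
  exact ⟨F', fun x hx => h1 x.1 x.2 (den_ne_zero g hx), h2⟩

theorem IsLittleSpace.covariant {ν : ℝ} {l : ℕ} (hH : IsLittleSpace H ν l) :
    Covariant Set.univ (fun g (x : Pt d) => detPow ν g x.1) tangentAct (ker H) :=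
  covariant_ker (isMultiplier_little ν) hH.maps hH.translate

theorem IsBigSpace.covariant {ν : ℝ} {n : ℕ} (hH : IsBigSpace H ν n) :
    Covariant (bigSet d) (bigMul ν n) bigAct (ker H) :=
  covariant_ker (isMultiplier_big ν n) hH.maps hH.translate

theorem Covariant.sub {S : Set (Pt d)} {J : SU d → Pt d → ℂ} {φ : SU d → Pt d → Pt d}
    {E E' : Pt d → Pt d → ℂ} (h : Covariant S J φ E) (h' : Covariant S J φ E') :
    Covariant S J φ fun x y => E x y - E' x y := fun g x hx y hy => by
  simp only [h g x hx y hy, h' g x hx y hy, mul_sub]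

/-- Two covariant Hermitian holomorphic kernels agree if they agree at the origin. -/
theorem Covariant.eq_of_origin {S : Set (Pt d)} {J : SU d → Pt d → ℂ} {φ : SU d → Pt d → Pt d}
    (hJ : IsMultiplier S J φ) {V : Submodule ℂ (Poly d)} [FiniteDimensional ℂ V]
    {E E' : Pt d → Pt d → ℂ} (h : Covariant S J φ E) (h' : Covariant S J φ E')
    (hol : ∀ y, IsHolomorphicMap V fun x => E x y) (hol' : ∀ y, IsHolomorphicMap V fun x => E' x y)
    (herm : ∀ x y, E y x = star (E x y)) (herm' : ∀ x y, E' y x = star (E' x y))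
    (h0 : ∀ ζ ω, E (origin d, ζ) (origin d, ω) = E' (origin d, ζ) (origin d, ω)) (x y : Pt d) :
    E x y = E' x y :=
  sub_eq_zero.mp ((h.sub h').eq_zero hJ (V := V) (fun y => show ((fun x => E x y) - fun x => E' x y) ∈ holMaps V from
      (holMaps V).sub_mem (hol y) (hol' y))
    (fun x y => by rw [herm, herm', star_sub]) (fun ζ ω => sub_eq_zero.mpr (h0 ζ ω)) x y)

/-- The kernel of the little space. -/
theorem IsLittleSpace.ker_eq {ν : ℝ} (hν : 0 < ν) {l : ℕ} (hH : IsLittleSpace H ν l) (x y : Pt d) :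
    ker H x y = lK ν l x y := by
  refine hH.covariant.eq_of_origin (isMultiplier_little ν) (V := Hom d l)
    (fun g x _ y _ => lK_tangentAct ν l g x y) (ker_isHolomorphicMap hH.maps)
    (lK_isHolomorphicMap ν l) ker_symm (fun x y => ?_) (fun ζ ω => ?_) x y
  · exact ((psd_lK hν l).1.apply y x).symm
  · rw [hH.normalized, lK_origin]

end Spaces

end BallKernel
end

/-! ### Evaluation vectors of the intertwiner, and its uniqueness -/

noncomputable section
namespace BallKernel
variable {d : ℕ}

theorem HasTaylor.tc_eq {f : ℂ → ℂ} {N : ℕ} {c : ℕ → ℂ} (h : HasTaylor f N c)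
    (hf : AnalyticAt ℂ f 0) {k : ℕ} (hk : k < N) : tc f k = c k :=
  (hasTaylor_tc hf N).unique h k hk

theorem tc_sum_pow (N : ℕ) (c : ℕ → ℂ) {k : ℕ} (hk : k < N) :
    tc (fun t => ∑ i ∈ Finset.range N, c i * t ^ i) k = c k := by
  have hd : Differentiable ℂ fun t : ℂ => ∑ i ∈ Finset.range N, c i * t ^ i := by fun_prop
  refine HasTaylor.tc_eq (N := N) ?_ (hd.analyticAt 0) hk
  simp only [HasTaylor, sub_self]
  exact isBigO_zero _ _

section Little

variable {L : Type*} [NormedAddCommGroup L] [InnerProductSpace ℂ L] [CompleteSpace L]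
  [RKHS ℂ L (Pt d) ℂ] {ν : ℝ} {l : ℕ}

/-- The vector representing the evaluation of the intertwining operator at a point. -/
def iopVec (hL : IsLittleSpace L ν l) (n : ℕ) (p : Pt d) : L :=
  Classical.choose (exists_iop_vector hL.maps.1 (n - l) (ν + 2 * l) p)

theorem inner_iopVec (hL : IsLittleSpace L ν l) (n : ℕ) (p : Pt d) (F : L) :
    inner ℂ (iopVec hL n p) F = iop (n - l) (ν + 2 * l) F p :=
  Classical.choose_spec (exists_iop_vector hL.maps.1 (n - l) (ν + 2 * l) p) F

theorem iopVec_isHolomorphicMap (hL : IsLittleSpace L ν l) {n : ℕ} (hl : l ≤ n) (y : Pt d) :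
    IsHolomorphicMap (MvPolynomial.restrictTotalDegree (Fin d) ℂ n)
      fun x => (inner ℂ (iopVec hL n x) (iopVec hL n y) : ℂ) := by
  simp only [inner_iopVec]
  exact iop_isHolomorphicMap hl (hL.maps.1 _) _

/-- The unitary operators on the little space. -/
theorem IsLittleSpace.exists_unitary (hL : IsLittleSpace L ν l) (g : SU d) :
    ∃ T : L ≃ₗᵢ[ℂ] L, ∀ F : L, IsLittleTranslate ν g F (T F) := by
  obtain ⟨T, hT⟩ := exists_unitary_of_multiplier (isMultiplier_little ν) hL.maps hL.translate g
  exact ⟨T, fun F => isLittleTranslate_iff.mpr fun x => hT F x trivial⟩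

/-- The intertwining property says how the unitary operators of the little space move the evaluation
vectors, and covariance of the Gram kernel follows. -/
theorem covariant_iopVec (hν : 0 < ν) (hL : IsLittleSpace L ν l) {n : ℕ} (hl : l ≤ n) :
    Covariant (bigSet d) (bigMul ν n) bigAct
      fun x y => (inner ℂ (iopVec hL n x) (iopVec hL n y) : ℂ) := by
  intro g x hx y hy
  obtain ⟨T, hT⟩ := hL.exists_unitary g
  refine gram_covariant (S := bigSet d) (J := bigMul ν n g) (φ := bigAct g) (ι := iopVec hL n) T
    (fun F x hx => ?_) hx hy
  rw [inner_iopVec, inner_iopVec]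
  exact iop_translate hν hl (hL.maps.1 F) (hL.maps.1 (T F)) (hT F) x.1 x.2 (den_ne_zero g hx)

/-- Along the line `t ↦ tω` through the origin, with direction `ω`, the two terms of `bK` combine
into a single power of exponent `-2`, so the whole kernel is one binomial power. -/
theorem lK_line (ν : ℝ) (l : ℕ) (ω : Z d) (y : Pt d) {t : ℂ}
    (ht : t • ω ∈ Metric.ball (0 : Z d) 1) :
    lK ν l (⟨t • ω, ht⟩, ω) y = (inner ℂ y.2 ω ^ l / (l.factorial : ℂ)) *
      (1 + -inner ℂ (y.1 : Z d) ω * t) ^ (-((ν + 2 * l : ℝ) : ℂ)) := by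
  have hh := hK_ne_zero (⟨t • ω, ht⟩, ω) y
  have e : hK (⟨t • ω, ht⟩, ω) y = 1 + -inner ℂ (y.1 : Z d) ω * t := by
    simp only [hK, inner_smul_right]
    ring
  have hb : bK (⟨t • ω, ht⟩, ω) y =
      inner ℂ y.2 ω * (1 + -inner ℂ (y.1 : Z d) ω * t) ^ (-(2 : ℂ)) := by
    rw [bK, e]
    rw [e] at hh
    rw [Complex.cpow_neg, Complex.cpow_ofNat]
    simp only [inner_smul_right]
    field_simp
    ring
  rw [lK, hb, e, mul_pow, ← Complex.cpow_nat_mul]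
  rw [e] at hh
  rw [show -((ν + 2 * l : ℝ) : ℂ) = -(ν : ℂ) + (l : ℂ) * -(2 : ℂ) by push_cast; ring,
    Complex.cpow_add _ _ hh]
  ring

theorem kv_eq_lK (hν : 0 < ν) (hL : IsLittleSpace L ν l) (x y : Pt d) : kv L y x = lK ν l x y := by
  rw [kv_apply]
  exact hL.ker_eq hν x y

theorem tc_line_kv (hν : 0 < ν) (hL : IsLittleSpace L ν l) (ω : Z d) (y : Pt d) (k : ℕ) :
    tc (line (kv L y) (origin d) ω) k = (inner ℂ y.2 ω ^ l / (l.factorial : ℂ)) *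
      ((inner ℂ (y.1 : Z d) ω) ^ k * ((poch (ν + 2 * l) k / k.factorial : ℝ) : ℂ)) := by
  have h1 : line (kv L y) (origin d) ω =ᶠ[𝓝 0] fun t =>
      (inner ℂ y.2 ω ^ l / (l.factorial : ℂ)) *
      (1 + -inner ℂ (y.1 : Z d) ω * t) ^ (-((ν + 2 * l : ℝ) : ℂ)) := by
    filter_upwards [eventually_line_mem (origin d).2 ω] with t ht
    rw [line_of_mem _ _ _ ht, kv_eq_lK hν hL]
    have ht' : t • ω ∈ Metric.ball (0 : Z d) 1 := by simpa [origin] using ht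
    rw [← lK_line ν l ω y ht']
    congr 3
    simp [origin]
  have h2 := (line_analyticAt (hL.maps.1 (kv L y)) (origin d) ω).congr h1
  rw [tc_congr h1]
  have h3 := (hasTaylor_one_add_cpow (ν + 2 * l) (-inner ℂ (y.1 : Z d) ω) (k + 1)).const_mul_left
    (inner ℂ y.2 ω ^ l / (l.factorial : ℂ))
  have h4 : HasTaylor (fun t => (inner ℂ y.2 ω ^ l / (l.factorial : ℂ)) *
      (1 + -inner ℂ (y.1 : Z d) ω * t) ^ (-((ν + 2 * l : ℝ) : ℂ))) (k + 1)
      (fun k => (inner ℂ y.2 ω ^ l / (l.factorial : ℂ)) *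
      ((inner ℂ (y.1 : Z d) ω) ^ k * ((poch (ν + 2 * l) k / k.factorial : ℝ) : ℂ))) := by
    refine h3.congr_left fun t => ?_
    rw [mul_sub, Finset.mul_sum]
    congr 1
    refine Finset.sum_congr rfl fun i _ => ?_
    rw [_root_.neg_neg]
    ring
  exact h4.tc_eq h2 k.lt_succ_self

/-- By the reproducing property this value is the conjugate of the operator applied to `kv L y` and
evaluated at the origin. -/
theorem iopVec_origin_apply (hν : 0 < ν) (hL : IsLittleSpace L ν l) (n : ℕ) (ω : Z d) (y : Pt d) :
    iopVec hL n (origin d, ω) y = ∑ k ∈ Finset.range (n - l + 1),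
      ((icoeff (n - l) (ν + 2 * l) k * (poch (ν + 2 * l) k / k.factorial) / l.factorial : ℝ) : ℂ) *
        ((inner ℂ ω (y.1 : Z d)) ^ k * inner ℂ ω y.2 ^ l) := by
  rw [← inner_kv, ← inner_conj_symm, inner_iopVec, iop, map_sum]
  refine Finset.sum_congr rfl fun k _ => ?_
  rw [tc_line_kv hν hL]
  simp only [map_mul, map_div₀, map_pow, inner_conj_symm, Complex.conj_ofReal, map_natCast]
  push_cast
  ring

/-- The operator acts a second time, now on a polynomial in `t`, so `A_k` occurs squared while
`(ν+2l)_k / k!` from the kernel occurs once. -/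
theorem inner_iopVec_origin (hν : 0 < ν) (hL : IsLittleSpace L ν l) (n : ℕ) (ζ ω : Z d) :
    inner ℂ (iopVec hL n (origin d, ζ)) (iopVec hL n (origin d, ω)) =
      ∑ k ∈ Finset.range (n - l + 1), ((icoeff (n - l) (ν + 2 * l) k ^ 2 *
        (poch (ν + 2 * l) k / k.factorial) / l.factorial : ℝ) : ℂ) *
          (inner ℂ ω ζ : ℂ) ^ (l + k) := by
  rw [inner_iopVec, iop]
  refine Finset.sum_congr rfl fun k hk => ?_
  set c : ℕ → ℂ := fun k =>
    ((icoeff (n - l) (ν + 2 * l) k * (poch (ν + 2 * l) k / k.factorial) / l.factorial : ℝ) : ℂ) *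
      (inner ℂ ω ζ : ℂ) ^ (l + k) with hc
  have h1 : line (⇑(iopVec hL n (origin d, ω))) (origin d) ζ =ᶠ[𝓝 0]
      fun t => ∑ i ∈ Finset.range (n - l + 1), c i * t ^ i := by
    filter_upwards [eventually_line_mem (origin d).2 ζ] with t ht
    rw [line_of_mem _ _ _ ht, iopVec_origin_apply hν hL]
    refine Finset.sum_congr rfl fun i _ => ?_
    simp only [origin, zero_add, inner_smul_right, hc]
    ring
  dsimp only
  rw [tc_congr h1, tc_sum_pow _ _ (Finset.mem_range.mp hk), hc]
  push_cast
  ring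

theorem kv_origin_const (hν : 0 < ν) (hL : IsLittleSpace L ν l) (ω : Z d) (z w : D d) (ζ : Z d) :
    kv L (origin d, ω) (z, ζ) = kv L (origin d, ω) (w, ζ) := by
  rw [kv_eq_lK hν hL, kv_eq_lK hν hL]
  simp [lK, bK, hK, origin]

/-- The intertwining operator is determined by its action on maps that are constant in `z`. -/
theorem intertwiner_eq {H : Type*} [NormedAddCommGroup H] [InnerProductSpace ℂ H] [CompleteSpace H]
    [RKHS ℂ H (Pt d) ℂ] {n : ℕ} (hν : 0 < ν) (hL : IsLittleSpace L ν l) (hl : l ≤ n)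
    (hH : IsSpaceOfMaps H (MvPolynomial.restrictTotalDegree (Fin d) ℂ n)) {V : L →ₗᵢ[ℂ] H} {a : ℂ}
    (hV : ∀ (g : SU d) (F F' : L), IsLittleTranslate ν g F F' → IsBigTranslate ν n g (V F) (V F'))
    (hc : ∀ F : L, (∀ (z w : D d) (ζ : Z d), F (z, ζ) = F (w, ζ)) → ∀ x : Pt d, V F x = a * F x)
    (F : L) (x : Pt d) : V F x = a * iop (n - l) (ν + 2 * l) F x := by
  have hcl : ∀ x, IsClosed {F : L | V F x = a * iop (n - l) (ν + 2 * l) F x} := fun x => by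
    simp only [← inner_kv x (V _), ← inner_iopVec hL n x]
    exact isClosed_eq (continuous_const.inner V.continuous)
      (continuous_const.mul (continuous_const.inner continuous_id))
  let M : Submodule ℂ L :=
    { carrier := {F | ∀ x, V F x = a * iop (n - l) (ν + 2 * l) F x}
      add_mem' := fun {F G} hF hG x => by
        rw [map_add, RKHS.coe_add, Pi.add_apply, hF x, hG x, ← inner_iopVec hL, ← inner_iopVec hL,
          ← inner_iopVec hL, inner_add_right, mul_add]
      zero_mem' := fun x => by
        rw [map_zero, RKHS.coe_zero, Pi.zero_apply, ← inner_iopVec hL, inner_zero_right, mul_zero]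
      smul_mem' := fun c F hF x => by
        rw [map_smul, RKHS.coe_smul, Pi.smul_apply, hF x, ← inner_iopVec hL, ← inner_iopVec hL,
          inner_smul_right, smul_eq_mul]
        ring }
  have hM : IsClosed (M : Set L) := by
    have : (M : Set L) = ⋂ x, {F : L | V F x = a * iop (n - l) (ν + 2 * l) F x} := by
      ext F
      simp [M]
    rw [this]
    exact isClosed_iInter hcl
  have hconst : ∀ F : L, (∀ (z w : D d) (ζ : Z d), F (z, ζ) = F (w, ζ)) → F ∈ M := by
    intro F hF x
    rw [hc F hF, iop_of_const hF]
  -- Both operators intertwine the same actions, so agreement is inherited by translates: directly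
  -- for small `ζ`, and for all `ζ` by polynomiality.
  have htrans : ∀ (g : SU d) (F F' : L), IsLittleTranslate ν g F F' → F ∈ M → F' ∈ M := by
    intro g F F' h hF x
    have h1 := hV g F F' h
    have h2 := iop_translate hν hl (hL.maps.1 F) (hL.maps.1 F') h
    have h3 : IsHolomorphicMap (MvPolynomial.restrictTotalDegree (Fin d) ℂ n)
        ((V F' : Pt d → ℂ) - a • iop (n - l) (ν + 2 * l) F') :=
      (holMaps _).sub_mem (hH.1 (V F')) ((holMaps _).smul_mem a
        (iop_isHolomorphicMap hl (hL.maps.1 F') _))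
    obtain ⟨r, hr, hnear⟩ := (isMultiplier_big (d := d) ν n).near x.1
    refine sub_eq_zero.mp (h3.eq_zero_of_small hr (fun ζ hζ => ?_) x.2)
    have hden := den_ne_zero g (hnear ζ hζ)
    have hF' := hF (actBall g x.1, act g.1 ((x.1 : Z d) + ζ) - act g.1 (x.1 : Z d))
    rw [Pi.sub_apply, Pi.smul_apply, h1 x.1 ζ hden, h2 x.1 ζ hden, hF', smul_eq_mul]
    ring
  -- By transitivity every kernel vector is a multiple of a translate of one at the origin, and
  -- those are constant in `z`.
  have hkv : ∀ y, kv L y ∈ M := by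
    intro y
    obtain ⟨g, hg⟩ := exists_SU_act_eq_zero y.1.2
    obtain ⟨T, hT⟩ := hL.exists_unitary g
    have h1 : tangentAct g y = (origin d, (tangentAct g y).2) := Prod.ext (Subtype.ext hg) rfl
    have h2 := htrans g _ _ (hT (kv L (origin d, (tangentAct g y).2)))
      (hconst _ (kv_origin_const hν hL _))
    have h3 : kv L y = star (detPow ν g y.1) • T (kv L (origin d, (tangentAct g y).2)) := by
      refine ext_inner_right ℂ fun G => ?_
      obtain ⟨G, rfl⟩ := T.surjective G
      rw [inner_smul_left, T.inner_map_map, inner_kv, inner_kv, ← h1, starRingEnd_apply, star_star]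
      exact isLittleTranslate_iff.mp (hT G) y
    rw [h3]
    exact M.smul_mem _ h2
  have htop : M = ⊤ := by
    rw [← top_le_iff, ← span_kv L (X := Pt d)]
    refine Submodule.topologicalClosure_minimal _ (Submodule.span_le.mpr ?_) hM
    rintro _ ⟨y, rfl⟩
    exact hkv y
  have : F ∈ M := htop ▸ Submodule.mem_top
  exact this x

end Little

end BallKernel
end

/-! ### Weighted sums of little spaces and their kernels -/

noncomputable section
namespace BallKernel
variable {d : ℕ}

section Sum

variable {ν : ℝ} {n : ℕ} {L : Fin (n + 1) → Type*} [∀ l, NormedAddCommGroup (L l)]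
  [∀ l, InnerProductSpace ℂ (L l)]

/-- The embedding of a summand. -/
def lpSingle (l : Fin (n + 1)) : L l →ₗᵢ[ℂ] lp L 2 where
  toLinearMap := lp.lsingle 2 l
  norm_map' F := lp.norm_single (by norm_num) l F

theorem lpSingle_self (l : Fin (n + 1)) (F : L l) : lpSingle l F l = F :=
  lp.single_apply_self 2 l F

theorem lpSingle_ne {l j : Fin (n + 1)} (F : L l) (h : j ≠ l) : lpSingle l F j = 0 :=
  lp.single_apply_ne 2 l F h

theorem inner_lpSingle (l : Fin (n + 1)) (F : L l) (G : lp L 2) :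
    inner ℂ G (lpSingle l F) = inner ℂ (G l) F := lp.inner_single_right l F G

theorem inner_lp (F G : lp L 2) : inner ℂ F G = ∑ l, inner ℂ (F l) (G l) := by
  rw [lp.inner_eq_tsum, tsum_fintype]

theorem sum_lpSingle (F : lp L 2) : ∑ l, lpSingle l (F l) = F := by
  refine ext_inner_left ℂ fun G => ?_
  rw [inner_sum, inner_lp]
  exact Finset.sum_congr rfl fun l _ => inner_lpSingle l _ _

theorem norm_lp_congr {F G : lp L 2} (h : ∀ l, ‖F l‖ = ‖G l‖) : ‖F‖ = ‖G‖ := by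
  rw [lp.norm_eq_tsum_rpow (by norm_num) F, lp.norm_eq_tsum_rpow (by norm_num) G]
  simp only [h]

variable [∀ l, CompleteSpace (L l)] [∀ l, RKHS ℂ (L l) (Pt d) ℂ]

/-- The evaluation vectors of the weighted sum. -/
def wVec (hL : ∀ l, IsLittleSpace (L l) ν l) (c : Fin (n + 1) → ℝ) (x : Pt d) : lp L 2 :=
  ⟨fun l => (Real.sqrt (c l) : ℂ) • iopVec (hL l) n x, Memℓp.all _⟩

theorem wVec_apply (hL : ∀ l, IsLittleSpace (L l) ν l) (c : Fin (n + 1) → ℝ) (x : Pt d)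
    (l : Fin (n + 1)) : wVec hL c x l = (Real.sqrt (c l) : ℂ) • iopVec (hL l) n x := rfl

/-- The kernel of the weighted sum. -/
def wK (hL : ∀ l, IsLittleSpace (L l) ν l) (c : Fin (n + 1) → ℝ) (x y : Pt d) : ℂ :=
  ∑ l, (c l : ℂ) * inner ℂ (iopVec (hL l) n x) (iopVec (hL l) n y)

theorem inner_wVec (hL : ∀ l, IsLittleSpace (L l) ν l) (c : Fin (n + 1) → ℝ) (x : Pt d)
    (F : lp L 2) : inner ℂ (wVec hL c x) F =
      ∑ l : Fin (n + 1), (Real.sqrt (c l) : ℂ) * iop (n - l) (ν + 2 * (l : ℕ)) (F l) x := by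
  rw [inner_lp]
  refine Finset.sum_congr rfl fun l _ => ?_
  rw [wVec_apply, inner_smul_left, inner_iopVec, Complex.conj_ofReal]

theorem inner_wVec_wVec (hL : ∀ l, IsLittleSpace (L l) ν l) {c : Fin (n + 1) → ℝ}
    (hc : ∀ l, 0 < c l) (x y : Pt d) : inner ℂ (wVec hL c x) (wVec hL c y) = wK hL c x y := by
  rw [inner_lp]
  refine Finset.sum_congr rfl fun l _ => ?_
  rw [wVec_apply, wVec_apply, inner_smul_left, inner_smul_right, Complex.conj_ofReal, ← mul_assoc,
    ← Complex.ofReal_mul, Real.mul_self_sqrt (hc l).le]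

theorem tc_zero_fun (k : ℕ) : tc (fun _ => 0) k = 0 := by
  simpa using tc_const_mul 0 (fun _ => 0) k

theorem line_zero_fun (z : D d) (ζ : Z d) : line (0 : Pt d → ℂ) z ζ = fun _ => 0 := by
  ext t
  simp [line]

/-- The image of `F l` has components of degree at least `l` in `ζ`, with lowest component `F l`
itself. Hence the lowest nonzero `F l` could not be cancelled. -/
theorem eq_zero_of_sum_iop (hL : ∀ l, IsLittleSpace (L l) ν l) {a : Fin (n + 1) → ℂ}
    (ha : ∀ l, a l ≠ 0) {F : ∀ l, L l}
    (h : ∀ x : Pt d, ∑ l : Fin (n + 1), a l * iop (n - l) (ν + 2 * (l : ℕ)) (F l) x = 0)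
    (l : Fin (n + 1)) : F l = 0 := by
  suffices key : ∀ m, ∀ l : Fin (n + 1), (l : ℕ) = m → F l = 0 from key l l rfl
  intro m
  induction m using Nat.strong_induction_on with
  | _ m ih =>
    intro l hl
    ext ⟨z, ζ⟩
    rw [RKHS.coe_zero, Pi.zero_apply]
    set b : Fin (n + 1) → ℕ → ℂ := fun j k =>
      a j * ((icoeff (n - j) (ν + 2 * (j : ℕ)) k : ℂ) * tc (line (F j) z ζ) k) with hb
    -- Replacing `ζ` by `s ζ` makes the relation a polynomial identity in `s`, from which the degree
    -- `l` part is read off.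
    have hP : ∑ j : Fin (n + 1), ∑ k ∈ Finset.range (n - j + 1),
        Polynomial.monomial ((j : ℕ) + k) (b j k) = 0 := by
      refine Polynomial.funext fun s => ?_
      rw [Polynomial.eval_zero, ← h (z, s • ζ), Polynomial.eval_finsetSum]
      refine Finset.sum_congr rfl fun j _ => ?_
      rw [Polynomial.eval_finsetSum, iop, Finset.mul_sum]
      refine Finset.sum_congr rfl fun k _ => ?_
      rw [Polynomial.eval_monomial]
      dsimp only
      rw [tc_line_smul ((hL j).maps.1 (F j))]
      ring
    have h1 := congrArg (fun P => Polynomial.coeff P l) hP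
    simp only [Polynomial.finsetSum_coeff, Polynomial.coeff_monomial, Polynomial.coeff_zero] at h1
    rw [Finset.sum_eq_single l (fun j _ hj => ?_) (by simp),
      Finset.sum_eq_single 0 (fun k _ hk => if_neg (by omega)) (by simp), if_pos (by simp)] at h1
    · simpa [hb, icoeff_zero, tc_zero, line_zero, ha l] using h1
    · refine Finset.sum_eq_zero fun k _ => ?_
      rcases lt_or_gt_of_ne (Fin.val_ne_of_ne hj) with hlt | hgt
      · have h2 : b j k = 0 := by
          rw [hb]
          dsimp only
          rw [ih j (hl ▸ hlt) j rfl, RKHS.coe_zero, line_zero_fun, tc_zero_fun]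
          simp
        simp [h2]
      · exact if_neg (by omega)

theorem span_wVec (hL : ∀ l, IsLittleSpace (L l) ν l) {c : Fin (n + 1) → ℝ} (hc : ∀ l, 0 < c l) :
    (Submodule.span ℂ (Set.range (wVec hL c))).topologicalClosure = ⊤ := by
  rw [Submodule.topologicalClosure_eq_top_iff, Submodule.eq_bot_iff]
  intro F hF
  -- Orthogonality to all evaluation vectors says that the weighted sum of the intertwined
  -- components vanishes identically.
  have h : ∀ l, F l = 0 := eq_zero_of_sum_iop hL (F := F) (a := fun l => (Real.sqrt (c l) : ℂ))
    (fun l => by exact_mod_cast (Real.sqrt_pos.mpr (hc l)).ne') fun x => by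
      rw [← inner_wVec hL c x]
      exact (Submodule.mem_orthogonal _ _).mp hF _ (Submodule.subset_span ⟨x, rfl⟩)
  exact lp.ext (funext h)

theorem covariant_wK (hν : 0 < ν) (hL : ∀ l, IsLittleSpace (L l) ν l) (c : Fin (n + 1) → ℝ) :
    Covariant (bigSet d) (bigMul ν n) bigAct (wK hL c) := by
  intro g x hx y hy
  rw [wK, wK, Finset.mul_sum]
  refine Finset.sum_congr rfl fun l _ => ?_
  have h := covariant_iopVec hν (hL l) (Nat.lt_succ_iff.mp l.2) g x hx y hy
  dsimp only at h
  rw [h]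
  ring

theorem wK_isHolomorphicMap (hL : ∀ l, IsLittleSpace (L l) ν l) (c : Fin (n + 1) → ℝ) (y : Pt d) :
    IsHolomorphicMap (MvPolynomial.restrictTotalDegree (Fin d) ℂ n) fun x => wK hL c x y := by
  have : (fun x => wK hL c x y) = ∑ l, (c l : ℂ) •
      fun x => (inner ℂ (iopVec (hL l) n x) (iopVec (hL l) n y) : ℂ) := by
    ext x
    simp [wK]
  rw [this]
  exact (holMaps _).sum_mem fun l _ => (holMaps _).smul_mem _
    (iopVec_isHolomorphicMap (hL l) (Nat.lt_succ_iff.mp l.2) y)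

theorem wK_symm (hL : ∀ l, IsLittleSpace (L l) ν l) (c : Fin (n + 1) → ℝ) (x y : Pt d) :
    wK hL c y x = star (wK hL c x y) := by
  simp only [wK, ← starRingEnd_apply, map_sum, map_mul, Complex.conj_ofReal, inner_conj_symm]

theorem psd_wK (hL : ∀ l, IsLittleSpace (L l) ν l) {c : Fin (n + 1) → ℝ} (hc : ∀ l, 0 < c l) :
    PSD (wK hL c) := by
  refine ⟨Matrix.IsHermitian.ext fun x y => (wK_symm hL c y x).symm, fun a => ?_⟩
  have h := inner_linearCombination (wVec hL c) a a
  have e : (a.sum fun i xi => a.sum fun j xj => star xi * (Matrix.of (wK hL c)) i j * xj) =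
      inner ℂ (Finsupp.linearCombination ℂ (wVec hL c) a)
        (Finsupp.linearCombination ℂ (wVec hL c) a) := by
    rw [h]
    simp only [inner_wVec_wVec hL hc, Matrix.of_apply]
  rw [e, inner_self_eq_norm_sq_to_K, ← RCLike.ofReal_pow]
  exact RCLike.ofReal_nonneg.mpr (sq_nonneg _)

section Space

variable {H : Type*} [NormedAddCommGroup H] [InnerProductSpace ℂ H] [CompleteSpace H]
  [RKHS ℂ H (Pt d) ℂ]

theorem exists_equiv_lp (hL : ∀ l, IsLittleSpace (L l) ν l) {c : Fin (n + 1) → ℝ}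
    (hc : ∀ l, 0 < c l) (hK : ∀ x y, ker H x y = wK hL c x y) :
    ∃ e : lp L 2 ≃ₗᵢ[ℂ] H, ∀ (F : lp L 2) (x : Pt d), e F x =
      ∑ l : Fin (n + 1), (Real.sqrt (c l) : ℂ) * iop (n - l) (ν + 2 * (l : ℕ)) (F l) x := by
  obtain ⟨e, he⟩ := exists_linearIsometryEquiv_of_gram (span_wVec hL hc) (span_kv H)
    (fun x y => by rw [inner_wVec_wVec hL hc, ← ker_eq_inner, hK])
  refine ⟨e, fun F x => ?_⟩
  rw [← inner_kv, ← he, e.inner_map_map, inner_wVec]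

theorem sum_iop_lpSingle (hL : ∀ l, IsLittleSpace (L l) ν l) (a : Fin (n + 1) → ℂ)
    (j : Fin (n + 1)) (F : L j) (x : Pt d) :
    ∑ l : Fin (n + 1), a l * iop (n - l) (ν + 2 * (l : ℕ)) (lpSingle j F l) x =
      a j * iop (n - j) (ν + 2 * (j : ℕ)) F x := by
  rw [Finset.sum_eq_single j (fun l _ hl => ?_) (by simp), lpSingle_self]
  rw [lpSingle_ne F hl, ← inner_iopVec (hL l), inner_zero_right, mul_zero]

theorem isWeightedSum_of_ker (hν : 0 < ν) (hL : ∀ l, IsLittleSpace (L l) ν l)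
    {c : Fin (n + 1) → ℝ} (hc : ∀ l, 0 < c l) (hK : ∀ x y, ker H x y = wK hL c x y) :
    IsWeightedSum H ν n c L := by
  obtain ⟨e, he⟩ := exists_equiv_lp hL hc hK
  have hV : ∀ (l : Fin (n + 1)) (F : L l) (x : Pt d), e.toLinearIsometry.comp (lpSingle l) F x =
      (Real.sqrt (c l) : ℂ) * iop (n - l) (ν + 2 * (l : ℕ)) F x := fun l F x => by
    rw [← sum_iop_lpSingle hL (fun l => (Real.sqrt (c l) : ℂ)) l F x]
    exact he _ _
  refine ⟨fun l => e.toLinearIsometry.comp (lpSingle l), IsHilbertSum.mk ?_ ?_, ?_, ?_⟩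
  · intro i j hij F G
    change inner ℂ (e (lpSingle i F)) (e (lpSingle j G)) = 0
    rw [e.inner_map_map, inner_lpSingle, lpSingle_ne F hij.symm, inner_zero_left]
  · refine le_trans (fun F _ => ?_) (Submodule.le_topologicalClosure _)
    obtain ⟨F, rfl⟩ := e.surjective F
    rw [← sum_lpSingle F, map_sum]
    exact Submodule.sum_mem _ fun l _ => Submodule.mem_iSup_of_mem l ⟨F l, rfl⟩
  · intro l g F F' h z ζ hden
    rw [hV, hV, iop_translate hν (Nat.lt_succ_iff.mp l.2) ((hL l).maps.1 F) ((hL l).maps.1 F') h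
      z ζ hden]
    ring
  · intro l F hF x
    rw [hV, iop_of_const hF]

theorem mem_range_of_PMaps (hL : ∀ l, IsLittleSpace (L l) ν l) {l : Fin (n + 1)}
    {G : Z d → Z d → ℂ} (hG : G ∈ PMaps (polyClass d) (Hom d l)) :
    ∃ F : L l, ∀ (z : D d) (ζ : Z d), F (z, ζ) = G z ζ := by
  suffices h : (fun x : Pt d => G x.1 x.2) ∈ LinearMap.range (coeLin (L l) (Pt d)) by
    obtain ⟨F, hF⟩ := h
    exact ⟨F, fun z ζ => congrFun hF (z, ζ)⟩
  refine PMaps_induction (P := fun G : Z d → Z d → ℂ => (fun x : Pt d => G x.1 x.2) ∈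
    LinearMap.range (coeLin (L l) (Pt d))) ?_ (Submodule.zero_mem _)
    (fun F G hF hG => Submodule.add_mem _ hF hG) (fun c F hF => Submodule.smul_mem _ c hF) hG
  rintro a ⟨p, hp⟩ q hq
  obtain ⟨F, hF⟩ := (hL l).maps.2 p q hq
  exact ⟨F, funext fun x => by
    dsimp only
    rw [hp]
    exact hF x.1 x.2⟩

theorem isBigSpace_of_ker (hν : 0 < ν) (hL : ∀ l, IsLittleSpace (L l) ν l)
    {c : Fin (n + 1) → ℝ} (hc : ∀ l, 0 < c l) (hK : ∀ x y, ker H x y = wK hL c x y) :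
    IsBigSpace H ν n := by
  obtain ⟨e, he⟩ := exists_equiv_lp hL hc hK
  have hle : ∀ l : Fin (n + 1), (l : ℕ) ≤ n := fun l => Nat.lt_succ_iff.mp l.2
  refine ⟨⟨fun F => ?_, ?_⟩, fun g F => ?_⟩
  · obtain ⟨F, rfl⟩ := e.surjective F
    have : (e F : Pt d → ℂ) = ∑ l : Fin (n + 1), (Real.sqrt (c l) : ℂ) •
        iop (n - l) (ν + 2 * (l : ℕ)) (F l) := by
      ext x
      simp [he]
    rw [this]
    exact (holMaps _).sum_mem fun l _ => (holMaps _).smul_mem _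
      (iop_isHolomorphicMap (hle l) ((hL l).maps.1 _) _)
  -- Polynomial maps are obtained by descending induction on the degree `l`: the image of such a map
  -- under the intertwiner is the map itself plus polynomial maps of higher degree in `ζ`, which are
  -- already known to belong to the space.
  · have key : ∀ j, ∀ l : Fin (n + 1), n - l = j → ∀ G ∈ PMaps (polyClass d) (Hom d l),
        (fun x : Pt d => G x.1 x.2) ∈ LinearMap.range (coeLin H (Pt d)) := by
      intro j
      induction j using Nat.strong_induction_on with
      | _ j ih =>
        intro l hlj G hG
        obtain ⟨F, hF⟩ := mem_range_of_PMaps hL hG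
        obtain ⟨R, hR, hR', hR''⟩ := iop_eq_sum isCoeffClass_polyClass hG hF (n - l)
          (ν + 2 * (l : ℕ))
        have hne : (Real.sqrt (c l) : ℂ) ≠ 0 := by exact_mod_cast (Real.sqrt_pos.mpr (hc l)).ne'
        have e1 : (fun x : Pt d => G x.1 x.2) = (Real.sqrt (c l) : ℂ)⁻¹ •
            coeLin H (Pt d) (e (lpSingle l F)) -
              ∑ k ∈ Finset.range (n - l), fun x : Pt d => R (k + 1) x.1 x.2 := by
          ext ⟨z, ζ⟩
          have h1 : coeLin H (Pt d) (e (lpSingle l F)) (z, ζ) =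
              (Real.sqrt (c l) : ℂ) * iop (n - l) (ν + 2 * (l : ℕ)) F (z, ζ) := by
            rw [← sum_iop_lpSingle hL (fun l => (Real.sqrt (c l) : ℂ)) l F]
            exact he _ _
          have h2 := hR' z ζ 0
          rw [icoeff_zero, tc_zero, line_zero, hF] at h2
          rw [Pi.sub_apply, Pi.smul_apply, h1, hR'', Finset.sum_range_succ', ← h2, smul_eq_mul,
            inv_mul_cancel_left₀ hne]
          simp
        rw [e1]
        refine Submodule.sub_mem _ (Submodule.smul_mem _ _ ⟨_, rfl⟩)
          (Submodule.sum_mem _ fun k hk => ?_)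
        have hk' := Finset.mem_range.mp hk
        exact ih (n - (l + (k + 1))) (by omega) ⟨l + (k + 1), by omega⟩ rfl _ (hR (k + 1))
    intro p q hq
    suffices h : (fun x : Pt d => MvPolynomial.eval (x.1 : Z d) p * MvPolynomial.eval x.2 q) ∈
        LinearMap.range (coeLin H (Pt d)) by
      obtain ⟨F, hF⟩ := h
      exact ⟨F, fun z ζ => congrFun hF (z, ζ)⟩
    have e2 : (fun x : Pt d => MvPolynomial.eval (x.1 : Z d) p * MvPolynomial.eval x.2 q) =
        ∑ m ∈ Finset.range (n + 1), fun x : Pt d => MvPolynomial.eval (x.1 : Z d) p *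
          MvPolynomial.eval x.2 (MvPolynomial.homogeneousComponent m q) := by
      ext x
      conv_lhs => rw [eval_eq_sum_homogeneous hq]
      rw [map_sum, Finset.mul_sum, Finset.sum_apply]
    rw [e2]
    refine Submodule.sum_mem _ fun m hm => ?_
    exact key _ ⟨m, Finset.mem_range.mp hm⟩ rfl
      (fun z ζ => MvPolynomial.eval z p * MvPolynomial.eval ζ _)
      (mul_eval_mem_PMaps (show (fun z : Z d => MvPolynomial.eval z p) ∈ polyClass d from
        ⟨p, fun _ => rfl⟩) (MvPolynomial.homogeneousComponent_mem m q))
  · obtain ⟨F, rfl⟩ := e.surjective F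
    -- The big translate is the componentwise little translate, which preserves the norm of the sum.
    choose T hT using fun l => (hL l).exists_unitary g
    refine ⟨e ⟨fun l => T l (F l), Memℓp.all _⟩, fun z ζ hden => ?_, ?_⟩
    · rw [he, he, Finset.mul_sum]
      refine Finset.sum_congr rfl fun l _ => ?_
      have := iop_translate hν (hle l) ((hL l).maps.1 (F l)) ((hL l).maps.1 _) (hT l (F l)) z ζ hden
      dsimp only
      rw [this]
      ring
    · rw [e.norm_map, e.norm_map]
      exact norm_lp_congr fun l => (T l).norm_map _

/-- The embeddings are forced to be `√c_l` times the intertwiners, so the isometry onto the Hilbert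
sum carries kernel vectors to the vectors `wVec`. -/
theorem IsWeightedSum.ker_eq (hν : 0 < ν) (hL : ∀ l, IsLittleSpace (L l) ν l)
    (hH : IsBigSpace H ν n) {c : Fin (n + 1) → ℝ} (hc : ∀ l, 0 < c l)
    (h : IsWeightedSum H ν n c L) (x y : Pt d) : ker H x y = wK hL c x y := by
  obtain ⟨V, hV, hV1, hV2⟩ := h
  have h1 : ∀ (x : Pt d), hV.linearIsometryEquiv (kv H x) = wVec hL c x := by
    intro x
    refine lp.ext (funext fun l => ext_inner_right ℂ fun F => ?_)
    have h2 : hV.linearIsometryEquiv.symm (lpSingle l F) = V l F :=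
      hV.linearIsometryEquiv_symm_apply_single F
    rw [← inner_lpSingle l F, ← hV.linearIsometryEquiv.apply_symm_apply (lpSingle l F),
      LinearIsometryEquiv.inner_map_map, h2, inner_kv,
      intertwiner_eq hν (hL l) (Nat.lt_succ_iff.mp l.2) hH.maps (hV1 l) (hV2 l), wVec_apply,
      inner_smul_left, inner_iopVec, Complex.conj_ofReal]
  rw [ker_eq_inner, ← hV.linearIsometryEquiv.inner_map_map, h1, h1, inner_wVec_wVec hL hc]

end Space

end Sum

end BallKernel
end

/-! ### The coefficients `kappa` and their triangular matrix -/

noncomputable section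
namespace BallKernel
variable {d : ℕ}

theorem binom_eq_choose (x : ℝ) (k : ℕ) : binom x k = Ring.choose x k := by
  have hk : (k.factorial : ℝ) ≠ 0 := by exact_mod_cast k.factorial_ne_zero
  rw [binom, div_eq_iff hk, mul_comm]
  exact (factorial_mul_choose x k).symm

theorem poch_div_factorial (x : ℝ) (k : ℕ) :
    poch x k / k.factorial = Ring.choose (x + k - 1) k := by
  rw [← binom_eq_choose, binom, poch, ← Finset.prod_range_reflect]
  congr 1
  refine Finset.prod_congr rfl fun i hi => ?_
  have hi' := Finset.mem_range.mp hi
  rw [Nat.sub_sub, Nat.cast_sub (by omega)]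
  push_cast
  ring

/-- `(ν+2l)_k / k!` is the binomial coefficient of `ν+2l+k-1` over `k`. Splitting the upper entry as
`(ν+m-1) + l` with `m = l+k`, Chu–Vandermonde gives the sum in `kappa`. -/
theorem kappa_eq {n l k : ℕ} (hl : l ≤ n) (ν : ℝ) :
    kappa n ν l (l + k) = icoeff (n - l) (ν + 2 * l) k ^ 2 *
      (poch (ν + 2 * l) k / k.factorial) := by
  rw [kappa, Nat.add_sub_cancel_left, icoeff, poch_div_factorial]
  congr 3
  · congr 1
    rw [Nat.cast_sub hl]
    ring
  · rw [show ν + 2 * (l : ℝ) + k - 1 = (ν + (l + k : ℕ) - 1) + l by push_cast; ring,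
      Ring.add_choose_eq k (Commute.all _ _)]
    refine Finset.sum_congr rfl fun pq _ => ?_
    rw [binom_eq_choose, Ring.choose_natCast]

theorem kappa_self {n l : ℕ} (ν : ℝ) : kappa n ν l l = 1 := by
  simp [kappa, poch, binom]

theorem sum_range_shift {n l : ℕ} (hl : l ≤ n) (g : ℕ → ℂ) :
    ∑ k ∈ Finset.range (n - l + 1), g (l + k) =
      ∑ m : Fin (n + 1), if l ≤ (m : ℕ) then g m else 0 := by
  rw [Fin.sum_univ_eq_sum_range (fun m => if l ≤ m then g m else 0), ← Finset.sum_filter]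
  have : (Finset.range (n + 1)).filter (fun m => l ≤ m) = Finset.Ico l (n + 1) := by
    ext m
    simp
    omega
  rw [this, Finset.sum_Ico_eq_sum_range, Nat.sub_add_comm hl]

theorem coeff_unique {n : ℕ} {a b : Fin (n + 1) → ℂ}
    (h : ∀ r : ℝ, 0 < r → r ≤ 1 → ∑ m : Fin (n + 1), a m * (r : ℂ) ^ (m : ℕ) =
      ∑ m : Fin (n + 1), b m * (r : ℂ) ^ (m : ℕ)) : a = b := by
  have hP : ∑ m : Fin (n + 1), Polynomial.monomial (m : ℕ) (a m - b m) = 0 := by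
    refine Polynomial.eq_zero_of_infinite_isRoot _ (Set.Infinite.mono (s :=
      (fun r : ℝ => (r : ℂ)) '' Set.Ioc 0 1) ?_ ((Set.Ioc_infinite one_pos).image
        Complex.ofReal_injective.injOn))
    rintro _ ⟨r, hr, rfl⟩
    change Polynomial.eval _ _ = 0
    simp only [Polynomial.eval_finsetSum, Polynomial.eval_monomial, sub_mul,
      Finset.sum_sub_distrib]
    exact sub_eq_zero.mpr (h r hr.1 hr.2)
  ext m
  have h1 := congrArg (fun P => Polynomial.coeff P m) hP
  simp only [Polynomial.finsetSum_coeff, Polynomial.coeff_monomial, Polynomial.coeff_zero] at h1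
  rw [Finset.sum_eq_single m (fun j _ hj => if_neg (Fin.val_ne_of_ne hj)) (by simp),
    if_pos rfl] at h1
  exact sub_eq_zero.mp h1

/-- The triangular matrix relating the weights to the kernel at the origin. -/
def kappaMatrix (n : ℕ) (ν : ℝ) : Matrix (Fin (n + 1)) (Fin (n + 1)) ℝ :=
  Matrix.of fun m l => if l ≤ m then kappa n ν l m / ((l : ℕ).factorial : ℝ) else 0

/-- Lower triangular, with diagonal entries `1 / l!`. -/
theorem isUnit_kappaMatrix (n : ℕ) (ν : ℝ) : IsUnit (kappaMatrix n ν) := by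
  rw [Matrix.isUnit_iff_isUnit_det, Matrix.det_of_isLowerTriangular, isUnit_iff_ne_zero,
    Finset.prod_ne_zero_iff]
  · intro l _
    simp [kappaMatrix, kappa_self, Nat.factorial_ne_zero]
  · intro i j hij
    have : ¬ j ≤ i := not_le.mpr (OrderDual.toDual_lt_toDual.mp hij)
    simp [kappaMatrix, this]

theorem kappaMatrix_mulVec (n : ℕ) (ν : ℝ) (c : Fin (n + 1) → ℝ) (m : Fin (n + 1)) :
    (kappaMatrix n ν).mulVec c m =
      ∑ l ∈ Finset.Iic m, kappa n ν l m * (c l / ((l : ℕ).factorial : ℝ)) := by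
  rw [Matrix.mulVec, dotProduct, ← Finset.sum_subset (Finset.subset_univ (Finset.Iic m))]
  · refine Finset.sum_congr rfl fun l hl => ?_
    rw [kappaMatrix, Matrix.of_apply, if_pos (Finset.mem_Iic.mp hl)]
    ring
  · intro l _ hl
    rw [Finset.mem_Iic] at hl
    simp [kappaMatrix, hl]

theorem wK_origin {ν : ℝ} (hν : 0 < ν) {n : ℕ} {L : Fin (n + 1) → Type*}
    [∀ l, NormedAddCommGroup (L l)] [∀ l, InnerProductSpace ℂ (L l)] [∀ l, CompleteSpace (L l)]
    [∀ l, RKHS ℂ (L l) (Pt d) ℂ] (hL : ∀ l, IsLittleSpace (L l) ν l) (c : Fin (n + 1) → ℝ)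
    (ζ ω : Z d) : wK hL c (origin d, ζ) (origin d, ω) =
      ∑ m : Fin (n + 1), (((kappaMatrix n ν).mulVec c m : ℝ) : ℂ) *
        (inner ℂ ω ζ : ℂ) ^ (m : ℕ) := by
  have h : ∀ l : Fin (n + 1), (c l : ℂ) *
      inner ℂ (iopVec (hL l) n (origin d, ζ)) (iopVec (hL l) n (origin d, ω)) =
        ∑ m : Fin (n + 1), ((kappaMatrix n ν m l * c l : ℝ) : ℂ) *
          (inner ℂ ω ζ : ℂ) ^ (m : ℕ) := by
    intro l
    have hl := Nat.lt_succ_iff.mp l.2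
    rw [inner_iopVec_origin hν]
    simp only [← kappa_eq hl ν]
    rw [sum_range_shift hl (fun m => ((kappa n ν l m / (l : ℕ).factorial : ℝ) : ℂ) *
      (inner ℂ ω ζ : ℂ) ^ m), Finset.mul_sum]
    refine Finset.sum_congr rfl fun m _ => ?_
    by_cases hm : l ≤ m
    · have hm' : (l : ℕ) ≤ m := hm
      simp only [kappaMatrix, Matrix.of_apply, if_pos hm, if_pos hm']
      push_cast
      ring
    · have hm' : ¬ (l : ℕ) ≤ m := hm
      simp [kappaMatrix, hm, hm']
  rw [wK, Finset.sum_congr rfl fun l _ => h l, Finset.sum_comm]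
  refine Finset.sum_congr rfl fun m _ => ?_
  rw [← Finset.sum_mul, Matrix.mulVec, dotProduct, Complex.ofReal_sum]

end BallKernel
end

/-! ### The form of a covariant kernel at the origin -/

noncomputable section
namespace BallKernel
variable {d : ℕ}

theorem psmul_origin (c : ℂ) (ζ : Z d) : psmul c (origin d, ζ) = (origin d, c • ζ) := by
  refine Prod.ext (Subtype.ext ?_) rfl
  rw [psmul, coe_bsmul (by simp [origin])]
  simp [origin]

theorem origin_mem_bigSet {ζ : Z d} (h : ‖ζ‖ < 1) : (origin d, ζ) ∈ bigSet d := by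
  simpa [bigSet, origin] using h

section Origin

variable {ν : ℝ} {n : ℕ} {E : Pt d → Pt d → ℂ}

/-- At the origin a covariant kernel depends only on the component of `ζ` along `ω`. -/
theorem Covariant.origin_proj (hE : Covariant (bigSet d) (bigMul ν n) bigAct E)
    (hol : ∀ y, IsHolomorphicMap (MvPolynomial.restrictTotalDegree (Fin d) ℂ n) fun x => E x y)
    {ζ ω : Z d} (hζ : ‖ζ‖ < 1) (hω : ‖ω‖ < 1) {t : ℂ}
    (ht : t * inner ℂ ω ω = inner ℂ ω ζ) (hω0 : (inner ℂ ω ω : ℂ) ≠ 0) :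
    E (origin d, ζ) (origin d, ω) = E (origin d, t • ω) (origin d, ω) := by
  have hJ := isMultiplier_big (d := d) ν n
  obtain ⟨q, -, hq'⟩ := (hol (origin d, ω)).1 (origin d)
  have hq : ∀ ζ, E (origin d, ζ) (origin d, ω) = MvPolynomial.eval ζ q := hq'
  have hd : Differentiable ℂ fun c : ℂ => MvPolynomial.eval (t • ω + c • (ζ - t • ω)) q :=
    (differentiable_eval q).comp ((differentiable_id.smul_const (ζ - t • ω)).const_add (t • ω))
  have key : ∀ c : ℂ, ‖c‖ = 1 → MvPolynomial.eval (t • ω + c • (ζ - t • ω)) q -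
      E (origin d, ζ) (origin d, ω) = 0 := by
    intro c hc
    have hcc : star c * c = 1 := by
      have := Complex.conj_mul' c
      rw [hc] at this
      simpa using this
    have hc' : ‖star c‖ = 1 := by simpa using hc
    -- Multiplying `ω` by `c̄` and then everything by `c` fixes `ω` and multiplies its orthogonal
    -- complement by `c`.
    obtain ⟨g, b, hb, hg⟩ := exists_SU_fix_zero ω hc'
    have hg' : ∀ z, act g.1 z = z + ((star c - 1) * inner ℂ ω z / inner ℂ ω ω) • ω := fun z => by
      have := hg z
      refine smul_right_injective _ hω0 ?_
      change (inner ℂ ω ω : ℂ) • act g.1 z = (inner ℂ ω ω : ℂ) • _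
      rw [this, smul_add, smul_smul, mul_div_cancel₀ _ hω0]
    have h0 : act g.1 0 = 0 := by simp [hg']
    have hφ : ∀ η, bigAct g (origin d, η) = (origin d, act g.1 η) := fun η => by
      refine Prod.ext (Subtype.ext h0) ?_
      rw [hJ.linear g ⟨b, hb⟩ h0]
    have e1 := hE g _ (origin_mem_bigSet hζ) _ (origin_mem_bigSet hω)
    rw [hJ.const g ⟨b, hb⟩ h0 _ (origin_mem_bigSet hζ) _ (origin_mem_bigSet hω), one_mul, hφ, hφ]
      at e1
    have m1 := hJ.maps g _ (origin_mem_bigSet hζ)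
    have m2 := hJ.maps g _ (origin_mem_bigSet hω)
    rw [hφ] at m1 m2
    rw [← hE.circle hJ hc m1 m2, psmul_origin, psmul_origin] at e1
    have e2 : c • act g.1 ω = ω := by
      rw [hg', mul_div_cancel_right₀ _ hω0, smul_add, smul_smul, mul_sub, mul_one, mul_comm c, hcc,
        ← add_smul]
      simp
    have e3 : c • act g.1 ζ = t • ω + c • (ζ - t • ω) := by
      rw [hg', ← ht, ← mul_assoc, mul_div_cancel_right₀ _ hω0, smul_add, smul_smul, ← mul_assoc,
        mul_sub, mul_one, mul_comm c, hcc, smul_sub, smul_smul, sub_mul, sub_smul, one_mul]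
      abel
    rw [e1, e2, e3, ← hq, sub_self]
  -- Continuation from the circle to `c = 0` removes the component of `ζ` orthogonal to `ω`.
  have h := eq_zero_of_unit_circle one_lt_two
    ((hd.sub_const (E (origin d, ζ) (origin d, ω))).differentiableOn) key (c := 0) (by simp)
  rw [zero_smul, add_zero, ← hq, sub_eq_zero] at h
  exact h.symm

theorem exists_coeff_line
    (hol : ∀ y, IsHolomorphicMap (MvPolynomial.restrictTotalDegree (Fin d) ℂ n) fun x => E x y)
    (ω : Z d) : ∃ a : Fin (n + 1) → ℂ, ∀ t : ℂ,
      E (origin d, t • ω) (origin d, ω) = ∑ m : Fin (n + 1), a m * t ^ (m : ℕ) := by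
  obtain ⟨q, hq, h⟩ := (hol (origin d, ω)).1 (origin d)
  have hq' : ∀ ζ, E (origin d, ζ) (origin d, ω) = MvPolynomial.eval ζ q := h
  refine ⟨fun m => MvPolynomial.eval ω (MvPolynomial.homogeneousComponent m q), fun t => ?_⟩
  rw [hq']
  conv_lhs => rw [eval_eq_sum_homogeneous hq]
  rw [map_sum, ← Fin.sum_univ_eq_sum_range
    (fun m => MvPolynomial.eval (t • ω) (MvPolynomial.homogeneousComponent m q))]
  refine Finset.sum_congr rfl fun m _ => ?_
  rw [eval_smul_of_homogeneous (MvPolynomial.homogeneousComponent_mem _ _), mul_comm]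

/-- The form of a covariant kernel at the origin. -/
theorem Covariant.exists_origin_coeff (hd : 0 < d)
    (hE : Covariant (bigSet d) (bigMul ν n) bigAct E)
    (hol : ∀ y, IsHolomorphicMap (MvPolynomial.restrictTotalDegree (Fin d) ℂ n) fun x => E x y)
    (herm : ∀ x y, E y x = star (E x y)) :
    ∃ k : Fin (n + 1) → ℝ, ∀ ζ ω : Z d, ‖ζ‖ < 1 → ‖ω‖ < 1 →
      E (origin d, ζ) (origin d, ω) =
        ∑ m : Fin (n + 1), (k m : ℂ) * (inner ℂ ω ζ : ℂ) ^ (m : ℕ) := by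
  have hJ := isMultiplier_big (d := d) ν n
  choose a ha using exists_coeff_line (n := n) hol
  have sq_ne : ∀ {ω : Z d}, ω ≠ 0 → (inner ℂ ω ω : ℂ) ≠ 0 := fun h => inner_self_ne_zero.mpr h
  have val : ∀ ζ ω : Z d, ‖ζ‖ < 1 → ‖ω‖ < 1 → ω ≠ 0 → E (origin d, ζ) (origin d, ω) =
      ∑ m : Fin (n + 1), a ω m * (inner ℂ ω ζ / inner ℂ ω ω : ℂ) ^ (m : ℕ) := by
    intro ζ ω hζ hω h0
    rw [← ha]
    exact hE.origin_proj hol hζ hω (div_mul_cancel₀ _ (sq_ne h0)) (sq_ne h0)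
  have left : ∀ (c : ℂ) (ζ ω : Z d), ‖c‖ ≤ 1 → ‖ζ‖ < 1 → ‖ω‖ < 1 →
      E (origin d, c • ζ) (origin d, ω) = E (origin d, ζ) (origin d, star c • ω) := by
    intro c ζ ω hc hζ hω
    have := hE.psmul_left hJ hol herm (origin_mem_bigSet hζ) (origin_mem_bigSet hω) hc
    rwa [psmul_origin, psmul_origin] at this
  have nr : ∀ {r : ℝ}, 0 < r → r ≤ 1 → ‖(r : ℂ)‖ ≤ 1 := fun h h' => by
    rwa [Complex.norm_real, Real.norm_eq_abs, abs_of_pos h]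
  have ns : ∀ {r : ℝ} {ω : Z d}, 0 < r → r ≤ 1 → ‖ω‖ < 1 → ‖(r : ℂ) • ω‖ < 1 :=
    fun {r ω} h h' hω => by
      rw [norm_smul]
      nlinarith [nr h h', norm_nonneg ω, norm_nonneg (r : ℂ)]
  have star_r : ∀ r : ℝ, star (r : ℂ) = r := Complex.conj_ofReal
  -- Moving the factor `r` of the second argument to the first compares the expansions along `r ω`
  -- and `ω`, as expected if `a ω m = k_m (ω|ω)^m`.
  have scale : ∀ (r : ℝ) (ω : Z d), 0 < r → r ≤ 1 → ‖ω‖ < 1 → ∀ m : Fin (n + 1),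
      a ((r : ℂ) • ω) m = a ω m * ((r : ℂ) ^ 2) ^ (m : ℕ) := by
    intro r ω hr hr1 hω m
    refine congrFun (coeff_unique (a := fun m => a ((r : ℂ) • ω) m)
      (b := fun m => a ω m * ((r : ℂ) ^ 2) ^ (m : ℕ)) fun t ht ht1 => ?_) m
    rw [← ha, ← star_r r, ← left _ _ _ (nr hr hr1) (by rw [star_r]; exact ns ht ht1 (ns hr hr1 hω))
      hω, star_r, smul_smul, smul_smul, ha]
    refine Finset.sum_congr rfl fun m _ => ?_
    ring
  -- Hermitian symmetry equates the expansions based at `ω` and at `ζ`. Scaling `ζ` by `r` gives an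
  -- identity of polynomials in `r`, and `(ζ|ω) ≠ 0` allows cancellation in each degree.
  have sym : ∀ ζ ω : Z d, ‖ζ‖ < 1 → ‖ω‖ < 1 → (inner ℂ ω ζ : ℂ) ≠ 0 → ∀ m : Fin (n + 1),
      a ω m / (inner ℂ ω ω : ℂ) ^ (m : ℕ) = star (a ζ m / (inner ℂ ζ ζ : ℂ) ^ (m : ℕ)) := by
    intro ζ ω hζ hω hs m
    have hζ0 : ζ ≠ 0 := fun h => hs (by rw [h, inner_zero_right])
    have hω0 : ω ≠ 0 := fun h => hs (by rw [h, inner_zero_left])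
    have h1 : (fun m : Fin (n + 1) => a ω m * (inner ℂ ω ζ / inner ℂ ω ω : ℂ) ^ (m : ℕ)) =
        fun m : Fin (n + 1) => star (a ζ m) * (inner ℂ ω ζ / inner ℂ ζ ζ : ℂ) ^ (m : ℕ) := by
      refine coeff_unique fun r hr hr1 => ?_
      have hrc : (r : ℂ) ≠ 0 := by exact_mod_cast hr.ne'
      have e1 := val ((r : ℂ) • ζ) ω (ns hr hr1 hζ) hω hω0
      have e2 := val ω ((r : ℂ) • ζ) hω (ns hr hr1 hζ) (smul_ne_zero hrc hζ0)
      rw [herm, e1, ← starRingEnd_apply] at e2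
      have e3 := congrArg (starRingEnd ℂ) e2
      rw [Complex.conj_conj] at e3
      calc _ = _ := Finset.sum_congr rfl fun m _ => by
              rw [inner_smul_right, mul_assoc, ← mul_pow]
              congr 2
              ring
        _ = _ := e3
        _ = _ := by
              rw [map_sum]
              refine Finset.sum_congr rfl fun m _ => ?_
              rw [scale r ζ hr hr1 hζ]
              simp only [inner_smul_left, inner_smul_right, map_mul, map_pow, map_div₀,
                Complex.conj_ofReal, inner_conj_symm, starRingEnd_apply (a ζ m)]
              rw [mul_assoc, mul_assoc, ← mul_pow, ← mul_pow]
              congr 2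
              field_simp
    have h2 := congrFun h1 m
    simp only [div_pow] at h2
    have hsm := pow_ne_zero (m : ℕ) hs
    have hn1 := pow_ne_zero (m : ℕ) (sq_ne hω0)
    have hn2 := pow_ne_zero (m : ℕ) (sq_ne hζ0)
    have h3 : star ((inner ℂ ζ ζ : ℂ) ^ (m : ℕ)) = (inner ℂ ζ ζ : ℂ) ^ (m : ℕ) := by
      rw [← starRingEnd_apply, map_pow, inner_conj_symm]
    rw [star_div₀, h3]
    field_simp at h2 ⊢
    exact h2
  -- A nonzero reference vector inside the ball; comparing `e` with itself shows that its normalized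
  -- coefficients are real.
  set e : Z d := (1 / 2 : ℂ) • EuclideanSpace.single (⟨0, hd⟩ : Fin d) (1 : ℂ) with he
  have hen : ‖e‖ = 1 / 2 := by
    rw [he, norm_smul]
    simp
  have he0 : e ≠ 0 := fun h => by
    rw [h, norm_zero] at hen
    norm_num at hen
  have he1 : ‖e‖ < 1 := by rw [hen]; norm_num
  have real : ∀ m : Fin (n + 1), star (a e m / (inner ℂ e e : ℂ) ^ (m : ℕ)) =
      a e m / (inner ℂ e e : ℂ) ^ (m : ℕ) := fun m => (sym e e he1 he1 (sq_ne he0) m).symm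
  have const : ∀ ω : Z d, ‖ω‖ < 1 → ω ≠ 0 → ∀ m : Fin (n + 1),
      a ω m / (inner ℂ ω ω : ℂ) ^ (m : ℕ) = a e m / (inner ℂ e e : ℂ) ^ (m : ℕ) := by
    intro ω hω hω0 m
    by_cases hs : (inner ℂ ω e : ℂ) = 0
    · have hs' : (inner ℂ e ω : ℂ) = 0 := by rw [← inner_conj_symm, hs, map_zero]
      -- When `ω` and `e` are orthogonal they are compared through `u`, which is orthogonal to
      -- neither.
      set u : Z d := (1 / 2 : ℂ) • (ω + e) with hu
      have hun : ‖u‖ < 1 := by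
        have h1 := norm_add_le ω e
        have h2 : ‖(1 / 2 : ℂ)‖ = 1 / 2 := by simp
        rw [hu, norm_smul, h2]
        linarith
      have h1 : (inner ℂ ω u : ℂ) ≠ 0 := by
        rw [hu, inner_smul_right, inner_add_right, hs, add_zero]
        exact mul_ne_zero (by norm_num) (sq_ne hω0)
      have h2 : (inner ℂ u e : ℂ) ≠ 0 := by
        rw [hu, inner_smul_left, inner_add_left, hs, zero_add]
        exact mul_ne_zero (by simp) (sq_ne he0)
      rw [sym u ω hun hω h1, sym e u he1 hun h2, star_star]
    · rw [sym e ω he1 hω hs, real]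
  refine ⟨fun m => (a e m / (inner ℂ e e : ℂ) ^ (m : ℕ)).re, ?_⟩
  have hre : ∀ m : Fin (n + 1), (((a e m / (inner ℂ e e : ℂ) ^ (m : ℕ)).re : ℝ) : ℂ) =
      a e m / (inner ℂ e e : ℂ) ^ (m : ℕ) := fun m => Complex.conj_eq_iff_re.mp (real m)
  have main : ∀ ζ ω : Z d, ‖ζ‖ < 1 → ‖ω‖ < 1 → ω ≠ 0 → E (origin d, ζ) (origin d, ω) =
      ∑ m : Fin (n + 1), (((a e m / (inner ℂ e e : ℂ) ^ (m : ℕ)).re : ℝ) : ℂ) *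
        (inner ℂ ω ζ : ℂ) ^ (m : ℕ) := by
    intro ζ ω hζ hω h0
    rw [val ζ ω hζ hω h0]
    refine Finset.sum_congr rfl fun m _ => ?_
    rw [hre, ← const ω hω h0 m, div_pow]
    ring
  intro ζ ω hζ hω
  -- For `ω = 0`, moving the scalar `0` across gives `E(ζ, 0) = E(0, e)`, which reduces to the
  -- nonzero case.
  by_cases h0 : ω = 0
  · have h1 := left 0 ζ e (by simp) hζ he1
    rw [star_zero, zero_smul, zero_smul] at h1
    rw [h0, ← h1, main 0 e (by simp) he1 he0, inner_zero_right, inner_zero_left]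
  · exact main ζ ω hζ hω h0

/-- Kernels that agree near the origin agree at the origin. -/
theorem eq_origin_of_small {V : Submodule ℂ (Poly d)} {E E' : Pt d → Pt d → ℂ}
    (hol : ∀ y, IsHolomorphicMap V fun x => E x y) (hol' : ∀ y, IsHolomorphicMap V fun x => E' x y)
    (herm : ∀ x y, E y x = star (E x y)) (herm' : ∀ x y, E' y x = star (E' x y))
    (h : ∀ ζ ω : Z d, ‖ζ‖ < 1 → ‖ω‖ < 1 →
      E (origin d, ζ) (origin d, ω) = E' (origin d, ζ) (origin d, ω)) (ζ ω : Z d) :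
    E (origin d, ζ) (origin d, ω) = E' (origin d, ζ) (origin d, ω) := by
  have hs : ∀ y, IsHolomorphicMap V fun x => E x y - E' x y := fun y =>
    show ((fun x => E x y) - fun x => E' x y) ∈ holMaps V from (holMaps V).sub_mem (hol y) (hol' y)
  have h1 : ∀ ζ ω : Z d, ‖ω‖ < 1 → E (origin d, ζ) (origin d, ω) = E' (origin d, ζ) (origin d, ω) :=
    fun ζ ω hω => sub_eq_zero.mp ((hs (origin d, ω)).eq_zero_of_small one_pos
      (fun η hη => sub_eq_zero.mpr (h η ω hη hω)) ζ)
  have h2 := sub_eq_zero.mp ((hs (origin d, ζ)).eq_zero_of_small one_pos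
    (fun η hη => sub_eq_zero.mpr (by rw [herm, herm', h1 ζ η hη])) ω)
  rw [herm (origin d, ω), herm' (origin d, ω), h2]

end Origin

end BallKernel
end

/-! ### Classification of the big spaces: existence, positivity and uniqueness of the weights -/

noncomputable section
namespace BallKernel
variable {d : ℕ}

section Classification

variable {ν : ℝ} {n : ℕ} {L : Fin (n + 1) → Type*} [∀ l, NormedAddCommGroup (L l)]
  [∀ l, InnerProductSpace ℂ (L l)] [∀ l, CompleteSpace (L l)] [∀ l, RKHS ℂ (L l) (Pt d) ℂ]

/-- Every choice of weights arises from a big space. -/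
theorem exists_bigSpace (hν : 0 < ν) (hL : ∀ l, IsLittleSpace (L l) ν l) {c : Fin (n + 1) → ℝ}
    (hc : ∀ l, 0 < c l) :
    ∃ (H : Type) (_ : NormedAddCommGroup H) (_ : InnerProductSpace ℂ H)
      (_ : CompleteSpace H) (_ : RKHS ℂ H (Pt d) ℂ),
      IsBigSpace H ν n ∧ IsWeightedSum H ν n c L := by
  obtain ⟨H, _, _, _, _, hH⟩ := exists_rkhs (psd_wK hL hc)
  exact ⟨H, _, _, ‹_›, _, isBigSpace_of_ker hν hL hc hH, isWeightedSum_of_ker hν hL hc hH⟩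

variable {H : Type*} [NormedAddCommGroup H] [InnerProductSpace ℂ H] [CompleteSpace H]
  [RKHS ℂ H (Pt d) ℂ]

/-- The kernel of a big space is a combination of the kernels of the summands. -/
theorem IsBigSpace.exists_ker_eq (hd : 0 < d) (hν : 0 < ν) (hL : ∀ l, IsLittleSpace (L l) ν l)
    (hH : IsBigSpace H ν n) : ∃ c : Fin (n + 1) → ℝ, ∀ x y, ker H x y = wK hL c x y := by
  have hol := ker_isHolomorphicMap hH.maps
  obtain ⟨k, hk⟩ := hH.covariant.exists_origin_coeff hd hol ker_symm
  -- Weights with the prescribed kernel at the origin; covariance spreads the equality to all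
  -- points. No sign of the weights is known yet.
  obtain ⟨c, hc⟩ := Matrix.mulVec_surjective_iff_isUnit.mpr (isUnit_kappaMatrix n ν) k
  refine ⟨c, hH.covariant.eq_of_origin (isMultiplier_big ν n) (covariant_wK hν hL c) hol
    (wK_isHolomorphicMap hL c) ker_symm (wK_symm hL c)
    (eq_origin_of_small hol (wK_isHolomorphicMap hL c) ker_symm (wK_symm hL c)
      fun ζ ω hζ hω => ?_)⟩
  rw [hk ζ ω hζ hω, wK_origin hν hL, hc]

theorem inner_linearCombination_eq {X M : Type*} [NormedAddCommGroup M] [InnerProductSpace ℂ M]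
    (v : X → M) (F : M) (a : X →₀ ℂ) :
    inner ℂ (Finsupp.linearCombination ℂ v a) F = a.sum fun x s => star s * inner ℂ (v x) F := by
  simp only [Finsupp.linearCombination_apply, Finsupp.sum, sum_inner, inner_smul_left,
    starRingEnd_apply]

/-- The weights of a big space are positive. -/
theorem IsBigSpace.weight_pos (hd : 0 < d) (hL : ∀ l, IsLittleSpace (L l) ν l)
    (hH : IsBigSpace H ν n) {c : Fin (n + 1) → ℝ} (hK : ∀ x y, ker H x y = wK hL c x y)
    (l : Fin (n + 1)) : 0 < c l := by
  set q : Poly d := MvPolynomial.X (⟨0, hd⟩ : Fin d) ^ (l : ℕ) with hq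
  have hqhom : q ∈ Hom d l := by
    rw [MvPolynomial.mem_homogeneousSubmodule]
    simpa using (MvPolynomial.isHomogeneous_X ℂ (⟨0, hd⟩ : Fin d)).pow (l : ℕ)
  obtain ⟨F, hF⟩ := hH.maps.2 1 q
    (homogeneous_le_restrictTotalDegree (Nat.lt_succ_iff.mp l.2) hqhom)
  obtain ⟨G, hG⟩ := (hL l).maps.2 1 q hqhom
  have hG0 : G ≠ 0 := by
    intro h
    have := hG (origin d) (EuclideanSpace.single (⟨0, hd⟩ : Fin d) (1 : ℂ))
    rw [h, RKHS.coe_zero] at this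
    simp [hq] at this
  -- The same map, constant in `z`, is seen in `H` as `F` and in `L l` as `G`; the intertwiner fixes
  -- it.
  have hev : ∀ x : Pt d, inner ℂ (kv H x) F = inner ℂ (iopVec (hL l) n x) G := by
    intro x
    have hc : ∀ (z w : D d) (ζ : Z d), G (z, ζ) = G (w, ζ) := fun z w ζ => by
      rw [hG, hG, map_one, map_one]
    rw [inner_kv, inner_iopVec, iop_of_const hc]
    exact (hF x.1 x.2).trans (hG x.1 x.2).symm
  -- On combinations of evaluation vectors this is Cauchy–Schwarz in `H`, with the squared norm
  -- there expressed through the kernel. Both sides are continuous in `u`, whatever the signs of the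
  -- `c j`.
  have hbound : ∀ u : lp L 2, ‖(inner ℂ (u l) G : ℂ)‖ ^ 2 ≤ ‖F‖ ^ 2 * ∑ j, c j * ‖u j‖ ^ 2 := by
    intro u
    -- Density is taken with all weights equal to `1`, because positivity of `c` is what is being
    -- proved.
    have hdense := denseRange_linearCombination (span_wVec hL (c := fun _ => 1) fun _ => one_pos)
    have hcoord : ∀ j, Continuous fun u : lp L 2 => u j := fun j =>
      (lp.evalCLM ℂ L 2 j).continuous
    refine hdense.induction_on (p := fun u : lp L 2 =>
      ‖(inner ℂ (u l) G : ℂ)‖ ^ 2 ≤ ‖F‖ ^ 2 * ∑ j, c j * ‖u j‖ ^ 2) u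
      (isClosed_le (((hcoord l).inner continuous_const).norm.pow 2) (continuous_const.mul
        (continuous_finsetSum _ fun j _ => continuous_const.mul ((hcoord j).norm.pow 2)))) fun a => ?_
    have hj : ∀ j, (Finsupp.linearCombination ℂ (wVec hL fun _ => 1) a : lp L 2) j =
        Finsupp.linearCombination ℂ (iopVec (hL j) n) a := by
      intro j
      have := map_finsuppSum (lp.evalCLM ℂ L 2 j) a fun x s => s • wVec hL (fun _ => 1) x
      simp only [Finsupp.linearCombination_apply]
      refine this.trans ?_
      refine Finsupp.sum_congr fun x _ => ?_
      rw [map_smul]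
      congr 1
      change wVec hL (fun _ => 1) x j = _
      rw [wVec_apply]
      simp
    have h1 : (inner ℂ (Finsupp.linearCombination ℂ (iopVec (hL l) n) a) G : ℂ) =
        inner ℂ (Finsupp.linearCombination ℂ (kv H) a) F := by
      rw [inner_linearCombination_eq, inner_linearCombination_eq]
      simp only [hev]
    have h2 : ‖Finsupp.linearCombination ℂ (kv H : Pt d → H) a‖ ^ 2 =
        ∑ j, c j * ‖Finsupp.linearCombination ℂ (iopVec (hL j) n) a‖ ^ 2 := by
      have h3 : ((‖Finsupp.linearCombination ℂ (kv H : Pt d → H) a‖ ^ 2 : ℝ) : ℂ) =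
          ((∑ j, c j * ‖Finsupp.linearCombination ℂ (iopVec (hL j) n) a‖ ^ 2 : ℝ) : ℂ) := by
        have h4 : ∀ {M : Type _} [NormedAddCommGroup M] [InnerProductSpace ℂ M] (w : M),
            ((‖w‖ ^ 2 : ℝ) : ℂ) = inner ℂ w w := fun w => by
          rw [inner_self_eq_norm_sq_to_K]
          simp
        rw [h4, inner_linearCombination]
        simp only [← ker_eq_inner, hK, wK]
        push_cast
        have h5 : ∀ j, (‖Finsupp.linearCombination ℂ (iopVec (hL j) n) a‖ : ℂ) ^ 2 =
            inner ℂ (Finsupp.linearCombination ℂ (iopVec (hL j) n) a)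
              (Finsupp.linearCombination ℂ (iopVec (hL j) n) a) := fun j => by
          rw [inner_self_eq_norm_sq_to_K]
          simp
        simp only [h5, inner_linearCombination, Finsupp.sum, Finset.mul_sum, Finset.sum_mul]
        rw [Finset.sum_comm (s := Finset.univ)]
        refine Finset.sum_congr rfl fun x _ => ?_
        rw [Finset.sum_comm (s := Finset.univ)]
        refine Finset.sum_congr rfl fun y _ => Finset.sum_congr rfl fun j _ => ?_
        ring
      exact_mod_cast h3
    simp only [hj]
    rw [h1, ← h2]
    have h6 := norm_inner_le_norm (𝕜 := ℂ) (Finsupp.linearCombination ℂ (kv H : Pt d → H) a) F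
    calc _ ≤ (‖Finsupp.linearCombination ℂ (kv H : Pt d → H) a‖ * ‖F‖) ^ 2 :=
          pow_le_pow_left₀ (norm_nonneg _) h6 2
      _ = _ := by ring
  -- At the vector with `G` as its only component the bound reads `‖G‖⁴ ≤ ‖F‖² c_l ‖G‖²`, which
  -- excludes `c_l ≤ 0`.
  have h := hbound (lpSingle l G)
  rw [lpSingle_self, inner_self_eq_norm_sq_to_K, Finset.sum_eq_single l
    (fun j _ hj => by rw [lpSingle_ne G hj]; simp) (by simp), lpSingle_self] at h
  have hGn : 0 < ‖G‖ := norm_pos_iff.mpr hG0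
  have h' : (‖G‖ ^ 2) ^ 2 ≤ ‖F‖ ^ 2 * (c l * ‖G‖ ^ 2) := by simpa using h
  by_contra! hc
  have h7 : 0 < (‖G‖ ^ 2) ^ 2 := by positivity
  have h8 : ‖F‖ ^ 2 * (c l * ‖G‖ ^ 2) ≤ 0 :=
    mul_nonpos_of_nonneg_of_nonpos (by positivity) (mul_nonpos_of_nonpos_of_nonneg hc (by positivity))
  linarith

/-- Weights with the same kernel agree. -/
theorem weights_unique (hd : 0 < d) (hν : 0 < ν) (hL : ∀ l, IsLittleSpace (L l) ν l)
    {b c : Fin (n + 1) → ℝ} (h : ∀ x y, wK hL b x y = wK hL c x y) : b = c := by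
  refine Matrix.mulVec_injective_iff_isUnit.mpr (isUnit_kappaMatrix n ν) ?_
  set e : Z d := EuclideanSpace.single (⟨0, hd⟩ : Fin d) (1 : ℂ) with he
  have hee : (inner ℂ e e : ℂ) = 1 := by simp [he]
  have h1 := coeff_unique (a := fun m => (((kappaMatrix n ν).mulVec b m : ℝ) : ℂ))
    (b := fun m => (((kappaMatrix n ν).mulVec c m : ℝ) : ℂ)) fun r _ _ => by
      have h2 := h (origin d, (r : ℂ) • e) (origin d, e)
      rwa [wK_origin hν, wK_origin hν, inner_smul_right, hee, mul_one] at h2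
  ext m
  exact_mod_cast congrFun h1 m

end Classification

end BallKernel
end

theorem mainTheorem7 (d n : ℕ) (hd : 0 < d) (ν : ℝ) (hν : 0 < ν) :
    -- the little spaces exist
    (∀ l : Fin (n + 1), ∃ (L : Type) (_ : NormedAddCommGroup L) (_ : InnerProductSpace ℂ L)
      (_ : CompleteSpace L) (_ : RKHS ℂ L (BallKernel.Pt d) ℂ),
      BallKernel.IsLittleSpace L ν l) ∧
    ∀ (L : Fin (n + 1) → Type*) [∀ l, NormedAddCommGroup (L l)]
      [∀ l, InnerProductSpace ℂ (L l)] [∀ l, CompleteSpace (L l)]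
      [∀ l, RKHS ℂ (L l) (BallKernel.Pt d) ℂ],
      (∀ l, BallKernel.IsLittleSpace (L l) ν l) →
      -- every choice of weights `c l > 0` occurs
      (∀ c : Fin (n + 1) → ℝ, (∀ l, 0 < c l) →
        ∃ (H : Type) (_ : NormedAddCommGroup H) (_ : InnerProductSpace ℂ H)
          (_ : CompleteSpace H) (_ : RKHS ℂ H (BallKernel.Pt d) ℂ),
          BallKernel.IsBigSpace H ν n ∧ BallKernel.IsWeightedSum H ν n c L) ∧
      -- every big space with a covariant kernel arises from exactly one choice of weights,
      -- and its kernel at the origin has the stated form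
      ∀ (H : Type*) [NormedAddCommGroup H] [InnerProductSpace ℂ H] [CompleteSpace H]
        [RKHS ℂ H (BallKernel.Pt d) ℂ],
        BallKernel.IsBigSpace H ν n →
        (∃! c : Fin (n + 1) → ℝ, (∀ l, 0 < c l) ∧ BallKernel.IsWeightedSum H ν n c L) ∧
        ∀ c : Fin (n + 1) → ℝ, (∀ l, 0 < c l) → BallKernel.IsWeightedSum H ν n c L →
          ∀ ζ ω : BallKernel.Z d,
            BallKernel.ker H (BallKernel.origin d, ζ) (BallKernel.origin d, ω) =
              ∑ m : Fin (n + 1), (inner ℂ ω ζ) ^ (m : ℕ) *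
                ∑ l ∈ Finset.Iic m,
                  ((BallKernel.kappa n ν l m * (c l / ((l : ℕ).factorial : ℝ)) : ℝ) : ℂ) := by
  refine ⟨fun l => BallKernel.exists_littleSpace hν l, fun L _ _ _ _ hL =>
    ⟨fun c hc => BallKernel.exists_bigSpace hν hL hc, fun H _ _ _ _ hH => ⟨?_, ?_⟩⟩⟩
  · obtain ⟨c, hc⟩ := hH.exists_ker_eq hd hν hL
    have hpos := hH.weight_pos hd hL hc
    refine ⟨c, ⟨hpos, BallKernel.isWeightedSum_of_ker hν hL hpos hc⟩, fun b ⟨hb, hb'⟩ => ?_⟩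
    exact BallKernel.weights_unique hd hν hL fun x y => by rw [← hb'.ker_eq hν hL hH hb, hc]
  · intro c hc hcs ζ ω
    rw [hcs.ker_eq hν hL hH hc, BallKernel.wK_origin hν]
    refine Finset.sum_congr rfl fun m _ => ?_
    rw [BallKernel.kappaMatrix_mulVec, Complex.ofReal_sum, mul_comm]
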